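/- **Setting.** Let $d\ge 2$, let $Z_1,\dots,Z_m\in\mathbb R^d$ be orthonormal, and let $F(u)=\sum_{i=1}^m g_i(\langle u,Z_i\rangle)$ for $u$ in the closed unit ball $\overline B$ of $\mathbb R^d$, where each $g_i\in C^2([-1,1])$ is even or odd, $g_i(0)=0$, the right derivative of $x\mapsto g_i(\sqrt x)$ at $0$ is $0$, and $\frac{d^2}{dx^2}g_i(\sqrt x)$ is either everywhere positive or everywhere negative on $(0,1]$. Put $h_i(x)=g_i(\operatorname{sign}(x)\sqrt{|x|})$, and suppose that $F$ is $(\alpha,\beta,\gamma,\delta)$-robust: $\alpha,\beta,\gamma,\delta>0$ and $\beta x^{\delta-1}\le |h_i''(x)|\le \alpha x^{\gamma-1}$ for all $x\in(0,1]$ and all $i$. Let $\epsilon>0$ and let $\widehat{\nabla F}$ be a (measurable) vector field with $\|\widehat{\nabla F}(u)-\nabla F(u)\|\le\epsilon$ for all $u\in\overline B$. Let $\hat G(u)=\widehat{\nabla F}(u)/\|\widehat{\nabla F}(u)\|$ if $\widehat{\nabla F}(u)\ne 0$ and $\hat G(u)=u$ otherwise. **Algorithm.** $\textsc{FindBasisElement}(\{\mu_1,\dots,\mu_k\},\sigma)$,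 with parameters $N_1,N_2,I\in\mathbb N$: choose orthonormal vectors $x_1,\dots,x_{d-k}$ in $\operatorname{span}(\mu_1,\dots,\mu_k)^\perp$; choose an index $l$ maximising $\|\widehat{\nabla F}(x_l)\|$; set $u\leftarrow\hat G(x_l)$ and then $u\leftarrow\hat G^{N_1}(u)$. Repeat $I$ times: draw $x$ (independently of the past draws) uniformly from $\sigma S^{d-1}\cap u^\perp$, set $w\leftarrow u\cos\|x\|+\frac{x}{\|x\|}\sin\|x\|$ and $u\leftarrow\hat G^{N_2}(w)$. Return $u$. **Notation.** Let $$\tau=\Big[\tfrac{\beta\gamma}{16\alpha\delta}m^{-\delta}\Big]^{\frac1{2\gamma}},\qquad N_{sc}=\Big\lceil\log_{1+2\gamma}\Big(\log_2\tfrac{\beta\gamma}{8\alpha\delta}+2\gamma\log_2\tfrac{\beta}{4\delta\epsilon}\Big)\Big\rceil,\qquad \eta_0=\tfrac{\sigma}{\sqrt d}\Big(\tfrac{\beta\gamma}{\alpha\delta m^\delta}\Big)^{\frac1\gamma}\tau^2,$$ $$N_{spread}(\eta)=\Big\lceil\tfrac{3}{2\eta}\Big(\tfrac{\alpha\delta}{\beta\gamma}\Big)^{\frac\delta\gamma}m^{\frac\delta\gamma(\delta-\gamma)}\Big[\tfrac1\gamma\ln\tfrac{4\alpha\delta}{\beta\gamma}+\tfrac\delta\gamma\ln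 m\Big]\Big\rceil+2N_{sc},$$ $$E(\eta)=\tfrac{9}{256}\,\tfrac\beta\delta\Big(\tfrac{\beta\gamma}{\alpha\delta}\Big)^{\frac{2\delta+1}{2\gamma}}m^{-\frac\delta\gamma(\frac12+\delta-\gamma)-\delta}\,\tau^{2+2\delta}\,\eta .$$ **Theorem.** There are universal constants $C_0,C_1,C_2>0$ such that the following holds in every such setting. Let $0\le k<m$ and $p\in(0,1)$, and suppose that $$0<\sigma\le\frac{\tau^2}{6\sqrt{2d(1+2\delta)}},\qquad \epsilon\le C_0\,E(\eta_0)\,d^{-\delta},\qquad N_1\ge 2N_{sc},\qquad N_2\ge 2N_{sc}+C_1N_{spread}(\eta_0),\qquad I\ge C_2\,m\lceil\ln(m/p)\rceil .$$ Let $\pi$ be a permutation of $\{1,\dots,m\}$, let $s_1,\dots,s_k\in\{\pm1\}$, and suppose that $\|s_i\mu_i-Z_{\pi(i)}\|\le 4\sqrt2\,\delta\epsilon/\beta$ for each $i\le k$. Then, whatever admissible $x_1,\dots,x_{d-k}$ and maximising index $l$ are chosen, with probability at least $1-p$ the vector $\mu_{k+1}$ returned by $\textsc{FindBasisElement}(\{\mu_1,\dots,\mu_k\},\sigma)$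 satisfies $\|s_{k+1}\mu_{k+1}-Z_{\pi(j)}\|\le 4\sqrt2\,\delta\epsilon/\beta$ for some $s_{k+1}\in\{\pm1\}$ and some $j\in\{k+1,\dots,m\}$. -/

import Mathlib

open MeasureTheory ProbabilityTheory Set
open scoped ENNReal

noncomputable section

namespace HiddenBasis

/-- Euclidean space `ℝ^d`. -/
abbrev Vec (d : ℕ) := EuclideanSpace ℝ (Fin d)

/-! ### Basis encoding functions -/

/-- `h(x) = g(sign(x) √|x|)`. -/
def hOf (g : ℝ → ℝ) (x : ℝ) : ℝ := g (Real.sign x * √|x|)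

/-- The second derivative of `h` on `(0, 1]` (one-sided at `1`). -/
def hSecond (g : ℝ → ℝ) (x : ℝ) : ℝ := iteratedDerivWithin 2 (hOf g) (Ioc 0 1) x

/-- Admissible contrast functions `g : [-1, 1] → ℝ` (values outside `[-1, 1]` are irrelevant). -/
structure IsContrast (g : ℝ → ℝ) : Prop where
  contDiff : ContDiffOn ℝ 2 g (Icc (-1) 1)
  even_or_odd : (∀ x ∈ Icc (-1 : ℝ) 1, g (-x) = g x) ∨ (∀ x ∈ Icc (-1 : ℝ) 1, g (-x) = -g x)
  strict_convexity : (∀ x ∈ Ioc (0 : ℝ) 1, 0 < hSecond g x) ∨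
    (∀ x ∈ Ioc (0 : ℝ) 1, 0 < -hSecond g x)
  right_deriv_zero : HasDerivWithinAt (fun x : ℝ => g (√x)) 0 (Ioi 0) 0
  zero : g 0 = 0

/-- `F(u) = ∑ᵢ gᵢ(⟨u, Zᵢ⟩)`; it is only used on the closed unit ball. -/
def befSum {d m : ℕ} (g : Fin m → ℝ → ℝ) (Z : Fin m → Vec d) (u : Vec d) : ℝ :=
  ∑ i, g i (inner ℝ u (Z i))

/-- The gradient of `F` on its domain, the closed unit ball. -/
def befGrad {d m : ℕ} (g : Fin m → ℝ → ℝ) (Z : Fin m → Vec d) (u : Vec d) : Vec d :=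
  gradientWithin (befSum g Z) (Metric.closedBall 0 1) u

/-- The data `(gᵢ, Zᵢ)` define a basis encoding function: orthonormal directions and
admissible contrasts. -/
structure IsBEF {d m : ℕ} (g : Fin m → ℝ → ℝ) (Z : Fin m → Vec d) : Prop where
  orthonormal : Orthonormal ℝ Z
  contrast : ∀ i, IsContrast (g i)

/-- `(α, β, γ, δ)`-robustness: `β x^(δ-1) ≤ |hᵢ''(x)| ≤ α x^(γ-1)` on `(0, 1]`. -/
structure IsRobust {m : ℕ} (g : Fin m → ℝ → ℝ) (α β γ δ : ℝ) : Prop where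
  α_pos : 0 < α
  β_pos : 0 < β
  γ_pos : 0 < γ
  δ_pos : 0 < δ
  lower : ∀ i, ∀ x ∈ Ioc (0 : ℝ) 1, β * x ^ (δ - 1) ≤ |hSecond (g i) x|
  upper : ∀ i, ∀ x ∈ Ioc (0 : ℝ) 1, |hSecond (g i) x| ≤ α * x ^ (γ - 1)

/-- `Fh` is an `ε`-approximation of `∇F` on the closed unit ball. -/
def IsGradApprox {d m : ℕ} (g : Fin m → ℝ → ℝ) (Z : Fin m → Vec d) (Fh : Vec d → Vec d)
    (ε : ℝ) : Prop :=
  ∀ u ∈ Metric.closedBall (0 : Vec d) 1, ‖Fh u - befGrad g Z u‖ ≤ ε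

/-! ### The algorithm -/

open scoped Classical in
/-- The approximate gradient iteration map `Ĝ`. -/
def gHat {d : ℕ} (Fh : Vec d → Vec d) (u : Vec d) : Vec d :=
  if Fh u ≠ 0 then ‖Fh u‖⁻¹ • Fh u else u

/-- `GI-Loop(u, N)`: apply `Ĝ` to `u` exactly `N` times. -/
def giLoop {d : ℕ} (Fh : Vec d → Vec d) (u : Vec d) (N : ℕ) : Vec d := (gHat Fh)^[N] u

/-- The exponential map of the sphere, `w = u cos ‖x‖ + (x / ‖x‖) sin ‖x‖` (it is `u` at `x = 0`). -/
def sphereExp {d : ℕ} (u x : Vec d) : Vec d :=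
  Real.cos ‖x‖ • u + Real.sin ‖x‖ • (‖x‖⁻¹ • x)

/-- Orthogonal projection of `z` onto `u^⊥`, rescaled to norm `σ`. -/
def toOrthSphere {d : ℕ} (σ : ℝ) (u z : Vec d) : Vec d :=
  σ • (‖(ℝ ∙ u)ᗮ.starProjection z‖⁻¹ • (ℝ ∙ u)ᗮ.starProjection z)

/-- The uniform distribution on `σ S^{d-1} ∩ u^⊥`: the direction of a standard Gaussian vector
of `u^⊥`, rescaled to norm `σ`. -/
def jumpLaw {d : ℕ} (σ : ℝ) (u : Vec d) : Measure (Vec d) :=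
  (stdGaussian (Vec d)).map (toOrthSphere σ u)

lemma toOrthSphere_map {d : ℕ} (σ : ℝ) (u z : Vec d) (L : Vec d ≃ₗᵢ[ℝ] Vec d) (hL : L u = u) :
    L (toOrthSphere σ u z) = toOrthSphere σ u (L z) := by
  have h : (ℝ ∙ u)ᗮ.starProjection (L z) = L ((ℝ ∙ u)ᗮ.starProjection z) := by
    have h1 : inner ℝ u (L z) = inner ℝ u z := by
      conv_lhs => rw [← hL]
      exact L.inner_map_map u z
    rw [Submodule.starProjection_orthogonal_val, Submodule.starProjection_orthogonal_val,
      Submodule.starProjection_singleton, Submodule.starProjection_singleton, h1]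
    simp [hL]
  simp only [toOrthSphere, h, map_smul, L.norm_map]

lemma measurable_toOrthSphere {d : ℕ} (σ : ℝ) (u : Vec d) : Measurable (toOrthSphere σ u) := by
  unfold toOrthSphere; fun_prop

/-- `jumpLaw σ u` is the uniform distribution on `σ S^{d-1} ∩ u^⊥`: it is a probability measure,
it is carried by this sphere, and it is invariant under all isometries of the sphere. -/
theorem jumpLaw_isUniform {d : ℕ} (hd : 2 ≤ d) {σ : ℝ} (hσ : 0 < σ) {u : Vec d} (hu : ‖u‖ = 1) :
    IsProbabilityMeasure (jumpLaw σ u) ∧ (∀ᵐ x ∂(jumpLaw σ u), ‖x‖ = σ ∧ inner ℝ u x = 0) ∧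
      ∀ L : Vec d ≃ₗᵢ[ℝ] Vec d, L u = u → (jumpLaw σ u).map L = jumpLaw σ u := by
  have hm := measurable_toOrthSphere σ u
  refine ⟨Measure.isProbabilityMeasure_map hm.aemeasurable, ?_, fun L hL => ?_⟩
  · have hS : MeasurableSet {x : Vec d | ‖x‖ = σ ∧ inner ℝ u x = 0} :=
      ((isClosed_eq continuous_norm continuous_const).inter
        (isClosed_eq (by fun_prop) continuous_const)).measurableSet
    rw [jumpLaw, ae_map_iff hm.aemeasurable hS]
    obtain ⟨e, he, he1⟩ : ∃ e ∈ (ℝ ∙ u)ᗮ, ‖e‖ = 1 := by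
      have hne : (ℝ ∙ u)ᗮ ≠ ⊥ := by
        intro h0
        rw [Submodule.orthogonal_eq_bot_iff] at h0
        have := finrank_span_singleton (K := ℝ) (v := u) (by rintro rfl; simp at hu)
        rw [h0, finrank_top, finrank_euclideanSpace_fin] at this
        omega
      obtain ⟨e, he, he0⟩ := Submodule.exists_mem_ne_zero_of_ne_bot hne
      exact ⟨‖e‖⁻¹ • e, Submodule.smul_mem _ _ he, norm_smul_inv_norm (𝕜 := ℝ) he0⟩
    have hlaw : (stdGaussian (Vec d)).map (innerSL ℝ e) = gaussianReal 0 1 := by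
      rw [IsGaussian.map_eq_gaussianReal, integral_strongDual_stdGaussian,
        variance_dual_stdGaussian, innerSL_apply_norm, he1]
      simp
    have hae : ∀ᵐ z ∂(stdGaussian (Vec d)), innerSL ℝ e z ≠ 0 := by
      have hn : NullSingletonClass (gaussianReal 0 1) :=
        nullSingletonClass_gaussianReal one_ne_zero
      have : ∀ᵐ t ∂((stdGaussian (Vec d)).map (innerSL ℝ e)), t ≠ 0 := by
        rw [hlaw]; exact Measure.ae_ne (gaussianReal 0 1) 0
      exact ae_of_ae_map (f := innerSL ℝ e) (by fun_prop) this
    filter_upwards [hae] with z hz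
    have hP : (ℝ ∙ u)ᗮ.starProjection z ≠ 0 := by
      intro h0
      apply hz
      have : inner ℝ ((ℝ ∙ u)ᗮ.starProjection e) z = inner ℝ e ((ℝ ∙ u)ᗮ.starProjection z) :=
        Submodule.inner_starProjection_left_eq_right _ _ _
      rw [h0, inner_zero_right, Submodule.starProjection_eq_self_iff.2 he] at this
      simpa using this
    constructor
    · rw [toOrthSphere, norm_smul, norm_smul, norm_inv, norm_norm,
        inv_mul_cancel₀ (norm_ne_zero_iff.2 hP), mul_one, Real.norm_of_nonneg hσ.le]
    · have := Submodule.mem_orthogonal_singleton_iff_inner_right.1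
        ((ℝ ∙ u)ᗮ.starProjection_apply_mem z)
      rw [toOrthSphere, inner_smul_right, inner_smul_right, this, mul_zero, mul_zero]
  · have hc : L ∘ toOrthSphere σ u = toOrthSphere σ u ∘ L :=
      funext fun z => toOrthSphere_map σ u z L hL
    rw [jumpLaw, Measure.map_map (by fun_prop) hm, hc, ← Measure.map_map hm (by fun_prop),
      stdGaussian_map]

/-- The law of `u` after the given number of iterations of the main loop started at `u₀`. In each
iteration `x` is drawn afresh, uniformly from `σ S^{d-1} ∩ u^⊥`, and then
`u ← GI-Loop(exp_u(x), N₂)`. -/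
def mainLoopLaw {d : ℕ} (Fh : Vec d → Vec d) (σ : ℝ) (N₂ : ℕ) (u₀ : Vec d) :
    ℕ → Measure (Vec d)
  | 0 => Measure.dirac u₀
  | n + 1 => (mainLoopLaw Fh σ N₂ u₀ n).bind fun u =>
      (jumpLaw σ u).map fun x => giLoop Fh (sphereExp u x) N₂

/-- `P` is the law of the output of `FindBasisElement({μ₁, …, μ_k}, σ)` with parameters
`N₁, N₂, I`, for some choice of the orthonormal vectors `x₁, …, x_{d-k}` of `span(μ)^⊥` and some
maximiser `j` of `‖Fh (x_i)‖`; the algorithm leaves these choices open. -/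
def IsFindBasisElementLaw {d k : ℕ} (Fh : Vec d → Vec d) (σ : ℝ) (N₁ N₂ I : ℕ)
    (μ : Fin k → Vec d) (P : Measure (Vec d)) : Prop :=
  ∃ x : Fin (d - k) → Vec d, Orthonormal ℝ x ∧
    (∀ i, x i ∈ (Submodule.span ℝ (range μ))ᗮ) ∧
    ∃ j, (∀ i, ‖Fh (x i)‖ ≤ ‖Fh (x j)‖) ∧
      P = mainLoopLaw Fh σ N₂ (giLoop Fh (gHat Fh (x j)) N₁) I

/-! ### The expressions in the parameter bounds -/

/-- The threshold `τ = [βγ/(16αδ) m^{-δ}]^{1/(2γ)}`. -/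
def tau (α β γ δ : ℝ) (m : ℕ) : ℝ :=
  (β * γ / (16 * α * δ) * (m : ℝ) ^ (-δ)) ^ (1 / (2 * γ))

/-- `N_sc = ⌈log_{1+2γ}(log₂(βγ/(8αδ)) + 2γ log₂(β/(4δε)))⌉`. -/
def nSmall (α β γ δ ε : ℝ) : ℤ :=
  ⌈Real.logb (1 + 2 * γ)
    (Real.logb 2 (β * γ / (8 * α * δ)) + 2 * γ * Real.logb 2 (β / (4 * δ * ε)))⌉

/-- `N_spread(η) = ⌈3/(2η) (αδ/(βγ))^{δ/γ} m^{(δ/γ)(δ-γ)} [(1/γ) ln(4αδ/(βγ)) + (δ/γ) ln m]⌉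
+ 2 N_sc`. -/
def nSpread (α β γ δ ε : ℝ) (m : ℕ) (η : ℝ) : ℤ :=
  ⌈3 / (2 * η) * (α * δ / (β * γ)) ^ (δ / γ) * (m : ℝ) ^ (δ / γ * (δ - γ)) *
    (1 / γ * Real.log (4 * α * δ / (β * γ)) + δ / γ * Real.log m)⌉ + 2 * nSmall α β γ δ ε

/-- `E(η) = (9/256) (β/δ) (βγ/(αδ))^{(2δ+1)/(2γ)} m^{-(δ/γ)(1/2+δ-γ)-δ} τ^{2+2δ} η`. -/
def epsDiverge (α β γ δ : ℝ) (m : ℕ) (η : ℝ) : ℝ :=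
  9 / 256 * (β / δ) * (β * γ / (α * δ)) ^ ((2 * δ + 1) / (2 * γ)) *
    (m : ℝ) ^ (-(δ / γ) * (1 / 2 + δ - γ) - δ) * tau α β γ δ m ^ (2 + 2 * δ) * η

/-- `η₀ = (σ/√d) (βγ/(αδ m^δ))^{1/γ} τ²`. -/
def etaZero (α β γ δ : ℝ) (m d : ℕ) (σ : ℝ) : ℝ :=
  σ / √(d : ℝ) * (β * γ / (α * δ * (m : ℝ) ^ δ)) ^ (1 / γ) * tau α β γ δ m ^ 2

end HiddenBasis

end

open HiddenBasis

/-! Let `ψᵢ` be the derivative of `x ↦ gᵢ(√x)`, up to sign. The `i`-th coordinate of `∇F(u)` has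
absolute value `2|uᵢ| ψᵢ(uᵢ²)`, so the noiseless iteration multiplies each `|uᵢ|` by `ψᵢ(uᵢ²)` and
renormalises: a power iteration whose multipliers grow with the coordinates. Robustness pinches the
increments of `ψᵢ` between those of `a x^δ` and `A x^γ`, where `a = β/δ` and `A = α/γ`. Progress is
measured by `resid Z B u`, the distance from `u` to the span of the active directions `Z i`, `i ∈
B`.

Three effects combine. Contraction: the gradient has norm about `2 a m^(-δ)` or more
(`norm_field_ge`), while a coordinate below `τ` is multiplied by at most `2 A τ^(2γ)`, sixteen times
less than `2 a m^(-δ)`. Hence inactive coordinates shrink geometrically down to the noise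
(`Tame.step`), and superexponentially once a single direction is active
(`resid_singleton_iterate_le`). Spreading: for each `B` there is a point of the simplex at which all
`ψᵢ` agree (`exists_balanced`). It consists of the squared coordinates of a fixed point of the
iteration, and it repels: the gap between the logarithms of the squared coordinates, taken relative
to it, grows by a fixed amount per step while all active coordinates exceed `τ` (`Separated.step`).
Such a gap is bounded, so some active coordinate falls below `τ` and contraction then removes it
(`exists_erase_resid_le`). Jump: with probability at least `1/20` the random jump opens the initial
gap that spreading needs, unless it already makes an active coordinate small (`separated_of_jump`,
`roundLaw_ge`).

So a round keeps the active set and, if it has at least two elements, shrinks it with probability at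
least `1/20` (`roundLaw_settled`, `roundLaw_drop`). The expected number of superfluous directions
decays by the factor `1 - 1/(20m)` per round (`law_ge`), and a further round started with one active
direction ends at residual at most `4ε/a`, which is the claimed accuracy up to the factor `√2`. The
first gradient step starts this process near the span of the directions not yet found
(`resid_start_le`). It remains to derive the inequalities between the scales from the bounds on `σ`
and `ε` (`Admissible.scales`) and to compare the iteration counts (`Admissible.exists_counts`). -/

noncomputable section

namespace HiddenBasis

open Filter Topology

/-! ### Profiles of contrast functions -/

/-- `ψ` increases on `[0, 1]` at least as fast as `a x^δ` and at most as fast as `A x^γ`. -/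
structure IsProfile (ψ : ℝ → ℝ) (a A γ δ : ℝ) : Prop where
  continuousOn : ContinuousOn ψ (Icc 0 1)
  zero : ψ 0 = 0
  lower : MonotoneOn (fun x => ψ x - a * x ^ δ) (Icc 0 1)
  upper : MonotoneOn (fun x => A * x ^ γ - ψ x) (Icc 0 1)

/-- The derivative of `x ↦ g(√x)`. -/
def sqrtDeriv (g : ℝ → ℝ) (x : ℝ) : ℝ := derivWithin g (Icc (-1) 1) (√x) / (2 * √x)

/-! ### Regularity of `g'` and of the derivative of `x ↦ g(√x)` -/

theorem uniqueDiffOn_Icc_neg_one : UniqueDiffOn ℝ (Icc (-1 : ℝ) 1) :=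
  uniqueDiffOn_Icc (by norm_num)

theorem IsContrast.hasDerivWithinAt {g : ℝ → ℝ} (hg : IsContrast g) {t : ℝ}
    (ht : t ∈ Icc (-1 : ℝ) 1) :
    HasDerivWithinAt g (derivWithin g (Icc (-1) 1) t) (Icc (-1) 1) t :=
  ((hg.contDiff.differentiableOn (by norm_num)) t ht).hasDerivWithinAt

theorem IsContrast.differentiableOn_deriv {g : ℝ → ℝ} (hg : IsContrast g) :
    DifferentiableOn ℝ (derivWithin g (Icc (-1) 1)) (Icc (-1) 1) :=
  (hg.contDiff.derivWithin (m := 1) uniqueDiffOn_Icc_neg_one (by norm_num)).differentiableOn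
    (by norm_num)

/-- On the positive axis `g` is `x ↦ g(√x)` composed with `t ↦ t²`, and both factors have right
derivative `0` at the origin. As a consequence `g'(√x)/(2√x)` is half a difference quotient of `g'`
at `0`. -/
theorem IsContrast.deriv_zero {g : ℝ → ℝ} (hg : IsContrast g) :
    derivWithin g (Icc (-1) 1) 0 = 0 := by
  have h1 : HasDerivWithinAt g (derivWithin g (Icc (-1) 1) 0) (Ioi 0) 0 :=
    ((hg.hasDerivWithinAt (by norm_num)).hasDerivAt
      (Icc_mem_nhds (by norm_num) (by norm_num))).hasDerivWithinAt
  have hsq : HasDerivWithinAt (fun t : ℝ => t ^ 2) 0 (Ioi 0) 0 := by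
    simpa using (hasDerivAt_pow 2 (0 : ℝ)).hasDerivWithinAt (s := Ioi 0)
  have h0 : HasDerivWithinAt (fun x : ℝ => g (√x)) 0 (Ioi 0) ((fun t : ℝ => t ^ 2) 0) := by
    simpa using hg.right_deriv_zero
  have h2 := HasDerivWithinAt.comp (h := fun t : ℝ => t ^ 2) (0 : ℝ) h0 hsq (fun t ht => by
    have : (0 : ℝ) < t := ht
    show (0 : ℝ) < t ^ 2
    positivity)
  have h3 : HasDerivWithinAt g 0 (Ioi 0) 0 := by
    have := h2.congr (f₁ := g) (fun t ht => by
      have : (0 : ℝ) < t := ht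
      simp [Real.sqrt_sq this.le]) (by simp)
    simpa using this
  exact (uniqueDiffWithinAt_Ioi 0).eq_deriv _ h1 h3

theorem sqrt_mem_Ioo {x : ℝ} (hx : x ∈ Ioo (0 : ℝ) 1) : √x ∈ Ioo (0 : ℝ) 1 :=
  ⟨Real.sqrt_pos.2 hx.1, by rw [Real.sqrt_lt' one_pos]; simpa using hx.2⟩

theorem sqrt_mem_Ioc {x : ℝ} (hx : x ∈ Ioc (0 : ℝ) 1) : √x ∈ Ioc (0 : ℝ) 1 :=
  ⟨Real.sqrt_pos.2 hx.1, Real.sqrt_le_one.2 hx.2⟩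

theorem IsContrast.hasDerivWithinAt_sqrt {g : ℝ → ℝ} (hg : IsContrast g) {x : ℝ}
    (hx : x ∈ Ioc (0 : ℝ) 1) :
    HasDerivWithinAt (fun x => g (√x)) (sqrtDeriv g x) (Ioc 0 1) x := by
  have h := sqrt_mem_Ioc hx
  have h1 := hg.hasDerivWithinAt (t := √x) ⟨by linarith [h.1], h.2⟩
  have h2 : HasDerivWithinAt (fun x : ℝ => √x) (1 / (2 * √x)) (Ioc 0 1) x :=
    (Real.hasDerivAt_sqrt hx.1.ne').hasDerivWithinAt
  have h3 := h1.comp x h2 (fun y hy => by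
    have := sqrt_mem_Ioc hy
    exact ⟨by linarith [this.1], this.2⟩)
  have e : sqrtDeriv g x = derivWithin g (Icc (-1) 1) (√x) * (1 / (2 * √x)) := by
    rw [sqrtDeriv]; ring
  rw [e]
  exact h3

theorem IsContrast.differentiableAt_sqrtDeriv {g : ℝ → ℝ} (hg : IsContrast g) {x : ℝ}
    (hx : x ∈ Ioo (0 : ℝ) 1) : DifferentiableAt ℝ (sqrtDeriv g) x := by
  have h := sqrt_mem_Ioo hx
  have h1 : DifferentiableAt ℝ (derivWithin g (Icc (-1) 1)) (√x) :=
    (hg.differentiableOn_deriv _ ⟨by linarith [h.1], h.2.le⟩).differentiableAt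
      (Icc_mem_nhds (by linarith [h.1]) h.2)
  have h2 : DifferentiableAt ℝ (fun x : ℝ => √x) x := (Real.hasDerivAt_sqrt hx.1.ne').differentiableAt
  exact (h1.comp x h2).div (h2.const_mul 2) (by linarith [h.1])

theorem IsContrast.hasDerivAt_sqrtDeriv {g : ℝ → ℝ} (hg : IsContrast g) {x : ℝ}
    (hx : x ∈ Ioo (0 : ℝ) 1) : HasDerivAt (sqrtDeriv g) (hSecond g x) x := by
  have hx' : x ∈ Ioc (0 : ℝ) 1 := ⟨hx.1, hx.2.le⟩
  have key : ∀ y ∈ Ioc (0 : ℝ) 1, derivWithin (hOf g) (Ioc 0 1) y = sqrtDeriv g y := by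
    intro y hy
    have h1 := (hg.hasDerivWithinAt_sqrt hy).congr (f₁ := hOf g) (fun z hz => by
      rw [hOf, Real.sign_of_pos hz.1, abs_of_pos hz.1, one_mul]) (by
      rw [hOf, Real.sign_of_pos hy.1, abs_of_pos hy.1, one_mul])
    exact h1.derivWithin ((uniqueDiffOn_Ioc 0 1) y hy)
  have e : hSecond g x = deriv (sqrtDeriv g) x := by
    rw [hSecond, show (2 : ℕ) = 1 + 1 from rfl, iteratedDerivWithin_succ, iteratedDerivWithin_one,
      derivWithin_congr key (key x hx')]
    exact (hg.differentiableAt_sqrtDeriv hx).derivWithin ((uniqueDiffOn_Ioc 0 1) x hx')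
  rw [e]
  exact (hg.differentiableAt_sqrtDeriv hx).hasDerivAt

theorem tendsto_sqrt_nhdsGT_zero : Tendsto (fun x : ℝ => √x) (𝓝[>] 0) (𝓝[>] 0) := by
  refine tendsto_nhdsWithin_iff.2 ⟨?_, ?_⟩
  · have := (Real.continuous_sqrt.tendsto 0).mono_left (nhdsWithin_le_nhds (s := Ioi (0 : ℝ)))
    simpa using this
  · filter_upwards [self_mem_nhdsWithin] with x hx
    exact Real.sqrt_pos.2 hx

/-- The quotient `g'(√x)/(2√x)` tends to `g''(0)/2`. A limit of derivatives at an endpoint is the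
one-sided derivative there, and that is `0` by assumption. -/
theorem IsContrast.tendsto_sqrtDeriv {g : ℝ → ℝ} (hg : IsContrast g) :
    Tendsto (sqrtDeriv g) (𝓝[>] 0) (𝓝 0) := by
  have hd : HasDerivAt (derivWithin g (Icc (-1) 1))
      (deriv (derivWithin g (Icc (-1) 1)) 0) 0 :=
    ((hg.differentiableOn_deriv 0 (by norm_num)).differentiableAt
      (Icc_mem_nhds (by norm_num) (by norm_num))).hasDerivAt
  set c := deriv (derivWithin g (Icc (-1) 1)) 0
  have hlim : Tendsto (sqrtDeriv g) (𝓝[>] 0) (𝓝 (c / 2)) := by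
    have h1 := (hasDerivAt_iff_tendsto_slope.1 hd).mono_left
      (nhdsWithin_mono 0 (fun x (hx : 0 < x) => hx.ne' : Ioi (0 : ℝ) ⊆ {0}ᶜ))
    have h2 := (h1.comp tendsto_sqrt_nhdsGT_zero).div_const 2
    refine h2.congr fun x => ?_
    rw [sqrtDeriv, Function.comp, slope_def_field, hg.deriv_zero]
    rw [sub_zero, sub_zero, div_div, mul_comm]
  have hdiff : DifferentiableOn ℝ (fun x => g (√x)) (Ioo 0 1) := fun x hx =>
    ((hg.hasDerivWithinAt_sqrt ⟨hx.1, hx.2.le⟩).mono Ioo_subset_Ioc_self).differentiableWithinAt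
  have hcont : ContinuousWithinAt (fun x => g (√x)) (Ioo 0 1) 0 :=
    hg.right_deriv_zero.continuousWithinAt.mono Ioo_subset_Ioi_self
  have h4 : HasDerivWithinAt (fun x => g (√x)) (c / 2) (Ici 0) 0 := by
    refine hasDerivWithinAt_Ici_of_tendsto_deriv hdiff hcont (Ioo_mem_nhdsGT one_pos) ?_
    refine hlim.congr' ?_
    filter_upwards [Ioo_mem_nhdsGT (one_pos : (0 : ℝ) < 1)] with x hx
    exact ((hg.hasDerivWithinAt_sqrt ⟨hx.1, hx.2.le⟩).hasDerivAt
      (Ioc_mem_nhds hx.1 hx.2)).deriv.symm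
  have h5 := (uniqueDiffWithinAt_Ioi 0).eq_deriv _ (h4.mono Ioi_subset_Ici_self)
    hg.right_deriv_zero
  rwa [h5] at hlim

theorem IsContrast.continuousOn_sqrtDeriv {g : ℝ → ℝ} (hg : IsContrast g) :
    ContinuousOn (sqrtDeriv g) (Icc 0 1) := by
  intro x hx
  rcases hx.1.eq_or_lt with rfl | h0
  · have : ContinuousWithinAt (sqrtDeriv g) (Ioi 0) 0 := by
      have h := hg.tendsto_sqrtDeriv
      -- Division by zero gives the value `0` at the origin, which happens to be the limit.
      have e : sqrtDeriv g 0 = 0 := by simp [sqrtDeriv]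
      rw [ContinuousWithinAt, e]
      exact h
    exact (continuousWithinAt_Ioi_iff_Ici.1 this).mono Icc_subset_Ici_self
  · have hs := sqrt_mem_Ioc ⟨h0, hx.2⟩
    have h1 : ContinuousWithinAt (derivWithin g (Icc (-1) 1)) (Icc (-1) 1) (√x) :=
      (hg.differentiableOn_deriv _ ⟨by linarith [hs.1], hs.2⟩).continuousWithinAt
    have h2 : ContinuousWithinAt (fun x : ℝ => √x) (Icc 0 1) x :=
      Real.continuous_sqrt.continuousWithinAt
    refine (h1.comp h2 fun y hy => ⟨?_, Real.sqrt_le_one.2 hy.2⟩).div (h2.const_mul 2)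
      (by linarith [hs.1])
    linarith [Real.sqrt_nonneg y]

theorem abs_derivWithin_neg {g : ℝ → ℝ} (hg : IsContrast g) {t : ℝ} (ht : t ∈ Icc (-1 : ℝ) 1) :
    |derivWithin g (Icc (-1) 1) (-t)| = |derivWithin g (Icc (-1) 1) t| := by
  have ht' : -t ∈ Icc (-1 : ℝ) 1 := ⟨by linarith [ht.2], by linarith [ht.1]⟩
  have h1 : HasDerivWithinAt (fun x => g (-x)) (derivWithin g (Icc (-1) 1) (-t) * -1)
      (Icc (-1) 1) t :=
    (hg.hasDerivWithinAt ht').comp t (hasDerivAt_neg t).hasDerivWithinAt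
      (fun y hy => ⟨by linarith [hy.2], by linarith [hy.1]⟩)
  have hu := uniqueDiffOn_Icc_neg_one t ht
  rcases hg.even_or_odd with he | ho
  · have h2 := h1.congr (f₁ := g) (fun y hy => (he y hy).symm) (he t ht).symm
    rw [h2.derivWithin hu]
    simp
  · have h2 := h1.congr (f₁ := fun x => -g x) (fun y hy => (ho y hy).symm) (ho t ht).symm
    have h3 := hu.eq_deriv _ h2 (hg.hasDerivWithinAt ht).neg
    rw [← abs_neg (derivWithin g (Icc (-1) 1) t), ← h3]
    simp

theorem IsContrast.derivWithin_eq {g : ℝ → ℝ} (hg : IsContrast g) {t : ℝ} (ht : 0 ≤ t) :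
    derivWithin g (Icc (-1) 1) t = 2 * t * sqrtDeriv g (t ^ 2) := by
  rcases ht.eq_or_lt with rfl | h0
  · simp [hg.deriv_zero]
  · rw [sqrtDeriv, Real.sqrt_sq ht]
    field_simp

/-- Up to sign, the derivative of `x ↦ g(√x)` is a profile, and it determines `|g'|`. -/
theorem exists_isProfile {g : ℝ → ℝ} (hg : IsContrast g) {α β γ δ : ℝ} (hγ : 0 < γ) (hδ : 0 < δ)
    (hβ : 0 < β)
    (hlo : ∀ x ∈ Ioc (0 : ℝ) 1, β * x ^ (δ - 1) ≤ |hSecond g x|)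
    (hup : ∀ x ∈ Ioc (0 : ℝ) 1, |hSecond g x| ≤ α * x ^ (γ - 1)) :
    ∃ ψ : ℝ → ℝ, IsProfile ψ (β / δ) (α / γ) γ δ ∧
      ∀ t ∈ Icc (-1 : ℝ) 1, |derivWithin g (Icc (-1) 1) t| = 2 * |t| * ψ (t ^ 2) := by
  -- `ς` is the constant sign of the second derivative; multiplying by it makes the first derivative
  -- increasing.
  obtain ⟨ς, hς, hpos⟩ : ∃ ς : ℝ, |ς| = 1 ∧ ∀ x ∈ Ioo (0 : ℝ) 1,
      ς * hSecond g x = |hSecond g x| := by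
    rcases hg.strict_convexity with h | h
    · exact ⟨1, by simp, fun x hx => by rw [one_mul, abs_of_pos (h x ⟨hx.1, hx.2.le⟩)]⟩
    · refine ⟨-1, by simp, fun x hx => ?_⟩
      have := h x ⟨hx.1, hx.2.le⟩
      rw [abs_of_neg (by linarith)]; ring
  have hcont : ContinuousOn (fun x => ς * sqrtDeriv g x) (Icc 0 1) :=
    continuousOn_const.mul hg.continuousOn_sqrtDeriv
  have hder : ∀ x ∈ interior (Icc (0 : ℝ) 1),
      HasDerivWithinAt (fun x => ς * sqrtDeriv g x) |hSecond g x| (interior (Icc (0 : ℝ) 1)) x := by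
    intro x hx
    rw [interior_Icc] at hx ⊢
    rw [← hpos x hx]
    exact ((hg.hasDerivAt_sqrtDeriv hx).const_mul ς).hasDerivWithinAt
  have hpow : ∀ {c κ : ℝ}, 0 < κ → ContinuousOn (fun x : ℝ => c / κ * x ^ κ) (Icc 0 1) ∧
      ∀ x ∈ interior (Icc (0 : ℝ) 1), HasDerivWithinAt (fun x : ℝ => c / κ * x ^ κ)
        (c * x ^ (κ - 1)) (interior (Icc (0 : ℝ) 1)) x := by
    intro c κ hκ
    refine ⟨continuousOn_const.mul (continuousOn_id.rpow_const fun x _ => Or.inr hκ.le), ?_⟩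
    intro x hx
    rw [interior_Icc] at hx
    have := ((Real.hasDerivAt_rpow_const (p := κ) (Or.inl hx.1.ne')).const_mul
      (c / κ)).hasDerivWithinAt (s := interior (Icc (0 : ℝ) 1))
    have e : c * x ^ (κ - 1) = c / κ * (κ * x ^ (κ - 1)) := by field_simp
    rwa [e]
  have hP : IsProfile (fun x => ς * sqrtDeriv g x) (β / δ) (α / γ) γ δ := by
    refine ⟨hcont, by simp [sqrtDeriv], ?_, ?_⟩
    · refine monotoneOn_of_hasDerivWithinAt_nonneg (convex_Icc 0 1) (hcont.sub (hpow hδ).1)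
        (fun x hx => (hder x hx).sub ((hpow hδ).2 x hx)) fun x hx => ?_
      rw [interior_Icc] at hx
      exact sub_nonneg.2 (hlo x ⟨hx.1, hx.2.le⟩)
    · refine monotoneOn_of_hasDerivWithinAt_nonneg (convex_Icc 0 1) ((hpow hγ).1.sub hcont)
        (fun x hx => ((hpow hγ).2 x hx).sub (hder x hx)) fun x hx => ?_
      rw [interior_Icc] at hx
      exact sub_nonneg.2 (hup x ⟨hx.1, hx.2.le⟩)
  refine ⟨_, hP, fun t ht => ?_⟩
  have hnn : ∀ x ∈ Icc (0 : ℝ) 1, 0 ≤ ς * sqrtDeriv g x := by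
    intro x hx
    have h := hP.lower ⟨le_rfl, zero_le_one⟩ hx hx.1
    have h2 : 0 ≤ β / δ * x ^ δ := by have := Real.rpow_nonneg hx.1 δ; positivity
    have h3 : ς * sqrtDeriv g 0 = 0 := hP.zero
    simp only [Real.zero_rpow hδ.ne', h3] at h
    linarith
  have key : ∀ t ∈ Icc (0 : ℝ) 1, |derivWithin g (Icc (-1) 1) t|
      = 2 * |t| * (ς * sqrtDeriv g (t ^ 2)) := by
    intro t ht
    have h1 := hnn (t ^ 2) ⟨by positivity, pow_le_one₀ ht.1 ht.2⟩
    rw [hg.derivWithin_eq ht.1, abs_mul, abs_mul, abs_two, ← abs_of_nonneg h1, abs_mul ς, hς,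
      one_mul]
  rcases le_total 0 t with h0 | h0
  · exact key t ⟨h0, ht.2⟩
  · have := key (-t) ⟨by linarith, by linarith [ht.1]⟩
    rwa [abs_derivWithin_neg hg ht, abs_neg, neg_sq] at this

end HiddenBasis
end

noncomputable section

namespace HiddenBasis

open Filter Topology

/-! ### The gradient of a basis encoding function -/

theorem befGrad_eq {d m : ℕ} {g : Fin m → ℝ → ℝ} {Z : Fin m → Vec d} (h : IsBEF g Z) {u : Vec d}
    (hu : ‖u‖ ≤ 1) :
    befGrad g Z u = ∑ i, derivWithin (g i) (Icc (-1) 1) (inner ℝ u (Z i)) • Z i := by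
  have hin : ∀ i, ∀ y ∈ Metric.closedBall (0 : Vec d) 1, inner ℝ y (Z i) ∈ Icc (-1 : ℝ) 1 := by
    intro i y hy
    have h1 := abs_real_inner_le_norm y (Z i)
    rw [h.orthonormal.1 i, mul_one] at h1
    exact abs_le.1 (h1.trans (by simpa using hy))
  have hu' : u ∈ Metric.closedBall (0 : Vec d) 1 := by simpa using hu
  have hG : HasGradientWithinAt (befSum g Z)
      (∑ i, derivWithin (g i) (Icc (-1) 1) (inner ℝ u (Z i)) • Z i)
      (Metric.closedBall 0 1) u := by
    rw [hasGradientWithinAt_iff_hasFDerivWithinAt, map_sum]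
    have : befSum g Z = fun y => ∑ i, g i (inner ℝ y (Z i)) := rfl
    rw [this]
    refine HasFDerivWithinAt.fun_sum fun i _ => ?_
    have hlin : HasFDerivWithinAt (fun y : Vec d => inner ℝ y (Z i)) (innerSL ℝ (Z i))
        (Metric.closedBall 0 1) u := by
      have e : (fun y : Vec d => inner ℝ y (Z i)) = fun y => innerSL ℝ (Z i) y := by
        funext y
        rw [innerSL_apply_apply, real_inner_comm]
      rw [e]
      exact (innerSL ℝ (Z i)).hasFDerivWithinAt
    have h1 := ((h.contrast i).hasDerivWithinAt (hin i u hu')).comp_hasFDerivWithinAt u hlin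
      (hin i)
    refine h1.congr_fderiv ?_
    ext y
    simp
  -- The iterates lie on the boundary of the domain. The gradient is still unique there, because the
  -- ball is convex with nonempty interior.
  have huniq : UniqueDiffWithinAt ℝ (Metric.closedBall (0 : Vec d) 1) u := by
    refine uniqueDiffOn_convex (convex_closedBall (0 : Vec d) 1) ?_ u hu'
    exact ⟨0, Metric.ball_subset_interior_closedBall (by simp)⟩
  have h2 : HasGradientWithinAt (befSum g Z) (befGrad g Z u) (Metric.closedBall 0 1) u :=
    DifferentiableWithinAt.hasGradientWithinAt hG.differentiableWithinAt
  rw [hasGradientWithinAt_iff_hasFDerivWithinAt] at hG h2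
  exact (InnerProductSpace.toDual ℝ (Vec d)).injective (huniq.eq h2 hG)

/-- `Fh` is, on the unit sphere, within `ε` of a field whose coordinates in the directions `Z i`
have absolute values `2 |uᵢ| ψᵢ(uᵢ²)`. -/
def IsNoisyField {d m : ℕ} (Z : Fin m → Vec d) (ψ : Fin m → ℝ → ℝ) (Fh : Vec d → Vec d) (ε : ℝ) :
    Prop :=
  ∀ u, ‖u‖ = 1 → ∃ c : Fin m → ℝ,
    (∀ i, |c i| = 2 * |inner ℝ u (Z i)| * ψ i (inner ℝ u (Z i) ^ 2)) ∧
      ‖Fh u - ∑ i, c i • Z i‖ ≤ ε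

theorem exists_isNoisyField {d m : ℕ} {g : Fin m → ℝ → ℝ} {Z : Fin m → Vec d} {α β γ δ ε : ℝ}
    {Fh : Vec d → Vec d} (h : IsBEF g Z) (hr : IsRobust g α β γ δ) (ha : IsGradApprox g Z Fh ε) :
    ∃ ψ : Fin m → ℝ → ℝ, (∀ i, IsProfile (ψ i) (β / δ) (α / γ) γ δ) ∧
      IsNoisyField Z ψ Fh ε := by
  choose ψ hψ hd using fun i => exists_isProfile (h.contrast i) hr.γ_pos hr.δ_pos hr.β_pos
    (hr.lower i) (hr.upper i)
  refine ⟨ψ, hψ, fun u hu =>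
    ⟨fun i => derivWithin (g i) (Icc (-1) 1) (inner ℝ u (Z i)), fun i => hd i _ ?_, ?_⟩⟩
  · have h1 := abs_real_inner_le_norm u (Z i)
    rw [h.orthonormal.1 i, mul_one, hu] at h1
    exact abs_le.1 h1
  · rw [← befGrad_eq h hu.le]
    exact ha u (by simp [hu])

/-! ### Residuals -/

/-- The distance from `u` to the span of the `Z i` with `i ∈ B`. -/
def resid {d m : ℕ} (Z : Fin m → Vec d) (B : Finset (Fin m)) (u : Vec d) : ℝ :=
  ‖u - ∑ i ∈ B, inner ℝ u (Z i) • Z i‖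

section Resid

variable {d m : ℕ} {Z : Fin m → Vec d}

theorem resid_nonneg (B : Finset (Fin m)) (u : Vec d) : 0 ≤ resid Z B u := norm_nonneg _

theorem continuous_resid (B : Finset (Fin m)) : Continuous (resid Z B) := by
  unfold resid; fun_prop

theorem norm_sum_smul_sq (hZ : Orthonormal ℝ Z) (B : Finset (Fin m)) (c : Fin m → ℝ) :
    ‖∑ i ∈ B, c i • Z i‖ ^ 2 = ∑ i ∈ B, c i ^ 2 := by
  rw [← real_inner_self_eq_norm_sq, hZ.inner_sum]
  exact Finset.sum_congr rfl fun i _ => by simp [sq]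

theorem resid_sq (hZ : Orthonormal ℝ Z) (B : Finset (Fin m)) (u : Vec d) :
    resid Z B u ^ 2 = ‖u‖ ^ 2 - ∑ i ∈ B, inner ℝ u (Z i) ^ 2 := by
  rw [resid, norm_sub_sq_real, norm_sum_smul_sq hZ, inner_sum]
  simp only [inner_smul_right, ← sq]
  ring

theorem resid_anti (hZ : Orthonormal ℝ Z) {B B' : Finset (Fin m)} (h : B ⊆ B') (u : Vec d) :
    resid Z B' u ≤ resid Z B u := by
  refine (sq_le_sq₀ (resid_nonneg _ _) (resid_nonneg _ _)).1 ?_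
  rw [resid_sq hZ, resid_sq hZ]
  have := Finset.sum_le_sum_of_subset_of_nonneg h
    (f := fun i => inner ℝ u (Z i) ^ 2) fun i _ _ => sq_nonneg _
  linarith

theorem resid_erase_sq (hZ : Orthonormal ℝ Z) {B : Finset (Fin m)} {i : Fin m} (hi : i ∈ B)
    (u : Vec d) : resid Z (B.erase i) u ^ 2 = resid Z B u ^ 2 + inner ℝ u (Z i) ^ 2 := by
  rw [resid_sq hZ, resid_sq hZ, ← Finset.add_sum_erase B _ hi]
  ring

theorem abs_inner_le_resid (hZ : Orthonormal ℝ Z) {B : Finset (Fin m)} {i : Fin m} (hi : i ∉ B)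
    (u : Vec d) : |inner ℝ u (Z i)| ≤ resid Z B u := by
  refine abs_le_of_sq_le_sq ?_ (resid_nonneg _ _)
  have h1 := resid_erase_sq hZ (Finset.mem_insert_self i B) u
  rw [Finset.erase_insert hi] at h1
  nlinarith [sq_nonneg (resid Z (insert i B) u)]

theorem resid_le_norm (hZ : Orthonormal ℝ Z) (B : Finset (Fin m)) (u : Vec d) :
    resid Z B u ≤ ‖u‖ := by
  refine (sq_le_sq₀ (resid_nonneg _ _) (norm_nonneg _)).1 ?_
  rw [resid_sq hZ]
  have := Finset.sum_nonneg (s := B) (f := fun i => inner ℝ u (Z i) ^ 2) fun i _ => sq_nonneg _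
  linarith

theorem resid_add_le (B : Finset (Fin m)) (u v : Vec d) :
    resid Z B (u + v) ≤ resid Z B u + resid Z B v := by
  have : u + v - ∑ i ∈ B, inner ℝ (u + v) (Z i) • Z i =
      (u - ∑ i ∈ B, inner ℝ u (Z i) • Z i) + (v - ∑ i ∈ B, inner ℝ v (Z i) • Z i) := by
    simp only [inner_add_left, add_smul, Finset.sum_add_distrib]
    abel
  rw [resid, this]
  exact norm_add_le _ _

theorem resid_smul (B : Finset (Fin m)) (r : ℝ) (u : Vec d) :
    resid Z B (r • u) = |r| * resid Z B u := by
  rw [resid, resid, ← Real.norm_eq_abs, ← norm_smul, smul_sub, Finset.smul_sum]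
  simp only [real_inner_smul_left, mul_smul]

theorem sum_inner_sq_eq (hZ : Orthonormal ℝ Z) (B : Finset (Fin m)) {u : Vec d} (hu : ‖u‖ = 1) :
    ∑ i ∈ B, inner ℝ u (Z i) ^ 2 = 1 - resid Z B u ^ 2 := by
  rw [resid_sq hZ, hu]; ring

theorem abs_inner_le_one (hZ : Orthonormal ℝ Z) {u : Vec d} (hu : ‖u‖ = 1) (i : Fin m) :
    |inner ℝ u (Z i)| ≤ 1 := by
  have h1 := abs_real_inner_le_norm u (Z i)
  rwa [hZ.1 i, mul_one, hu] at h1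

theorem inner_sq_mem_Icc (hZ : Orthonormal ℝ Z) {u : Vec d} (hu : ‖u‖ = 1) (i : Fin m) :
    inner ℝ u (Z i) ^ 2 ∈ Icc (0 : ℝ) 1 := by
  refine ⟨sq_nonneg _, ?_⟩
  rw [← sq_abs]
  exact pow_le_one₀ (abs_nonneg _) (abs_inner_le_one hZ hu i)

end Resid

/-! ### Profiles: elementary bounds -/

section Profile

variable {ψ : ℝ → ℝ} {a A γ δ : ℝ}

theorem IsProfile.lower_le (h : IsProfile ψ a A γ δ) (hδ : 0 < δ) {x : ℝ} (hx : x ∈ Icc (0 : ℝ) 1) :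
    a * x ^ δ ≤ ψ x := by
  have := h.lower ⟨le_rfl, zero_le_one⟩ hx hx.1
  simp only [h.zero, Real.zero_rpow hδ.ne'] at this
  linarith

theorem IsProfile.le_upper (h : IsProfile ψ a A γ δ) (hγ : 0 < γ) {x : ℝ} (hx : x ∈ Icc (0 : ℝ) 1) :
    ψ x ≤ A * x ^ γ := by
  have := h.upper ⟨le_rfl, zero_le_one⟩ hx hx.1
  simp only [h.zero, Real.zero_rpow hγ.ne'] at this
  linarith

theorem IsProfile.nonneg (h : IsProfile ψ a A γ δ) (hδ : 0 < δ) (ha : 0 < a) {x : ℝ}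
    (hx : x ∈ Icc (0 : ℝ) 1) : 0 ≤ ψ x :=
  (mul_nonneg ha.le (Real.rpow_nonneg hx.1 δ)).trans (h.lower_le hδ hx)

theorem IsProfile.pos (h : IsProfile ψ a A γ δ) (hδ : 0 < δ) (ha : 0 < a) {x : ℝ}
    (hx : x ∈ Ioc (0 : ℝ) 1) : 0 < ψ x :=
  (mul_pos ha (Real.rpow_pos_of_pos hx.1 δ)).trans_le (h.lower_le hδ ⟨hx.1.le, hx.2⟩)

theorem IsProfile.strictMonoOn (h : IsProfile ψ a A γ δ) (hδ : 0 < δ) (ha : 0 < a) :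
    StrictMonoOn ψ (Icc 0 1) := by
  intro x hx y hy hxy
  have h1 := h.lower hx hy hxy.le
  have h2 := mul_lt_mul_of_pos_left (Real.rpow_lt_rpow hx.1 hxy hδ) ha
  simp only at h1
  linarith

theorem IsProfile.le_of_mem (h : IsProfile ψ a A γ δ) (hδ : 0 < δ) (hγ : 0 < γ) : a ≤ A := by
  have h1 := h.lower_le hδ (x := 1) (by simp)
  have h2 := h.le_upper hγ (x := 1) (by simp)
  simp only [Real.one_rpow, mul_one] at h1 h2
  linarith

/-- For `δ < γ` the inequality `a x^δ ≤ A x^γ` fails near `0`. The witness satisfies `x^(γ-δ) =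
a/(2A)`; the factor `2` makes the contradiction strict. -/
theorem IsProfile.exponent_le (h : IsProfile ψ a A γ δ) (hδ : 0 < δ) (hγ : 0 < γ) (ha : 0 < a) :
    γ ≤ δ := by
  by_contra hlt
  push Not at hlt
  have hA : 0 < A := ha.trans_le (h.le_of_mem hδ hγ)
  set x : ℝ := (a / (2 * A)) ^ (1 / (γ - δ)) with hx
  have hb : 0 < a / (2 * A) := by positivity
  have hb1 : a / (2 * A) ≤ 1 := by
    rw [div_le_one (by positivity)]; linarith [h.le_of_mem hδ hγ]
  have hxpos : 0 < x := Real.rpow_pos_of_pos hb _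
  have hx1 : x ≤ 1 := Real.rpow_le_one hb.le hb1 (by
    have : 0 < γ - δ := by linarith
    positivity)
  have hxp : x ^ (γ - δ) = a / (2 * A) := by
    rw [hx, ← Real.rpow_mul hb.le, one_div, inv_mul_cancel₀ (by linarith), Real.rpow_one]
  have h1 := (h.lower_le hδ ⟨hxpos.le, hx1⟩).trans (h.le_upper hγ ⟨hxpos.le, hx1⟩)
  have h2 : x ^ γ = x ^ δ * (a / (2 * A)) := by
    rw [← hxp, ← Real.rpow_add hxpos]; ring_nf
  rw [h2] at h1
  have h3 : A * (x ^ δ * (a / (2 * A))) = a * x ^ δ / 2 := by field_simp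
  have h4 : 0 < a * x ^ δ := mul_pos ha (Real.rpow_pos_of_pos hxpos δ)
  linarith

/-- The logarithmic growth rate of a profile. -/
theorem IsProfile.log_growth (h : IsProfile ψ a A γ δ) (hδ : 0 < δ) (hγ : 0 < γ) (ha : 0 < a)
    {s x y : ℝ} (hs : 0 < s) (hsx : s ≤ x) (hxy : x ≤ y) (hy : y ≤ 1) :
    δ * (a / A) * s ^ (δ - γ) * (Real.log y - Real.log x) ≤
      Real.log (ψ y) - Real.log (ψ x) := by
  have hA : 0 < A := ha.trans_le (h.le_of_mem hδ hγ)
  have hx : 0 < x := hs.trans_le hsx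
  have hy0 : 0 < y := hx.trans_le hxy
  have hψx := h.pos hδ ha (x := x) ⟨hx, hxy.trans hy⟩
  have hψy := h.pos hδ ha (x := y) ⟨hy0, hy⟩
  set κ := a / A * x ^ (δ - γ) with hκ
  have hδγ : 0 ≤ δ - γ := sub_nonneg.2 (h.exponent_le hδ hγ ha)
  have hκ0 : 0 ≤ κ := by positivity
  have hκ1 : κ ≤ 1 := by
    have h1 : a / A ≤ 1 := (div_le_one hA).2 (h.le_of_mem hδ hγ)
    have h2 : x ^ (δ - γ) ≤ 1 := Real.rpow_le_one hx.le (hxy.trans hy) hδγ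
    have h3 : 0 ≤ x ^ (δ - γ) := Real.rpow_nonneg hx.le _
    calc κ ≤ 1 * 1 := mul_le_mul h1 h2 h3 zero_le_one
      _ = 1 := one_mul 1
  have hY : 0 < (y / x) ^ δ := Real.rpow_pos_of_pos (by positivity) δ
  have hY1 : 1 ≤ (y / x) ^ δ := Real.one_le_rpow ((one_le_div hx).2 hxy) hδ.le
  -- The increment of `ψ` is at least that of `a x^δ`, and `ψ x ≤ A x^γ`. Dividing yields a convex
  -- combination of `1` and `(y/x)^δ` with weight `κ`.
  have hratio : 1 - κ + κ * (y / x) ^ δ ≤ ψ y / ψ x := by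
    rw [le_div_iff₀ hψx]
    have h1 := h.lower ⟨hx.le, hxy.trans hy⟩ ⟨hy0.le, hy⟩ hxy
    simp only at h1
    have h2 := h.le_upper hγ (x := x) ⟨hx.le, hxy.trans hy⟩
    have h3 : y ^ δ = (y / x) ^ δ * x ^ δ := by
      rw [← Real.mul_rpow (by positivity) hx.le, div_mul_cancel₀ _ hx.ne']
    have h4 : κ * (A * x ^ γ) = a * x ^ δ := by
      rw [hκ, show δ = (δ - γ) + γ by ring, Real.rpow_add hx]
      field_simp
      ring_nf
    have h5 : 0 ≤ κ * ((y / x) ^ δ - 1) := mul_nonneg hκ0 (by linarith)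
    have h6 := mul_le_mul_of_nonneg_left h2 h5
    have h7 : κ * ((y / x) ^ δ - 1) * (A * x ^ γ) = a * y ^ δ - a * x ^ δ := by
      rw [h3, ← mul_assoc a, mul_comm a ((y / x) ^ δ), mul_assoc _ a, ← h4]; ring
    linarith
  -- Weighted AM-GM turns the combination into the power `(y/x)^(δκ)`, so the logarithmic rate is
  -- `δκ`.
  have hamgm := Real.geom_mean_le_arith_mean2_weighted (sub_nonneg.2 hκ1) hκ0 zero_le_one hY.le
    (by ring)
  rw [Real.one_rpow, one_mul, mul_one] at hamgm
  have hlog := Real.log_le_log (Real.rpow_pos_of_pos hY κ) (hamgm.trans hratio)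
  rw [Real.log_rpow hY, Real.log_rpow (by positivity), Real.log_div hψy.ne' hψx.ne',
    Real.log_div hy0.ne' hx.ne'] at hlog
  refine le_trans ?_ hlog
  have h8 : s ^ (δ - γ) ≤ x ^ (δ - γ) := Real.rpow_le_rpow hs.le hsx hδγ
  have h9 : 0 ≤ Real.log y - Real.log x := sub_nonneg.2 (Real.log_le_log hx hxy)
  calc δ * (a / A) * s ^ (δ - γ) * (Real.log y - Real.log x)
      ≤ δ * (a / A) * x ^ (δ - γ) * (Real.log y - Real.log x) := by gcongr
    _ = κ * (δ * (Real.log y - Real.log x)) := by rw [hκ]; ring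

end Profile

end HiddenBasis
end

noncomputable section

namespace HiddenBasis

open Filter Topology

/-! ### One noisy gradient step -/

/-- Bernoulli's inequality needs an exponent at least `1`, which `1/2 + δ` may not be; it is applied
to `1 + 2δ`, a larger exponent on a base in `[0, 1]`. -/
theorem one_sub_le_rpow {x δ : ℝ} (hx0 : 0 ≤ x) (hx1 : x ≤ 1) (hδ : 0 < δ) :
    1 - (1 + 2 * δ) * x ≤ (1 - x) ^ (1 / 2 + δ) := by
  have h1 := one_add_mul_self_le_rpow_one_add (s := -x) (by linarith) (p := 1 + 2 * δ)
    (by linarith)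
  have h2 : (1 - x) ^ (1 + 2 * δ) ≤ (1 - x) ^ (1 / 2 + δ) :=
    Real.rpow_le_rpow_of_exponent_ge' (by linarith) (by linarith) (by linarith) (by linarith)
  have h3 : (1 + -x) = 1 - x := by ring
  rw [h3] at h1
  linarith

/-- The relations between the scales of the problem that the dynamics depends on. -/
structure Scales (d m : ℕ) (a A γ δ ε σ τ s : ℝ) : Prop where
  a_pos : 0 < a
  A_pos : 0 < A
  γ_pos : 0 < γ
  δ_pos : 0 < δ
  ε_pos : 0 < ε
  σ_pos : 0 < σ
  τ_pos : 0 < τ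
  τ_lt_one : τ < 1
  s_pos : 0 < s
  τ_pow : A * (τ ^ 2) ^ γ = a * (m : ℝ) ^ (-δ) / 16
  s_pow : A * s ^ γ = a * (m : ℝ) ^ (-δ)
  σ_le : σ ≤ τ / 12
  σ_sq_le : (1 + 2 * δ) * σ ^ 2 ≤ 1 / 144
  σ_sqrt_le : σ * √d ≤ s / 32
  ε_le : ε ≤ a * (m : ℝ) ^ (-δ) * σ / 1000
  ε_le_half : ε ≤ a * (τ * (τ ^ 2) ^ δ)
  ε_growth : 3 * ε ≤ 2 * (a * (τ * (τ ^ 2) ^ δ)) *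
    (δ * (a / A) * s ^ (δ - γ) * (s * σ / (40 * √d)))

section Dynamics

variable {d m : ℕ} {Z : Fin m → Vec d} {ψ : Fin m → ℝ → ℝ} {Fh : Vec d → Vec d}
  {a A γ δ ε σ τ s : ℝ}

/-! ### Size and direction of the gradient field after one step -/

theorem inner_sum_smul (hZ : Orthonormal ℝ Z) (c : Fin m → ℝ) (i : Fin m) :
    inner ℝ (∑ j, c j • Z j) (Z i) = c i := by
  rw [hZ.inner_left_fintype]; rfl

theorem resid_sum_le (hZ : Orthonormal ℝ Z) {B : Finset (Fin m)} {u : Vec d} {c : Fin m → ℝ}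
    {κ : ℝ} (hκ : 0 ≤ κ) (hc : ∀ i, i ∉ B → |c i| ≤ κ * |inner ℝ u (Z i)|) :
    resid Z B (∑ i, c i • Z i) ≤ κ * resid Z B u := by
  refine (sq_le_sq₀ (resid_nonneg _ _) (mul_nonneg hκ (resid_nonneg _ _))).1 ?_
  rw [mul_pow, resid_sq hZ, norm_sum_smul_sq hZ]
  simp only [inner_sum_smul hZ]
  rw [← Finset.sum_compl_add_sum B, add_sub_cancel_right]
  have h1 : ∑ i ∈ Bᶜ, c i ^ 2 ≤ κ ^ 2 * ∑ i ∈ Bᶜ, inner ℝ u (Z i) ^ 2 := by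
    rw [Finset.mul_sum]
    refine Finset.sum_le_sum fun i hi => ?_
    rw [← sq_abs, ← sq_abs (inner ℝ u (Z i)), ← mul_pow]
    exact pow_le_pow_left₀ (abs_nonneg _) (hc i (Finset.mem_compl.1 hi)) 2
  refine h1.trans (mul_le_mul_of_nonneg_left ?_ (sq_nonneg κ))
  have h2 := resid_sq hZ Finset.univ u
  rw [← Finset.sum_compl_add_sum B] at h2
  have h3 := resid_sq hZ B u
  nlinarith [sq_nonneg (resid Z Finset.univ u)]

/-- Each `i ∈ B` contributes at least `4a² (uᵢ²)^(1+2δ)` to the squared norm. By convexity the sum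
is smallest when the mass `1 - resid²` is spread evenly over `B`. -/
theorem norm_field_ge (hZ : Orthonormal ℝ Z) (hψ : ∀ i, IsProfile (ψ i) a A γ δ) (ha : 0 < a)
    (hδ : 0 < δ) {B : Finset (Fin m)} (hB : B.Nonempty) {u : Vec d} (hu : ‖u‖ = 1)
    {c : Fin m → ℝ}
    (hc : ∀ i, |c i| = 2 * |inner ℝ u (Z i)| * ψ i (inner ℝ u (Z i) ^ 2)) :
    2 * a * (B.card : ℝ) ^ (-δ) * (1 - resid Z B u ^ 2) ^ (1 / 2 + δ) ≤ ‖∑ i, c i • Z i‖ := by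
  have hn : (0 : ℝ) < B.card := by exact_mod_cast hB.card_pos
  have hX0 : 0 ≤ 1 - resid Z B u ^ 2 := by
    rw [← sum_inner_sq_eq hZ B hu]
    exact Finset.sum_nonneg fun i _ => sq_nonneg _
  refine (sq_le_sq₀ (by positivity) (norm_nonneg _)).1 ?_
  rw [norm_sum_smul_sq hZ]
  have h1 : ∑ i ∈ B, c i ^ 2 ≤ ∑ i, c i ^ 2 :=
    Finset.sum_le_sum_of_subset_of_nonneg (Finset.subset_univ _) fun i _ _ => sq_nonneg _
  refine le_trans ?_ h1
  have h2 : ∀ i ∈ B, 4 * a ^ 2 * (inner ℝ u (Z i) ^ 2) ^ (1 + 2 * δ) ≤ c i ^ 2 := by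
    intro i _
    have hm := inner_sq_mem_Icc hZ hu i
    set x := inner ℝ u (Z i) with hx
    have e : (x ^ 2) ^ (1 + 2 * δ) = x ^ 2 * ((x ^ 2) ^ δ) ^ 2 := by
      rw [Real.rpow_add_of_nonneg hm.1 zero_le_one (by positivity), Real.rpow_one, mul_comm 2 δ,
        Real.rpow_mul hm.1, Real.rpow_two]
    have h3 := (hψ i).lower_le hδ hm
    have h4 : 0 ≤ a * (x ^ 2) ^ δ := mul_nonneg ha.le (Real.rpow_nonneg hm.1 _)
    have h5 : (a * (x ^ 2) ^ δ) ^ 2 ≤ ψ i (x ^ 2) ^ 2 := pow_le_pow_left₀ h4 h3 2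
    rw [← sq_abs (c i), hc i, mul_pow, mul_pow, sq_abs, e]
    nlinarith [mul_le_mul_of_nonneg_left h5 hm.1]
  have h3 := Finset.sum_le_sum h2
  rw [← Finset.mul_sum] at h3
  refine le_trans ?_ h3
  have h4 := Real.rpow_sum_le_const_mul_sum_rpow_of_nonneg (s := B)
    (f := fun i => inner ℝ u (Z i) ^ 2) (p := 1 + 2 * δ) (by linarith)
    (fun i _ => sq_nonneg _)
  rw [sum_inner_sq_eq hZ B hu] at h4
  have e1 : ((B.card : ℝ) ^ (-δ)) ^ 2 * (B.card : ℝ) ^ (1 + 2 * δ - 1) = 1 := by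
    rw [← Real.rpow_natCast, ← Real.rpow_mul hn.le, ← Real.rpow_add hn]
    norm_num
    rw [show -(δ * 2) + 2 * δ = 0 by ring, Real.rpow_zero]
  have e2 : ((1 - resid Z B u ^ 2) ^ (1 / 2 + δ)) ^ 2 = (1 - resid Z B u ^ 2) ^ (1 + 2 * δ) := by
    rw [← Real.rpow_natCast, ← Real.rpow_mul hX0]
    norm_num
    ring_nf
  calc (2 * a * (B.card : ℝ) ^ (-δ) * (1 - resid Z B u ^ 2) ^ (1 / 2 + δ)) ^ 2
      = 4 * a ^ 2 * (((B.card : ℝ) ^ (-δ)) ^ 2 * (1 - resid Z B u ^ 2) ^ (1 + 2 * δ)) := by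
        rw [← e2]; ring
    _ ≤ 4 * a ^ 2 * (((B.card : ℝ) ^ (-δ)) ^ 2 * ((B.card : ℝ) ^ (1 + 2 * δ - 1) *
        ∑ i ∈ B, (inner ℝ u (Z i) ^ 2) ^ (1 + 2 * δ))) := by gcongr
    _ = 4 * a ^ 2 * ((((B.card : ℝ) ^ (-δ)) ^ 2 * (B.card : ℝ) ^ (1 + 2 * δ - 1)) *
        ∑ i ∈ B, (inner ℝ u (Z i) ^ 2) ^ (1 + 2 * δ)) := by ring
    _ = 4 * a ^ 2 * ∑ i ∈ B, (inner ℝ u (Z i) ^ 2) ^ (1 + 2 * δ) := by rw [e1, one_mul]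

theorem gHat_of_approx {u G : Vec d} {L : ℝ} (hF : ‖Fh u - G‖ ≤ ε) (hL : L ≤ ‖G‖) (hε : ε < L) :
    L - ε ≤ ‖Fh u‖ ∧ gHat Fh u = ‖Fh u‖⁻¹ • Fh u ∧ ‖gHat Fh u‖ = 1 := by
  have h1 : ‖G‖ - ‖Fh u‖ ≤ ‖Fh u - G‖ := by
    rw [norm_sub_rev]; exact norm_sub_norm_le _ _
  have h2 : L - ε ≤ ‖Fh u‖ := by linarith
  have h3 : Fh u ≠ 0 := by
    intro h0
    rw [h0, norm_zero] at h2
    linarith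
  have h4 : gHat Fh u = ‖Fh u‖⁻¹ • Fh u := if_pos h3
  refine ⟨h2, h4, ?_⟩
  rw [h4]
  exact norm_smul_inv_norm (𝕜 := ℝ) h3

theorem resid_gHat_le (hZ : Orthonormal ℝ Z) (B : Finset (Fin m)) {u G : Vec d} {L : ℝ}
    (hF : ‖Fh u - G‖ ≤ ε) (hL : L ≤ ‖G‖) (hε : ε < L) :
    resid Z B (gHat Fh u) ≤ (resid Z B G + ε) / (L - ε) := by
  obtain ⟨h1, h2, -⟩ := gHat_of_approx hF hL hε
  have hpos : 0 < ‖Fh u‖ := by linarith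
  rw [h2, resid_smul, abs_of_pos (inv_pos.2 hpos), inv_mul_eq_div]
  have h3 : resid Z B (Fh u) ≤ resid Z B G + ε := by
    have e : Fh u = G + (Fh u - G) := by abel
    calc resid Z B (Fh u) = resid Z B (G + (Fh u - G)) := by rw [← e]
      _ ≤ resid Z B G + resid Z B (Fh u - G) := resid_add_le _ _ _
      _ ≤ resid Z B G + ε := by linarith [resid_le_norm hZ B (Fh u - G)]
  have h4 : 0 ≤ resid Z B G + ε := (resid_nonneg _ _).trans h3
  calc resid Z B (Fh u) / ‖Fh u‖ ≤ (resid Z B G + ε) / ‖Fh u‖ := by gcongr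
    _ ≤ (resid Z B G + ε) / (L - ε) := by gcongr

/-- `u` is a unit vector near the span of the `Z i` whose coordinates outside `B` are below `τ`. -/
structure Tame (Z : Fin m → Vec d) (σ τ : ℝ) (B : Finset (Fin m)) (u : Vec d) : Prop where
  norm_eq : ‖u‖ = 1
  resid_univ_le : resid Z Finset.univ u ≤ 5 / 4 * σ
  abs_inner_le : ∀ i, i ∉ B → |inner ℝ u (Z i)| ≤ τ

theorem Tame.mono {B B' : Finset (Fin m)} {u : Vec d} (h : Tame Z σ τ B u) (hB : B ⊆ B') :
    Tame Z σ τ B' u :=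
  ⟨h.norm_eq, h.resid_univ_le, fun i hi => h.abs_inner_le i fun hi' => hi (hB hi')⟩

/-- Used with all directions, where the factor is `m^(-δ)`, and with a singleton, where it
disappears and makes the superexponential phase possible. -/
theorem Scales.norm_ge (hs : Scales d m a A γ δ ε σ τ s) (hZ : Orthonormal ℝ Z)
    (hψ : ∀ i, IsProfile (ψ i) a A γ δ) {B : Finset (Fin m)} (hB : B.Nonempty) {u : Vec d}
    (hu : ‖u‖ = 1) (hR : resid Z B u ≤ 5 / 4 * σ) {c : Fin m → ℝ}
    (hc : ∀ i, |c i| = 2 * |inner ℝ u (Z i)| * ψ i (inner ℝ u (Z i) ^ 2)) :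
    2 * a * (B.card : ℝ) ^ (-δ) * (49 / 50) ≤ ‖∑ i, c i • Z i‖ := by
  refine le_trans ?_ (norm_field_ge hZ hψ hs.a_pos hs.δ_pos hB hu hc)
  have hn : (0 : ℝ) < B.card := by exact_mod_cast hB.card_pos
  have h1 : resid Z B u ^ 2 ≤ 25 / 16 * σ ^ 2 := by
    have := pow_le_pow_left₀ (resid_nonneg B u) hR 2
    linarith
  have h2 : resid Z B u ^ 2 ≤ 1 := by
    have := pow_le_pow_left₀ (resid_nonneg B u) (resid_le_norm hZ B u) 2
    rwa [hu, one_pow] at this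
  have h3 := one_sub_le_rpow (sq_nonneg (resid Z B u)) h2 hs.δ_pos
  have h4 : (1 + 2 * δ) * resid Z B u ^ 2 ≤ 1 / 50 := by
    have := mul_le_mul_of_nonneg_left h1 (by linarith [hs.δ_pos] : 0 ≤ 1 + 2 * δ)
    linarith [hs.σ_sq_le]
  have := hs.a_pos
  gcongr
  linarith

theorem abs_field_le (hZ : Orthonormal ℝ Z) (hψ : ∀ i, IsProfile (ψ i) a A γ δ) (hγ : 0 < γ)
    (hA : 0 < A) {u : Vec d} (hu : ‖u‖ = 1) {c : Fin m → ℝ}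
    (hc : ∀ i, |c i| = 2 * |inner ℝ u (Z i)| * ψ i (inner ℝ u (Z i) ^ 2)) {i : Fin m} {r : ℝ}
    (hi : |inner ℝ u (Z i)| ≤ r) :
    |c i| ≤ 2 * (A * (r ^ 2) ^ γ) * |inner ℝ u (Z i)| := by
  have hm := inner_sq_mem_Icc hZ hu i
  have h1 := (hψ i).le_upper hγ hm
  have h2 : inner ℝ u (Z i) ^ 2 ≤ r ^ 2 := by
    rw [← sq_abs]; exact pow_le_pow_left₀ (abs_nonneg _) hi 2
  have h3 : (inner ℝ u (Z i) ^ 2) ^ γ ≤ (r ^ 2) ^ γ := Real.rpow_le_rpow hm.1 h2 hγ.le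
  have h4 := h1.trans (mul_le_mul_of_nonneg_left h3 hA.le)
  rw [hc i]
  have := mul_le_mul_of_nonneg_left h4 (abs_nonneg (inner ℝ u (Z i)))
  linarith

theorem Scales.pos_rpow (hs : Scales d m a A γ δ ε σ τ s) : 0 < (m : ℝ) ^ (-δ) := by
  have h1 : 0 < A * s ^ γ := mul_pos hs.A_pos (Real.rpow_pos_of_pos hs.s_pos γ)
  rw [hs.s_pow] at h1
  exact pos_of_mul_pos_right h1 hs.a_pos.le

theorem Tame.univ_nonempty {B : Finset (Fin m)} {u : Vec d} (hs : Scales d m a A γ δ ε σ τ s)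
    (h : Tame Z σ τ B u) : (Finset.univ : Finset (Fin m)).Nonempty := by
  by_contra h0
  rw [Finset.not_nonempty_iff_eq_empty] at h0
  have := h.resid_univ_le
  rw [h0, resid, Finset.sum_empty, sub_zero, h.norm_eq] at this
  linarith [hs.σ_le, hs.τ_lt_one]

/-- With `p = a m^(-δ)`, coordinates outside `B` are multiplied by at most `2p/16`, and after
subtracting the noise the norm of the field is still at least `19p/10`. The quotient `10/152 < 1/15`
is the contraction factor. -/
theorem Tame.step (hs : Scales d m a A γ δ ε σ τ s) (hZ : Orthonormal ℝ Z)
    (hψ : ∀ i, IsProfile (ψ i) a A γ δ) (hF : IsNoisyField Z ψ Fh ε) {B : Finset (Fin m)}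
    {u : Vec d} (h : Tame Z σ τ B u) :
    Tame Z σ τ B (gHat Fh u) ∧ resid Z B (gHat Fh u) ≤ resid Z B u / 15 + σ / 1000 := by
  obtain ⟨c, hc, hFc⟩ := hF u h.norm_eq
  have hL := hs.norm_ge hZ hψ (h.univ_nonempty hs) h.norm_eq h.resid_univ_le hc
  rw [Finset.card_univ, Fintype.card_fin] at hL
  set p := a * (m : ℝ) ^ (-δ) with hp
  have hppos : 0 < p := mul_pos hs.a_pos hs.pos_rpow
  have hσ1 : σ < 1 / 12 := by linarith [hs.σ_le, hs.τ_lt_one]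
  have hL' : p * (49 / 25) ≤ ‖∑ i, c i • Z i‖ := by linarith
  have hεp : ε ≤ p * (σ / 1000) := by linarith [hs.ε_le]
  have hεL : ε < p * (49 / 25) := by nlinarith
  have key : ∀ B' : Finset (Fin m), Tame Z σ τ B' u →
      resid Z B' (gHat Fh u) ≤ resid Z B' u / 15 + σ / 1000 := by
    intro B' h'
    have h1 : resid Z B' (∑ i, c i • Z i) ≤ 2 * (p / 16) * resid Z B' u := by
      refine resid_sum_le hZ (by positivity) fun i hi => ?_
      have := abs_field_le hZ hψ hs.γ_pos hs.A_pos h.norm_eq hc (h'.abs_inner_le i hi)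
      rwa [hs.τ_pow] at this
    refine (resid_gHat_le hZ B' hFc hL' hεL).trans ?_
    have hR := resid_nonneg (Z := Z) B' u
    have hσ := hs.σ_pos
    have h2 : p * (19 / 10) ≤ p * (49 / 25) - ε := by nlinarith
    calc (resid Z B' (∑ i, c i • Z i) + ε) / (p * (49 / 25) - ε)
        ≤ (2 * (p / 16) * resid Z B' u + p * (σ / 1000)) / (p * (19 / 10)) := by gcongr
      _ = resid Z B' u * (10 / 152) + σ / 1900 := by field_simp; ring
      _ ≤ resid Z B' u / 15 + σ / 1000 := by linarith
  have hn := (gHat_of_approx hFc hL' hεL).2.2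
  have huniv := key Finset.univ (h.mono (Finset.subset_univ B))
  refine ⟨⟨hn, ?_, fun i hi => ?_⟩, key B h⟩
  · linarith [h.resid_univ_le, hs.σ_pos]
  · have h1 := key (Finset.univ.erase i) (h.mono fun j hj =>
      Finset.mem_erase.2 ⟨fun e => hi (e ▸ hj), Finset.mem_univ j⟩)
    have h2 := abs_inner_le_resid hZ (Finset.notMem_erase i Finset.univ) (gHat Fh u)
    have h3 : resid Z (Finset.univ.erase i) u ≤ resid Z Finset.univ u + |inner ℝ u (Z i)| := by
      refine (sq_le_sq₀ (resid_nonneg _ _)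
        (add_nonneg (resid_nonneg _ _) (abs_nonneg _))).1 ?_
      rw [resid_erase_sq hZ (Finset.mem_univ i), add_sq, sq_abs]
      have := mul_nonneg (resid_nonneg (Z := Z) Finset.univ u) (abs_nonneg (inner ℝ u (Z i)))
      linarith
    linarith [h.abs_inner_le i hi, h.resid_univ_le, hs.σ_le, hs.τ_pos]

theorem Tame.iterate (hs : Scales d m a A γ δ ε σ τ s) (hZ : Orthonormal ℝ Z)
    (hψ : ∀ i, IsProfile (ψ i) a A γ δ) (hF : IsNoisyField Z ψ Fh ε) {B : Finset (Fin m)}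
    {u : Vec d} (h : Tame Z σ τ B u) (n : ℕ) :
    Tame Z σ τ B ((gHat Fh)^[n] u) ∧
      resid Z B ((gHat Fh)^[n] u) ≤ resid Z B u * (1 / 15) ^ n + σ / 900 := by
  induction n with
  | zero => exact ⟨h, by simp; linarith [hs.σ_pos]⟩
  | succ n ih =>
    rw [Function.iterate_succ_apply']
    obtain ⟨h1, h2⟩ := ih.1.step hs hZ hψ hF
    refine ⟨h1, ?_⟩
    rw [pow_succ]
    linarith [hs.σ_pos, ih.2]

end Dynamics

end HiddenBasis
end

noncomputable section

namespace HiddenBasis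

open Filter Topology

section Dynamics

variable {d m : ℕ} {Z : Fin m → Vec d} {ψ : Fin m → ℝ → ℝ} {Fh : Vec d → Vec d}
  {a A γ δ ε σ τ s : ℝ}

/-! ### Superexponential convergence near a basis vector -/

theorem Scales.one_le_of_fin (_ : Scales d m a A γ δ ε σ τ s) (i : Fin m) : (1 : ℝ) ≤ m := by
  have := i.pos
  exact_mod_cast this

/-- With one active direction every other coordinate is at most the residual `r` itself, so the
field contracts by a multiple of `r^(2γ)`: the new residual is of order `r^(1+2γ)` plus noise. -/
theorem resid_singleton_step (hs : Scales d m a A γ δ ε σ τ s) (hZ : Orthonormal ℝ Z)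
    (hψ : ∀ i, IsProfile (ψ i) a A γ δ) (hF : IsNoisyField Z ψ Fh ε) {i : Fin m}
    {u : Vec d} (hu : ‖u‖ = 1) (hR : resid Z {i} u ≤ 5 / 4 * σ) :
    resid Z {i} (gHat Fh u) ≤ 103 / 100 *
      (A / a * (resid Z {i} u ^ 2) ^ γ * resid Z {i} u + 4 * ε / a / 8) := by
  obtain ⟨c, hc, hFc⟩ := hF u hu
  have ha := hs.a_pos
  have hA := hs.A_pos
  have hL := hs.norm_ge hZ hψ (Finset.singleton_nonempty i) hu hR hc
  simp only [Finset.card_singleton, Nat.cast_one, Real.one_rpow, mul_one] at hL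
  have hσ1 : σ < 1 / 12 := by linarith [hs.σ_le, hs.τ_lt_one]
  have hm1 : (m : ℝ) ^ (-δ) ≤ 1 :=
    Real.rpow_le_one_of_one_le_of_nonpos (hs.one_le_of_fin i) (by linarith [hs.δ_pos])
  have hε : ε ≤ a / 12000 := by
    have h1 : a * (m : ℝ) ^ (-δ) ≤ a := by nlinarith
    nlinarith [hs.ε_le, hs.σ_pos]
  refine (resid_gHat_le hZ {i} hFc hL (by linarith)).trans ?_
  have h1 : resid Z {i} (∑ j, c j • Z j) ≤ 2 * (A * (resid Z {i} u ^ 2) ^ γ) * resid Z {i} u := by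
    refine resid_sum_le hZ (by positivity) fun j hj => ?_
    exact abs_field_le hZ hψ hs.γ_pos hs.A_pos hu hc (abs_inner_le_resid hZ hj u)
  have hR0 := resid_nonneg (Z := Z) {i} u
  have hε0 := hs.ε_pos
  have h2 : 2 * a * (100 / 103) ≤ 2 * a * (49 / 50) - ε := by linarith
  calc (resid Z {i} (∑ j, c j • Z j) + ε) / (2 * a * (49 / 50) - ε)
      ≤ (2 * (A * (resid Z {i} u ^ 2) ^ γ) * resid Z {i} u + ε) / (2 * a * (100 / 103)) := by
        gcongr
    _ = _ := by field_simp; ring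

theorem Scales.ratio_mul_rpow_le (hs : Scales d m a A γ δ ε σ τ s) (i : Fin m) {r : ℝ}
    (h0 : 0 ≤ r) (hr : r ≤ 5 / 4 * σ) : A / a * (r ^ 2) ^ γ ≤ 1 / 16 := by
  have h1 : (r ^ 2) ^ γ ≤ (τ ^ 2) ^ γ := by
    refine Real.rpow_le_rpow (sq_nonneg r) ?_ hs.γ_pos.le
    exact pow_le_pow_left₀ h0 (by linarith [hs.σ_le, hs.τ_pos]) 2
  have hm1 : (m : ℝ) ^ (-δ) ≤ 1 :=
    Real.rpow_le_one_of_one_le_of_nonpos (hs.one_le_of_fin i) (by linarith [hs.δ_pos])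
  rw [div_mul_eq_mul_div, div_le_iff₀ hs.a_pos]
  have h2 := mul_le_mul_of_nonneg_left h1 hs.A_pos.le
  rw [hs.τ_pow] at h2
  nlinarith [hs.a_pos]

/-- Put `y = 8(A/a) r^(2γ)`. While the noise does not dominate, a step gives `r' ≤ y r`, hence `y' ≤
y^(1+2γ)`; starting from `y ≤ 1/2`, this decays doubly exponentially. A residual below `4ε/a` stays
below it. -/
theorem resid_singleton_iterate_le (hs : Scales d m a A γ δ ε σ τ s) (hZ : Orthonormal ℝ Z)
    (hψ : ∀ i, IsProfile (ψ i) a A γ δ) (hF : IsNoisyField Z ψ Fh ε) {i : Fin m}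
    {u : Vec d} (hu : Tame Z σ τ {i} u) (hR : resid Z {i} u ≤ 9 / 8 * σ) {N : ℕ}
    (hN : (1 / 2 : ℝ) ^ ((1 + 2 * γ) ^ (N : ℝ)) ≤ 8 * (A / a) * ((4 * ε / a) ^ 2) ^ γ) :
    resid Z {i} ((gHat Fh)^[N] u) ≤ 4 * ε / a := by
  have ha := hs.a_pos
  have hA := hs.A_pos
  have hγ := hs.γ_pos
  set T := 4 * ε / a with hT
  have hT0 : 0 < T := by have := hs.ε_pos; positivity
  set K := A / a with hK
  have hK0 : 0 < K := by positivity
  have hbound : ∀ n, resid Z {i} ((gHat Fh)^[n] u) ≤ 5 / 4 * σ := by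
    intro n
    have h1 := (hu.iterate hs hZ hψ hF n).2
    have h2 : ((1 : ℝ) / 15) ^ n ≤ 1 := pow_le_one₀ (by norm_num) (by norm_num)
    have h3 := mul_le_mul_of_nonneg_left h2 (resid_nonneg (Z := Z) {i} u)
    linarith [hs.σ_pos]
  have key : ∀ n : ℕ, resid Z {i} ((gHat Fh)^[n] u) ≤ T ∨
      8 * K * (resid Z {i} ((gHat Fh)^[n] u) ^ 2) ^ γ ≤ (1 / 2 : ℝ) ^ ((1 + 2 * γ) ^ (n : ℝ)) := by
    intro n
    induction n with
    | zero =>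
      right
      have := hs.ratio_mul_rpow_le i (resid_nonneg (Z := Z) {i} u) (hbound 0)
      simp only [Function.iterate_zero, id, Nat.cast_zero, Real.rpow_zero, Real.rpow_one]
      linarith
    | succ n ih =>
      rw [Function.iterate_succ_apply']
      set w := (gHat Fh)^[n] u with hw
      have hstep := resid_singleton_step hs hZ hψ hF (hu.iterate hs hZ hψ hF n).1.norm_eq
        (hbound n)
      rw [← hw, ← hT, ← hK] at hstep
      have hsmall := hs.ratio_mul_rpow_le i (resid_nonneg (Z := Z) {i} w) (hbound n)
      rw [← hK] at hsmall
      have hr0 := resid_nonneg (Z := Z) {i} w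
      have hr1 := resid_nonneg (Z := Z) {i} (gHat Fh w)
      set r := resid Z {i} w with hr
      rcases ih with ih | ih
      · left
        nlinarith
      -- If the noise term is at most six times the signal, the step is at most `1.03 · 7 ≤ 8` times
      -- the signal; otherwise it is at most `1.03 (1/48 + 1/8) T ≤ T`.
      · by_cases hcase : T / 8 ≤ 6 * (K * (r ^ 2) ^ γ * r)
        · right
          have h1 : resid Z {i} (gHat Fh w) ≤ 8 * K * (r ^ 2) ^ γ * r := by
            have h0 := mul_nonneg (mul_nonneg hK0.le (Real.rpow_nonneg (sq_nonneg r) γ)) hr0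
            linarith
          have hy0 : 0 ≤ 8 * K * (r ^ 2) ^ γ := by positivity
          have h2 : (resid Z {i} (gHat Fh w) ^ 2) ^ γ ≤
              (8 * K * (r ^ 2) ^ γ) ^ (2 * γ) * (r ^ 2) ^ γ := by
            calc (resid Z {i} (gHat Fh w) ^ 2) ^ γ ≤ ((8 * K * (r ^ 2) ^ γ * r) ^ 2) ^ γ :=
                  Real.rpow_le_rpow (sq_nonneg _) (pow_le_pow_left₀ hr1 h1 2) hγ.le
              _ = (8 * K * (r ^ 2) ^ γ) ^ (2 * γ) * (r ^ 2) ^ γ := by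
                  rw [mul_pow, Real.mul_rpow (sq_nonneg _) (sq_nonneg _), Real.rpow_mul hy0,
                    Real.rpow_two]
          calc 8 * K * (resid Z {i} (gHat Fh w) ^ 2) ^ γ
              ≤ 8 * K * ((8 * K * (r ^ 2) ^ γ) ^ (2 * γ) * (r ^ 2) ^ γ) := by gcongr
            _ = (8 * K * (r ^ 2) ^ γ) ^ (1 + 2 * γ) := by
                rw [Real.rpow_add_of_nonneg hy0 zero_le_one (by positivity), Real.rpow_one]; ring
            _ ≤ ((1 / 2 : ℝ) ^ ((1 + 2 * γ) ^ (n : ℝ))) ^ (1 + 2 * γ) :=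
                Real.rpow_le_rpow hy0 ih (by positivity)
            _ = (1 / 2 : ℝ) ^ ((1 + 2 * γ) ^ ((n + 1 : ℕ) : ℝ)) := by
                rw [← Real.rpow_mul (by norm_num), Nat.cast_add, Nat.cast_one,
                  Real.rpow_add (by positivity), Real.rpow_one]
        · left
          push Not at hcase
          linarith
  rcases key N with h | h
  · exact h
  · have h1 := h.trans hN
    have h2 : (resid Z {i} ((gHat Fh)^[N] u) ^ 2) ^ γ ≤ (T ^ 2) ^ γ :=
      le_of_mul_le_mul_left h1 (by positivity)
    have h3 := (Real.rpow_le_rpow_iff (sq_nonneg _) (sq_nonneg _) hγ).1 h2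
    exact (sq_le_sq₀ (resid_nonneg _ _) hT0.le).1 h3

/-- For the right sign the squared distance is `2(1 - c)` with `c = |⟨u, Z i⟩| ≤ 1`, and `1 - c ≤ 1
- c²`. -/
theorem exists_sign_norm_sub_le (hZ : Orthonormal ℝ Z) {i : Fin m} {u : Vec d} (hu : ‖u‖ = 1) :
    ∃ t : ℝ, (t = 1 ∨ t = -1) ∧ ‖t • u - Z i‖ ≤ √2 * resid Z {i} u := by
  obtain ⟨t, ht, hti⟩ : ∃ t : ℝ, (t = 1 ∨ t = -1) ∧ t * inner ℝ u (Z i) = |inner ℝ u (Z i)| := by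
    rcases le_total 0 (inner ℝ u (Z i)) with h | h
    · exact ⟨1, Or.inl rfl, by rw [one_mul, abs_of_nonneg h]⟩
    · exact ⟨-1, Or.inr rfl, by rw [abs_of_nonpos h]; ring⟩
  refine ⟨t, ht, ?_⟩
  refine (sq_le_sq₀ (norm_nonneg _) (mul_nonneg (Real.sqrt_nonneg 2) (resid_nonneg _ _))).1 ?_
  rw [norm_sub_sq_real, real_inner_smul_left, hti, norm_smul, hu, hZ.1 i, mul_pow √2,
    Real.sq_sqrt zero_le_two, resid_sq hZ, hu, Finset.sum_singleton]
  have h1 : ‖t‖ = 1 := by rcases ht with rfl | rfl <;> simp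
  have h2 := abs_inner_le_one hZ hu i
  have h3 := sq_abs (inner ℝ u (Z i))
  rw [h1]
  nlinarith [abs_nonneg (inner ℝ u (Z i))]

/-! ### Balanced points -/

/-- For each nonempty `B` the simplex on `B` contains a point at which all profiles agree. -/
theorem exists_balanced (hψ : ∀ i, IsProfile (ψ i) a A γ δ) (ha : 0 < a) (hδ : 0 < δ)
    {B : Finset (Fin m)} (hB : B.Nonempty) :
    ∃ (x : Fin m → ℝ) (l : ℝ), (∀ i ∈ B, x i ∈ Icc (0 : ℝ) 1 ∧ ψ i (x i) = l) ∧
      ∑ i ∈ B, x i = 1 := by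
  have hn : (0 : ℝ) < B.card := by exact_mod_cast hB.card_pos
  set S : Set (Fin m → ℝ) := Icc 0 1 ∩ {x | ∑ i ∈ B, x i = 1} with hS
  have hcomp : IsCompact S :=
    isCompact_Icc.inter_right (isClosed_eq (by fun_prop) continuous_const)
  have hne : S.Nonempty := by
    refine ⟨fun _ => (B.card : ℝ)⁻¹, ⟨⟨fun i => ?_, fun i => ?_⟩, ?_⟩⟩
    · exact inv_nonneg.2 hn.le
    · exact inv_le_one_of_one_le₀ (Nat.one_le_cast.2 hB.card_pos)
    · simp [hn.ne']
  have hcont : ContinuousOn (fun x : Fin m → ℝ => B.inf' hB fun i => ψ i (x i)) S := by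
    refine ContinuousOn.finset_inf'_apply hB fun i _ => ?_
    exact (hψ i).continuousOn.comp (continuous_apply i).continuousOn
      fun x hx => ⟨hx.1.1 i, hx.1.2 i⟩
  -- A point maximising the smallest value `ψᵢ(xᵢ)` is balanced, since any surplus at one index
  -- could be shared to raise the minimum.
  obtain ⟨x, hx, hmax⟩ := hcomp.exists_isMaxOn hne hcont
  have hx01 : ∀ i, x i ∈ Icc (0 : ℝ) 1 := fun i => ⟨hx.1.1 i, hx.1.2 i⟩
  set l := B.inf' hB fun i => ψ i (x i) with hl
  have hle : ∀ i ∈ B, l ≤ ψ i (x i) := fun i hi =>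
    Finset.inf'_le (fun i => ψ i (x i)) hi
  have hl0 : 0 ≤ l := by
    rw [hl, Finset.le_inf'_iff]
    exact fun i _ => (hψ i).nonneg hδ ha (hx01 i)
  refine ⟨x, l, fun j hj => ⟨hx01 j, ?_⟩, hx.2⟩
  by_contra hjne
  have hlt : l < ψ j (x j) := lt_of_le_of_ne (hle j hj) (Ne.symm hjne)
  have hxj : 0 < x j := by
    rcases (hx01 j).1.eq_or_lt with h | h
    · rw [← h, (hψ j).zero] at hlt
      linarith
    · exact h
  -- Mass `t` is taken from `j` and redistributed evenly over `B`, with `j` included. By continuity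
  -- a small `t` leaves `ψ j` above `l`, and every other value strictly increases.
  obtain ⟨t, ht0, htx, ht⟩ : ∃ t, 0 < t ∧ t ≤ x j ∧ l < ψ j (x j + t / B.card - t) := by
    have hmap : MapsTo (fun t : ℝ => x j + t / B.card - t) (Icc 0 (x j)) (Icc 0 1) := by
      intro t ht
      have h1 : t / B.card ≤ t := div_le_self ht.1 (Nat.one_le_cast.2 hB.card_pos)
      have h2 : 0 ≤ t / B.card := div_nonneg ht.1 hn.le
      exact ⟨by linarith [ht.2], by linarith [(hx01 j).2]⟩
    have hc : ContinuousWithinAt (fun t : ℝ => ψ j (x j + t / B.card - t)) (Icc 0 (x j)) 0 :=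
      ((hψ j).continuousOn.comp (by fun_prop) hmap) 0 ⟨le_rfl, hxj.le⟩
    have hc' := (hc.mono Ioc_subset_Icc_self).eventually (lt_mem_nhds (a := l) (by simpa using hlt))
    have hnb : (𝓝[Ioc 0 (x j)] (0 : ℝ)).NeBot := by
      rw [nhdsWithin_Ioc_eq_nhdsGT hxj]; infer_instance
    obtain ⟨t, ht, htm⟩ := (hc'.and self_mem_nhdsWithin).exists
    exact ⟨t, htm.1, htm.2, ht⟩
  have htn : 0 < t / B.card := div_pos ht0 hn
  set y : Fin m → ℝ := fun i => if i ∈ B then x i + t / B.card - (if i = j then t else 0) else 0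
    with hy
  have hyB : ∀ i ∈ B, y i = x i + t / B.card - (if i = j then t else 0) := fun i hi => if_pos hi
  have hy0 : ∀ i, 0 ≤ y i := by
    intro i
    by_cases hi : i ∈ B
    · rw [hyB i hi]
      split_ifs with h
      · subst h; linarith
      · linarith [(hx01 i).1]
    · simp [hy, hi]
  have hysum : ∑ i ∈ B, y i = 1 := by
    rw [Finset.sum_congr rfl hyB, Finset.sum_sub_distrib, Finset.sum_add_distrib, hx.2]
    rw [Finset.sum_ite_eq' B j, if_pos hj, Finset.sum_const, nsmul_eq_mul, mul_div_cancel₀ _ hn.ne']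
    ring
  have hy1 : ∀ i, y i ≤ 1 := by
    intro i
    by_cases hi : i ∈ B
    · rw [← hysum]
      exact Finset.single_le_sum (fun i _ => hy0 i) hi
    · simp [hy, hi]
  have hyS : y ∈ S := ⟨⟨hy0, hy1⟩, hysum⟩
  have h1 : (B.inf' hB fun i => ψ i (y i)) ≤ l := hmax hyS
  refine absurd h1 (not_le.2 ?_)
  rw [Finset.lt_inf'_iff]
  intro i hi
  rw [hyB i hi]
  by_cases h : i = j
  · subst h
    simpa using ht
  · rw [if_neg h, sub_zero]
    have h2 : x i + t / B.card ≤ 1 := by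
      have := hy1 i
      rwa [hyB i hi, if_neg h, sub_zero] at this
    exact (hle i hi).trans_lt ((hψ i).strictMonoOn hδ ha (hx01 i)
      ⟨by linarith [(hx01 i).1], h2⟩ (by linarith))

/-- Some `x j` is at least `1/m`, so the common level is at least `a m^(-δ) = A s^γ`; being at most
`A (x i)^γ`, it forces `x i ≥ s`. -/
theorem Scales.exists_balanced (hs : Scales d m a A γ δ ε σ τ s)
    (hψ : ∀ i, IsProfile (ψ i) a A γ δ) {B : Finset (Fin m)} (hB : B.Nonempty) :
    ∃ (x : Fin m → ℝ) (l : ℝ), (∀ i ∈ B, s ≤ x i ∧ x i ≤ 1 ∧ ψ i (x i) = l) ∧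
      ∑ i ∈ B, x i = 1 := by
  obtain ⟨x, l, hx, hsum⟩ := HiddenBasis.exists_balanced hψ hs.a_pos hs.δ_pos hB
  refine ⟨x, l, fun i hi => ⟨?_, (hx i hi).1.2, (hx i hi).2⟩, hsum⟩
  have hm : (0 : ℝ) < m := by have := i.pos; exact_mod_cast this
  obtain ⟨j, hj, hjm⟩ : ∃ j ∈ B, (m : ℝ)⁻¹ ≤ x j := by
    refine Finset.exists_le_of_sum_le hB ?_
    rw [hsum, Finset.sum_const, nsmul_eq_mul, ← div_eq_mul_inv, div_le_one hm]
    have := B.card_le_univ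
    rw [Fintype.card_fin] at this
    exact_mod_cast this
  have h1 := (hψ j).lower_le hs.δ_pos (hx j hj).1
  have h2 : (m : ℝ) ^ (-δ) ≤ x j ^ δ := by
    rw [Real.rpow_neg hm.le, ← Real.inv_rpow hm.le]
    exact Real.rpow_le_rpow (inv_nonneg.2 hm.le) hjm hs.δ_pos.le
  have h3 := (hψ i).le_upper hs.γ_pos (hx i hi).1
  rw [(hx i hi).2, ← (hx j hj).2] at h3
  have h4 : A * s ^ γ ≤ A * x i ^ γ := by
    rw [hs.s_pow]
    exact ((mul_le_mul_of_nonneg_left h2 hs.a_pos.le).trans h1).trans h3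
  exact (Real.rpow_le_rpow_iff hs.s_pos.le (hx i hi).1.1 hs.γ_pos).1
    (le_of_mul_le_mul_left h4 hs.A_pos)

end Dynamics

end HiddenBasis
end

noncomputable section

namespace HiddenBasis

open Filter Topology

section Dynamics

variable {d m : ℕ} {Z : Fin m → Vec d} {ψ : Fin m → ℝ → ℝ} {Fh : Vec d → Vec d}
  {a A γ δ ε σ τ s : ℝ}

/-! ### Spreading away from balanced points -/

/-- The logarithmic position of the `i`-th squared coordinate of `u` relative to `x i`. -/
def logPos (Z : Fin m → Vec d) (x : Fin m → ℝ) (u : Vec d) (i : Fin m) : ℝ :=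
  Real.log (inner ℝ u (Z i) ^ 2) - Real.log (x i)

/-- Two of the logarithmic positions with index in `B` differ by at least `X`. -/
def Separated (Z : Fin m → Vec d) (x : Fin m → ℝ) (B : Finset (Fin m)) (X : ℝ) (u : Vec d) : Prop :=
  ∃ i ∈ B, ∃ j ∈ B, X ≤ logPos Z x u i - logPos Z x u j

/-- The a priori bound that stops the spreading phase: squared coordinates range over `[τ², 1]` and
balanced ones over `[s, 1]`. -/
theorem Separated.le_log (hZ : Orthonormal ℝ Z) {x : Fin m → ℝ} {B : Finset (Fin m)} {X : ℝ}
    {u : Vec d} (hs : 0 < s) (hτ : 0 < τ) (hx : ∀ i ∈ B, s ≤ x i ∧ x i ≤ 1) (hu : ‖u‖ = 1)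
    (hbig : ∀ i ∈ B, τ < |inner ℝ u (Z i)|) (h : Separated Z x B X u) :
    X ≤ -Real.log s - Real.log (τ ^ 2) := by
  obtain ⟨i, hi, j, hj, hX⟩ := h
  have h1 := inner_sq_mem_Icc hZ hu i
  have h2 : Real.log (inner ℝ u (Z i) ^ 2) ≤ 0 := Real.log_nonpos h1.1 h1.2
  have h3 : Real.log s ≤ Real.log (x i) := Real.log_le_log hs (hx i hi).1
  have h4 : Real.log (τ ^ 2) ≤ Real.log (inner ℝ u (Z j) ^ 2) := by
    refine Real.log_le_log (by positivity) ?_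
    rw [← sq_abs (inner ℝ u (Z j))]
    exact pow_le_pow_left₀ hτ.le (hbig j hj).le 2
  have h5 : Real.log (x j) ≤ 0 := Real.log_nonpos (hs.le.trans (hx j hj).1) (hx j hj).2
  unfold logPos at hX
  linarith

/-- If the positions of a unit vector near the span of `B` are spread out, then the largest one is
bounded away from `0`. -/
theorem Scales.logPos_max_ge (hs : Scales d m a A γ δ ε σ τ s) (hZ : Orthonormal ℝ Z)
    (hd : 0 < d) {x : Fin m → ℝ} {B : Finset (Fin m)} (hx : ∀ i ∈ B, s ≤ x i ∧ x i ≤ 1)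
    (hsum : ∑ i ∈ B, x i = 1) {u : Vec d} (hu : ‖u‖ = 1) (hR : resid Z B u ≤ 5 / 4 * σ)
    (hpos : ∀ i ∈ B, 0 < inner ℝ u (Z i) ^ 2) {i j : Fin m} (hj : j ∈ B)
    (hmax : ∀ k ∈ B, logPos Z x u k ≤ logPos Z x u i)
    (hX : 2 * (σ / (5 * √d)) ≤ logPos Z x u i - logPos Z x u j) :
    2 * (s * σ / (40 * √d)) ≤ logPos Z x u i := by
  have hd' : 0 < √(d : ℝ) := Real.sqrt_pos.2 (by exact_mod_cast hd)
  have hd1 : 1 ≤ √(d : ℝ) := Real.one_le_sqrt.2 (by exact_mod_cast hd)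
  have hσ := hs.σ_pos
  have hs0 := hs.s_pos
  set ξ := σ / (5 * √d) with hξ
  have hξ0 : 0 < ξ := by positivity
  have hξ1 : ξ ≤ 1 / 2 := by
    rw [hξ, div_le_iff₀ (by positivity)]
    nlinarith [hs.σ_le, hs.τ_lt_one]
  have hs1 : s ≤ 1 := (hx j hj).1.trans (hx j hj).2
  set M := Real.exp (logPos Z x u i) with hM
  have hM0 : 0 < M := Real.exp_pos _
  have hexp : ∀ k ∈ B, inner ℝ u (Z k) ^ 2 = Real.exp (logPos Z x u k) * x k := by
    intro k hk
    have hxk : 0 < x k := hs0.trans_le (hx k hk).1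
    rw [logPos, Real.exp_sub, Real.exp_log (hpos k hk), Real.exp_log hxk,
      div_mul_cancel₀ _ hxk.ne']
  have hle : ∀ k ∈ B, inner ℝ u (Z k) ^ 2 ≤ M * x k := by
    intro k hk
    rw [hexp k hk]
    exact mul_le_mul_of_nonneg_right (Real.exp_le_exp.2 (hmax k hk)) (hs0.le.trans (hx k hk).1)
  have hxj : 0 < x j := hs0.trans_le (hx j hj).1
  -- The gap makes coordinate `j` fall short of `M * x j` by the factor `exp(-2ξ) ≤ 1 - ξ`, valid
  -- for `ξ ≤ 1/2`.
  have hjle : inner ℝ u (Z j) ^ 2 ≤ M * ((1 - ξ) * x j) := by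
    rw [hexp j hj, ← mul_assoc]
    refine mul_le_mul_of_nonneg_right ?_ hxj.le
    have h1 : Real.exp (logPos Z x u j) ≤ M * Real.exp (-(2 * ξ)) := by
      rw [hM, ← Real.exp_add]
      exact Real.exp_le_exp.2 (by linarith)
    refine h1.trans (mul_le_mul_of_nonneg_left ?_ hM0.le)
    have h2 : Real.exp (-(2 * ξ)) = (Real.exp (2 * ξ))⁻¹ := Real.exp_neg _
    have h3 := Real.add_one_le_exp (2 * ξ)
    rw [h2]
    refine (inv_anti₀ (by positivity) h3).trans ?_
    rw [inv_le_iff_one_le_mul₀ (by positivity)]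
    nlinarith
  -- The deficit at `j` is at least `s ξ` in the total mass. As that mass is nearly `1`, the factor
  -- `M` must exceed `1`.
  have hmass : 1 - resid Z B u ^ 2 ≤ M * (1 - s * ξ) := by
    rw [← sum_inner_sq_eq hZ B hu, ← Finset.add_sum_erase B _ hj]
    have h1 : ∑ k ∈ B.erase j, inner ℝ u (Z k) ^ 2 ≤ M * (1 - x j) := by
      have h2 : 1 - x j = ∑ k ∈ B.erase j, x k := by
        rw [← hsum, ← Finset.add_sum_erase B _ hj]; ring
      rw [h2, Finset.mul_sum]
      exact Finset.sum_le_sum fun k hk => hle k (Finset.mem_of_mem_erase hk)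
    have h3 : s * ξ ≤ x j * ξ := mul_le_mul_of_nonneg_right (hx j hj).1 hξ0.le
    nlinarith
  -- The missing mass must be small against `s ξ`; this is what the bound on `σ √d` is for.
  have hR2 : resid Z B u ^ 2 ≤ s * ξ / 4 := by
    have h1 := pow_le_pow_left₀ (resid_nonneg B u) hR 2
    have h2 : σ ^ 2 ≤ s * ξ * (5 / 32) := by
      have e : σ ^ 2 = 5 * ξ * (σ * √d) := by rw [hξ]; field_simp
      rw [e]
      nlinarith [hs.σ_sqrt_le]
    nlinarith
  have hy0 : 0 < s * ξ := by positivity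
  have hy1 : s * ξ ≤ 1 / 2 := by nlinarith
  have hMge : 1 + s * ξ / 2 ≤ M := by
    by_contra hlt
    push Not at hlt
    nlinarith [mul_lt_mul_of_pos_right hlt (by linarith : 0 < 1 - s * ξ)]
  have hlog : Real.log (1 + s * ξ / 2) ≤ logPos Z x u i := by
    rw [← Real.log_exp (logPos Z x u i)]
    exact Real.log_le_log (by linarith) hMge
  refine le_trans ?_ hlog
  have h4 := Real.one_sub_inv_le_log_of_pos (by linarith : 0 < 1 + s * ξ / 2)
  refine le_trans ?_ h4
  have e : 2 * (s * σ / (40 * √d)) = s * ξ / 4 := by rw [hξ]; field_simp; ring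
  rw [e, le_sub_iff_add_le, ← le_sub_iff_add_le', inv_le_iff_one_le_mul₀ (by positivity)]
  nlinarith

/-- The relative error is at most `e/b ≤ 1/2`, and `log(1-y) ≥ -2y`, `log(1+y) ≤ y` there. The
losses `2` and `1` add up to the `3` in `Scales.ε_growth`. -/
theorem log_sub_ge {c f e b : ℝ} (hb : 0 < b) (he : 0 ≤ e) (heb : e ≤ b / 2) (hc : b ≤ |c|)
    (hf : |f - c| ≤ e) : Real.log |c| - 2 * (e / b) ≤ Real.log |f| ∧
      Real.log |f| ≤ Real.log |c| + e / b ∧ f ≠ 0 := by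
  have hc0 : 0 < |c| := hb.trans_le hc
  have h1 : |c| - |f| ≤ e := by
    have := abs_sub_abs_le_abs_sub c f
    rw [abs_sub_comm] at this
    linarith
  have h2 : |f| - |c| ≤ e := (abs_sub_abs_le_abs_sub f c).trans hf
  have hy : e ≤ e / b * |c| := by
    rw [div_mul_eq_mul_div, le_div_iff₀ hb]
    exact mul_le_mul_of_nonneg_left hc he
  have hy0 : 0 ≤ e / b := by positivity
  have hy2 : e / b ≤ 1 / 2 := by rw [div_le_iff₀ hb]; linarith
  have hf0 : 0 < |f| := by linarith
  refine ⟨?_, ?_, abs_pos.1 hf0⟩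
  · have h3 : |c| * (1 - e / b) ≤ |f| := by linarith
    have h4 := Real.log_le_log (mul_pos hc0 (by linarith)) h3
    rw [Real.log_mul hc0.ne' (by linarith)] at h4
    have h5 := Real.one_sub_inv_le_log_of_pos (by linarith : 0 < 1 - e / b)
    have h6 : (1 - e / b)⁻¹ ≤ 1 + 2 * (e / b) := by
      rw [inv_le_iff_one_le_mul₀ (by linarith)]
      nlinarith
    linarith
  · have h3 : |f| ≤ |c| * (1 + e / b) := by linarith
    have h4 := Real.log_le_log hf0 h3
    rw [Real.log_mul hc0.ne' (by linarith)] at h4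
    have h5 := Real.log_le_sub_one_of_pos (by linarith : 0 < 1 + e / b)
    linarith

/-- Take the indices of the largest and smallest position: the first squared coordinate lies above
`x i`, the second at or below `x j`, so `ψ i` is above the common level and `ψ j` is not.
Normalisation cancels in the difference of logarithms, which gains `2(log ψ i - log ψ j) ≥ 4ρη` and
loses at most `6ε/b ≤ 2ρη` to noise. -/
theorem Separated.step (hs : Scales d m a A γ δ ε σ τ s) (hZ : Orthonormal ℝ Z)
    (hψ : ∀ i, IsProfile (ψ i) a A γ δ) (hF : IsNoisyField Z ψ Fh ε) (hd : 0 < d)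
    {x : Fin m → ℝ} {l : ℝ} {B : Finset (Fin m)}
    (hx : ∀ i ∈ B, s ≤ x i ∧ x i ≤ 1 ∧ ψ i (x i) = l) (hsum : ∑ i ∈ B, x i = 1)
    {u : Vec d} (hu : ‖u‖ = 1) (hR : resid Z B u ≤ 5 / 4 * σ)
    (hbig : ∀ i ∈ B, τ < |inner ℝ u (Z i)|) {X : ℝ} (hX0 : 2 * (σ / (5 * √d)) ≤ X)
    (h : Separated Z x B X u) :
    Separated Z x B (X + 2 * (δ * (a / A) * s ^ (δ - γ) * (s * σ / (40 * √d))))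
      (gHat Fh u) := by
  obtain ⟨i₀, hi₀, j₀, hj₀, hX⟩ := h
  have hBne : B.Nonempty := ⟨i₀, hi₀⟩
  obtain ⟨i, hi, hmax⟩ := B.exists_max_image (logPos Z x u) hBne
  obtain ⟨j, hj, hmin⟩ := B.exists_min_image (logPos Z x u) hBne
  have hXij : X ≤ logPos Z x u i - logPos Z x u j := by linarith [hmax i₀ hi₀, hmin j₀ hj₀]
  have habs : ∀ k ∈ B, 0 < |inner ℝ u (Z k)| := fun k hk => hs.τ_pos.trans (hbig k hk)
  have hpos : ∀ k ∈ B, 0 < inner ℝ u (Z k) ^ 2 := fun k hk => by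
    rw [← sq_abs]; exact pow_pos (habs k hk) 2
  have hmaxge := hs.logPos_max_ge hZ hd (fun k hk => ⟨(hx k hk).1, (hx k hk).2.1⟩) hsum hu hR
    hpos hj hmax (by linarith)
  have hxpos : ∀ k ∈ B, 0 < x k := fun k hk => hs.s_pos.trans_le (hx k hk).1
  -- The squared coordinates on `B` have sum at most `1 = ∑ x`, so one of them is at most its
  -- balanced value.
  have hminle : logPos Z x u j ≤ 0 := by
    obtain ⟨k, hk, hkx⟩ : ∃ k ∈ B, inner ℝ u (Z k) ^ 2 ≤ x k := by
      refine Finset.exists_le_of_sum_le hBne ?_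
      rw [hsum, sum_inner_sq_eq hZ B hu]
      linarith [sq_nonneg (resid Z B u)]
    refine (hmin k hk).trans ?_
    rw [logPos]
    linarith [Real.log_le_log (hpos k hk) hkx]
  obtain ⟨c, hc, hFc⟩ := hF u hu
  set ρ := δ * (a / A) * s ^ (δ - γ) with hρ
  set η := s * σ / (40 * √d) with hη
  have hρ0 : 0 ≤ ρ := by
    have := hs.δ_pos; have := hs.a_pos; have := hs.A_pos; have := hs.s_pos; positivity
  have hi1 := inner_sq_mem_Icc hZ hu i
  have hj1 := inner_sq_mem_Icc hZ hu j
  have hη0 : 0 ≤ η := by have := hs.s_pos; have := hs.σ_pos; positivity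
  have hxi : x i ≤ inner ℝ u (Z i) ^ 2 := by
    have h1 : 0 ≤ logPos Z x u i := by linarith
    rw [logPos, sub_nonneg] at h1
    exact (Real.log_le_log_iff (hxpos i hi) (hpos i hi)).1 h1
  have hxj : inner ℝ u (Z j) ^ 2 ≤ x j := by
    rw [logPos, sub_nonpos] at hminle
    exact (Real.log_le_log_iff (hpos j hj) (hxpos j hj)).1 hminle
  have hgi := (hψ i).log_growth hs.δ_pos hs.γ_pos hs.a_pos hs.s_pos (hx i hi).1 hxi hi1.2
  rw [(hx i hi).2.2, ← hρ] at hgi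
  have hgi' : 2 * (ρ * η) ≤ Real.log (ψ i (inner ℝ u (Z i) ^ 2)) - Real.log l := by
    refine le_trans ?_ hgi
    have := mul_le_mul_of_nonneg_left hmaxge hρ0
    rw [logPos] at this
    linarith
  have hψpos : ∀ k ∈ B, 0 < ψ k (inner ℝ u (Z k) ^ 2) := fun k hk =>
    (hψ k).pos hs.δ_pos hs.a_pos ⟨hpos k hk, (inner_sq_mem_Icc hZ hu k).2⟩
  have hgj : Real.log (ψ j (inner ℝ u (Z j) ^ 2)) ≤ Real.log l := by
    refine Real.log_le_log (hψpos j hj) ?_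
    rw [← (hx j hj).2.2]
    exact ((hψ j).strictMonoOn hs.δ_pos hs.a_pos).monotoneOn hj1
      ⟨(hxpos j hj).le, (hx j hj).2.1⟩ hxj
  set b := 2 * (a * (τ * (τ ^ 2) ^ δ)) with hb
  have hb0 : 0 < b := by have := hs.a_pos; have := hs.τ_pos; positivity
  have hcb : ∀ k ∈ B, b ≤ |c k| := by
    intro k hk
    rw [hc k]
    have h1 := (hψ k).lower_le hs.δ_pos (inner_sq_mem_Icc hZ hu k)
    have h2 : (τ ^ 2) ^ δ ≤ (inner ℝ u (Z k) ^ 2) ^ δ := by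
      refine Real.rpow_le_rpow (sq_nonneg τ) ?_ hs.δ_pos.le
      rw [← sq_abs (inner ℝ u (Z k))]
      exact pow_le_pow_left₀ hs.τ_pos.le (hbig k hk).le 2
    have h3 : a * (τ ^ 2) ^ δ ≤ ψ k (inner ℝ u (Z k) ^ 2) :=
      (mul_le_mul_of_nonneg_left h2 hs.a_pos.le).trans h1
    have h4 : τ * (a * (τ ^ 2) ^ δ) ≤ |inner ℝ u (Z k)| * ψ k (inner ℝ u (Z k) ^ 2) :=
      mul_le_mul (hbig k hk).le h3
        (mul_nonneg hs.a_pos.le (Real.rpow_nonneg (sq_nonneg τ) _)) (abs_nonneg _)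
    rw [hb]
    linarith
  have hfk : ∀ k, |inner ℝ (Fh u) (Z k) - c k| ≤ ε := by
    intro k
    rw [← inner_sum_smul hZ c k, ← inner_sub_left]
    refine (abs_real_inner_le_norm _ _).trans ?_
    rw [hZ.1 k, mul_one]
    exact hFc
  have hεb : ε ≤ b / 2 := by linarith [hs.ε_le_half]
  have hfi := log_sub_ge hb0 hs.ε_pos.le hεb (hcb i hi) (hfk i)
  have hfj := log_sub_ge hb0 hs.ε_pos.le hεb (hcb j hj) (hfk j)
  have hF0 : Fh u ≠ 0 := by
    intro h0
    apply hfi.2.2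
    rw [h0, inner_zero_left]
  have hFn : 0 < ‖Fh u‖ := norm_pos_iff.2 hF0
  have hlog : ∀ k, inner ℝ (Fh u) (Z k) ≠ 0 → Real.log (inner ℝ (gHat Fh u) (Z k) ^ 2) =
      2 * Real.log |inner ℝ (Fh u) (Z k)| - 2 * Real.log ‖Fh u‖ := by
    intro k hk
    rw [gHat, if_pos hF0, real_inner_smul_left, Real.log_pow, Real.log_mul (inv_ne_zero hFn.ne') hk,
      Real.log_inv, Real.log_abs]
    push_cast
    ring
  have hlogc : ∀ k ∈ B, 2 * Real.log |c k| = 2 * Real.log 2 + Real.log (inner ℝ u (Z k) ^ 2) +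
      2 * Real.log (ψ k (inner ℝ u (Z k) ^ 2)) := by
    intro k hk
    rw [hc k, Real.log_mul (by have := habs k hk; positivity) (hψpos k hk).ne',
      Real.log_mul two_ne_zero (habs k hk).ne', Real.log_pow, Real.log_abs]
    push_cast
    ring
  have herr : 3 * (ε / b) ≤ ρ * η := by
    rw [← mul_div_assoc, div_le_iff₀ hb0]
    linarith [hs.ε_growth]
  refine ⟨i, hi, j, hj, ?_⟩
  have h1 := hlogc i hi
  have h2 := hlogc j hj
  unfold logPos at hXij ⊢
  rw [hlog i hfi.2.2, hlog j hfj.2.2]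
  linarith [hfi.1, hfj.2.1]

/-- A separated vector loses one of its large coordinates. -/
theorem exists_erase_resid_le (hs : Scales d m a A γ δ ε σ τ s) (hZ : Orthonormal ℝ Z)
    (hψ : ∀ i, IsProfile (ψ i) a A γ δ) (hF : IsNoisyField Z ψ Fh ε) (hd : 0 < d)
    {x : Fin m → ℝ} {l : ℝ} {B : Finset (Fin m)}
    (hx : ∀ i ∈ B, s ≤ x i ∧ x i ≤ 1 ∧ ψ i (x i) = l) (hsum : ∑ i ∈ B, x i = 1)
    {w : Vec d} (hw : Tame Z σ τ B w) (hR : resid Z B w ≤ 9 / 8 * σ)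
    (hsep : (∃ k ∈ B, |inner ℝ w (Z k)| ≤ τ) ∨ Separated Z x B (2 * (σ / (5 * √d))) w)
    {J L N : ℕ} (hL : ((1 : ℝ) / 15) ^ L ≤ σ / 10)
    (hJ : -Real.log s - Real.log (τ ^ 2) <
      2 * (δ * (a / A) * s ^ (δ - γ) * (s * σ / (40 * √d))) * J)
    (hN : J + L ≤ N) : ∃ k ∈ B, resid Z (B.erase k) ((gHat Fh)^[N] w) ≤ σ / 8 := by
  set q := 2 * (δ * (a / A) * s ^ (δ - γ) * (s * σ / (40 * √d))) with hq
  have hq0 : 0 ≤ q := by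
    have := hs.δ_pos; have := hs.a_pos; have := hs.A_pos; have := hs.s_pos; have := hs.σ_pos
    positivity
  have hd' : 0 ≤ 2 * (σ / (5 * √(d : ℝ))) := by have := hs.σ_pos; positivity
  -- If all coordinates in `B` stayed above `τ` for `J` steps, the gap would outgrow the bound of
  -- `Separated.le_log`.
  obtain ⟨n, hnJ, k, hk, hsmall⟩ : ∃ n ≤ J, ∃ k ∈ B,
      |inner ℝ ((gHat Fh)^[n] w) (Z k)| ≤ τ := by
    by_contra hcon
    push Not at hcon
    have hsep' : Separated Z x B (2 * (σ / (5 * √d))) w := by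
      rcases hsep with ⟨k, hk, hk'⟩ | h
      · exact absurd (hcon 0 (Nat.zero_le _) k hk) (not_lt.2 hk')
      · exact h
    have hgrow : ∀ n ≤ J, Separated Z x B (2 * (σ / (5 * √d)) + q * n) ((gHat Fh)^[n] w) := by
      intro n
      induction n with
      | zero => intro _; simpa using hsep'
      | succ n ih =>
        intro hn
        have ht := hw.iterate hs hZ hψ hF n
        have hRn : resid Z B ((gHat Fh)^[n] w) ≤ 5 / 4 * σ := by
          have h2 : ((1 : ℝ) / 15) ^ n ≤ 1 := pow_le_one₀ (by norm_num) (by norm_num)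
          have h3 := mul_le_mul_of_nonneg_left h2 (resid_nonneg (Z := Z) B w)
          linarith [hs.σ_pos, ht.2]
        have := Separated.step hs hZ hψ hF hd hx hsum ht.1.norm_eq hRn (hcon n (by omega))
          (le_add_of_nonneg_right (mul_nonneg hq0 (Nat.cast_nonneg n))) (ih (by omega))
        rw [Function.iterate_succ_apply']
        convert this using 1
        push_cast
        ring
    have h1 := (hgrow J le_rfl).le_log hZ hs.s_pos hs.τ_pos
      (fun i hi => ⟨(hx i hi).1, (hx i hi).2.1⟩) (hw.iterate hs hZ hψ hF J).1.norm_eq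
      (hcon J le_rfl)
    linarith
  refine ⟨k, hk, ?_⟩
  have ht := (hw.iterate hs hZ hψ hF n).1
  -- From now on `k` is inactive, and at least `L` steps remain in which contraction acts.
  have ht' : Tame Z σ τ (B.erase k) ((gHat Fh)^[n] w) := by
    refine ⟨ht.norm_eq, ht.resid_univ_le, fun i hi => ?_⟩
    by_cases hik : i = k
    · rw [hik]; exact hsmall
    · exact ht.abs_inner_le i fun hiB => hi (Finset.mem_erase.2 ⟨hik, hiB⟩)
  have h1 := (ht'.iterate hs hZ hψ hF (N - n)).2
  rw [← Function.iterate_add_apply, Nat.sub_add_cancel (by omega)] at h1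
  refine h1.trans ?_
  have h2 : resid Z (B.erase k) ((gHat Fh)^[n] w) ≤ 1 := by
    rw [← ht.norm_eq]; exact resid_le_norm hZ _ _
  have h3 : ((1 : ℝ) / 15) ^ (N - n) ≤ (1 / 15) ^ L :=
    pow_le_pow_of_le_one (by norm_num) (by norm_num) (by omega)
  have h4 : 0 ≤ ((1 : ℝ) / 15) ^ (N - n) := by positivity
  have h5 : resid Z (B.erase k) ((gHat Fh)^[n] w) * (1 / 15) ^ (N - n) ≤ 1 * (1 / 15) ^ L :=
    mul_le_mul h2 h3 h4 zero_le_one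
  linarith [hs.σ_pos]

/-! ### The random jump -/

theorem resid_jump_le (hZ : Orthonormal ℝ Z) (B : Finset (Fin m)) (hσ : 0 ≤ σ) {u e : Vec d}
    (he : ‖e‖ = 1) :
    resid Z B (Real.cos σ • u + Real.sin σ • e) ≤ resid Z B u + σ := by
  refine (resid_add_le _ _ _).trans ?_
  rw [resid_smul, resid_smul]
  have h1 : |Real.cos σ| * resid Z B u ≤ 1 * resid Z B u :=
    mul_le_mul_of_nonneg_right (Real.abs_cos_le_one σ) (resid_nonneg _ _)
  have h2 : |Real.sin σ| * resid Z B e ≤ σ * 1 := by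
    refine mul_le_mul ?_ ?_ (resid_nonneg _ _) hσ
    · exact (Real.abs_sin_le_abs).trans (abs_of_nonneg hσ).le
    · rw [← he]; exact resid_le_norm hZ B e
  linarith

theorem norm_jump {u e : Vec d} (hu : ‖u‖ = 1) (he : ‖e‖ = 1) (hue : inner ℝ u e = 0) :
    ‖Real.cos σ • u + Real.sin σ • e‖ = 1 := by
  have : ‖Real.cos σ • u + Real.sin σ • e‖ ^ 2 = 1 := by
    rw [norm_add_sq_real, norm_smul, norm_smul, hu, he, inner_smul_left, inner_smul_right, hue,
      Real.norm_eq_abs, Real.norm_eq_abs, mul_one, mul_one, sq_abs, sq_abs]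
    simp
  exact (sq_eq_sq₀ (norm_nonneg _) zero_le_one).1 (by rw [this, one_pow])

/-- A jump of length `σ` raises the residual by at most `σ`. The value `9/8 σ` leaves room below
`5/4 σ` for the noise accumulated in the later steps. -/
theorem Tame.jump (hs : Scales d m a A γ δ ε σ τ s) (hZ : Orthonormal ℝ Z)
    {B : Finset (Fin m)} {u e : Vec d} (hu : ‖u‖ = 1) (hR : resid Z B u ≤ σ / 8) (he : ‖e‖ = 1)
    (hue : inner ℝ u e = 0) :
    Tame Z σ τ B (Real.cos σ • u + Real.sin σ • e) ∧
      resid Z B (Real.cos σ • u + Real.sin σ • e) ≤ 9 / 8 * σ := by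
  have h1 : resid Z B (Real.cos σ • u + Real.sin σ • e) ≤ 9 / 8 * σ := by
    linarith [resid_jump_le hZ B hs.σ_pos.le (u := u) he]
  refine ⟨⟨norm_jump hu he hue, ?_, fun i hi => ?_⟩, h1⟩
  · linarith [resid_anti hZ (Finset.subset_univ B) (Real.cos σ • u + Real.sin σ • e), hs.σ_pos]
  · linarith [abs_inner_le_resid hZ hi (Real.cos σ • u + Real.sin σ • e), hs.σ_le, hs.τ_pos]

/-- The sign of a real number, with value `1` at `0`. -/
def signOne (t : ℝ) : ℝ := if 0 ≤ t then 1 else -1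

theorem signOne_mul (t : ℝ) : signOne t * t = |t| := by
  unfold signOne
  split_ifs with h
  · rw [one_mul, abs_of_nonneg h]
  · rw [abs_of_neg (not_le.1 h)]; ring

theorem abs_signOne (t : ℝ) : |signOne t| = 1 := by
  unfold signOne
  split_ifs <;> simp

/-- The test direction of the jump at `u` for the coordinates `i` and `j`. -/
def testDir (Z : Fin m → Vec d) (x : Fin m → ℝ) (u : Vec d) (i j : Fin m) : Vec d :=
  (√(x j) * signOne (inner ℝ u (Z i))) • Z i - (√(x i) * signOne (inner ℝ u (Z j))) • Z j

theorem norm_testDir_sq (hZ : Orthonormal ℝ Z) {x : Fin m → ℝ} (u : Vec d) {i j : Fin m}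
    (hij : i ≠ j) (hi : 0 ≤ x i) (hj : 0 ≤ x j) : ‖testDir Z x u i j‖ ^ 2 = x j + x i := by
  rw [testDir, norm_sub_sq_real, norm_smul, norm_smul, hZ.1 i, hZ.1 j, inner_smul_left,
    inner_smul_right, hZ.2 hij, Real.norm_eq_abs, Real.norm_eq_abs, abs_mul, abs_mul, abs_signOne,
    abs_signOne, abs_of_nonneg (Real.sqrt_nonneg _), abs_of_nonneg (Real.sqrt_nonneg _)]
  simp [Real.sq_sqrt, hi, hj]

theorem log_sq_sub_ge {P Q κ n : ℝ} (hQ : 0 < Q) (hκ : 0 < κ) (hκ1 : κ ≤ 1 / 40)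
    (hQn : Q ≤ n) (h : Q + κ * n ≤ P) :
    2 * (40 / 41 * κ) ≤ Real.log (P ^ 2) - Real.log (Q ^ 2) := by
  have h1 : Q * (1 + κ) ≤ P := by nlinarith
  have h2 := Real.log_le_log (by positivity) h1
  rw [Real.log_mul hQ.ne' (by positivity)] at h2
  have h3 := Real.one_sub_inv_le_log_of_pos (by positivity : 0 < 1 + κ)
  have h4 : (1 + κ)⁻¹ ≤ 1 - 40 / 41 * κ := by
    rw [inv_le_iff_one_le_mul₀ (by positivity)]
    nlinarith
  rw [Real.log_pow, Real.log_pow]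
  push_cast
  linarith

/-- A jump that moves far enough in the test direction separates the coordinates `i` and `j`,
unless one of them becomes small. -/
theorem separated_of_jump (hs : Scales d m a A γ δ ε σ τ s) (hZ : Orthonormal ℝ Z) (hd : 0 < d)
    {x : Fin m → ℝ} {B : Finset (Fin m)} (hx : ∀ i ∈ B, s ≤ x i ∧ x i ≤ 1) {u e : Vec d}
    (hu : ‖u‖ = 1) (he : ‖e‖ = 1) (hue : inner ℝ u e = 0) {i j : Fin m} (hi : i ∈ B) (hj : j ∈ B)
    (hij : i ≠ j)
    (hq : Real.sin σ / (4 * √d) * ‖testDir Z x u i j‖ ≤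
      |inner ℝ (Real.cos σ • u + Real.sin σ • e) (testDir Z x u i j)|) :
    (∃ k ∈ B, |inner ℝ (Real.cos σ • u + Real.sin σ • e) (Z k)| ≤ τ) ∨
      Separated Z x B (2 * (σ / (5 * √d))) (Real.cos σ • u + Real.sin σ • e) := by
  by_contra hcon
  push Not at hcon
  obtain ⟨hbig, hsep⟩ := hcon
  apply hsep
  have hσ := hs.σ_pos
  have hσ1 : σ ≤ 1 / 12 := by linarith [hs.σ_le, hs.τ_lt_one]
  set w := Real.cos σ • u + Real.sin σ • e with hw
  have hwn : ‖w‖ = 1 := norm_jump hu he hue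
  -- A coordinate whose sign was flipped by the jump would now be at most `σ < τ` in absolute value.
  -- Hence `w` keeps the signs of `u`, and the test direction compares `√(x j) |wᵢ|` with `√(x i)
  -- |wⱼ|`.
  have hsign : ∀ k ∈ B, signOne (inner ℝ u (Z k)) * inner ℝ w (Z k) = |inner ℝ w (Z k)| := by
    intro k hk
    have h1 : signOne (inner ℝ u (Z k)) * inner ℝ w (Z k) = Real.cos σ * |inner ℝ u (Z k)| +
        Real.sin σ * (signOne (inner ℝ u (Z k)) * inner ℝ e (Z k)) := by
      rw [hw, inner_add_left, real_inner_smul_left, real_inner_smul_left, ← signOne_mul]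
      ring
    have h2 : |signOne (inner ℝ u (Z k)) * inner ℝ w (Z k)| = |inner ℝ w (Z k)| := by
      rw [abs_mul, abs_signOne, one_mul]
    have hcos : 0 ≤ Real.cos σ :=
      Real.cos_nonneg_of_mem_Icc ⟨by linarith [Real.pi_gt_three], by linarith [Real.pi_gt_three]⟩
    have hsin0 : 0 ≤ Real.sin σ :=
      Real.sin_nonneg_of_nonneg_of_le_pi hσ.le (by linarith [Real.pi_gt_three])
    have hsin : Real.sin σ ≤ σ := Real.sin_le hσ.le
    have h3 : |signOne (inner ℝ u (Z k)) * inner ℝ e (Z k)| ≤ 1 := by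
      rw [abs_mul, abs_signOne, one_mul]
      exact abs_inner_le_one hZ he k
    have h4 : -σ ≤ signOne (inner ℝ u (Z k)) * inner ℝ w (Z k) := by
      rw [h1]
      have h5 := mul_nonneg hcos (abs_nonneg (inner ℝ u (Z k)))
      have h6 := mul_le_mul_of_nonneg_left (abs_le.1 h3).1 hsin0
      linarith
    rcases le_total 0 (signOne (inner ℝ u (Z k)) * inner ℝ w (Z k)) with h0 | h0
    · rw [← h2, abs_of_nonneg h0]
    · rw [abs_of_nonpos h0] at h2
      linarith [hbig k hk, hs.σ_le, hs.τ_pos]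
  have hxi : 0 < x i := hs.s_pos.trans_le (hx i hi).1
  have hxj : 0 < x j := hs.s_pos.trans_le (hx j hj).1
  have hwi : 0 < |inner ℝ w (Z i)| := hs.τ_pos.trans (hbig i hi)
  have hwj : 0 < |inner ℝ w (Z j)| := hs.τ_pos.trans (hbig j hj)
  have hinner : inner ℝ w (testDir Z x u i j) =
      √(x j) * |inner ℝ w (Z i)| - √(x i) * |inner ℝ w (Z j)| := by
    rw [testDir, inner_sub_right, real_inner_smul_right, real_inner_smul_right, ← hsign i hi,
      ← hsign j hj]
    ring
  have hn := norm_testDir_sq hZ u hij hxi.le hxj.le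
  set n := ‖testDir Z x u i j‖ with hndef
  have hn0 : 0 ≤ n := norm_nonneg _
  have hin : √(x i) ≤ n := by
    rw [← Real.sqrt_sq hn0, hn]; exact Real.sqrt_le_sqrt (by linarith)
  have hjn : √(x j) ≤ n := by
    rw [← Real.sqrt_sq hn0, hn]; exact Real.sqrt_le_sqrt (by linarith)
  have hsqi : 0 < √(x i) := Real.sqrt_pos.2 hxi
  have hsqj : 0 < √(x j) := Real.sqrt_pos.2 hxj
  have hd1 : 1 ≤ √(d : ℝ) := Real.one_le_sqrt.2 (by exact_mod_cast hd)
  have hsin := Real.sin_gt_sub_cube hσ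
  have hsin2 : 99 / 100 * σ ≤ Real.sin σ := by nlinarith [mul_pos hσ hσ]
  set κ := Real.sin σ / (4 * √d) with hκ
  have hκge : 99 / 400 * (σ / √d) ≤ κ := by
    rw [hκ, show 99 / 400 * (σ / √(d : ℝ)) = (99 / 100 * σ) / (4 * √d) by field_simp; ring]
    gcongr
  have hσd : 0 < σ / √(d : ℝ) := by positivity
  have hκ0 : 0 < κ := by linarith
  have hκ1 : κ ≤ 1 / 40 := by
    rw [hκ, div_le_iff₀ (by positivity)]
    nlinarith [Real.sin_le hσ.le]
  have e : 2 * (σ / (5 * √(d : ℝ))) = 2 / 5 * (σ / √d) := by field_simp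
  have hX : 2 * (σ / (5 * √(d : ℝ))) ≤ 2 * (40 / 41 * κ) := by rw [e]; linarith
  have hlog : ∀ {y t : ℝ}, 0 < y → 0 < |t| → Real.log ((√y * |t|) ^ 2) =
      Real.log y + Real.log (t ^ 2) := by
    intro y t hy ht
    rw [mul_pow, Real.sq_sqrt hy.le, sq_abs, Real.log_mul hy.ne']
    rw [← sq_abs]; positivity
  rw [hinner] at hq
  have hle' : ∀ k l, √(x k) * |inner ℝ w (Z l)| ≤ √(x k) := fun k l =>
    mul_le_of_le_one_right (Real.sqrt_nonneg _) (abs_inner_le_one hZ hwn l)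
  -- The sign of the pairing only decides which of `i` and `j` is ahead.
  rcases le_abs.1 hq with h | h
  · have h1 := log_sq_sub_ge (P := √(x j) * |inner ℝ w (Z i)|) (mul_pos hsqi hwj) hκ0 hκ1
      ((hle' i j).trans hin) (by linarith)
    rw [hlog hxj hwi, hlog hxi hwj] at h1
    refine ⟨i, hi, j, hj, ?_⟩
    unfold logPos
    linarith
  · have h1 := log_sq_sub_ge (P := √(x i) * |inner ℝ w (Z j)|) (mul_pos hsqj hwi) hκ0 hκ1
      ((hle' j i).trans hjn) (by linarith)
    rw [hlog hxj hwi, hlog hxi hwj] at h1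
    refine ⟨j, hj, i, hi, ?_⟩
    unfold logPos
    linarith

end Dynamics

end HiddenBasis
end

noncomputable section

namespace HiddenBasis

open Filter Topology

/-! ### Gaussian estimates -/

theorem gaussianReal_real_Ioo_le :
    (gaussianReal 0 1).real (Ioo (-(1 / 2)) (1 / 2)) ≤ 2 / 5 := by
  have hpdf : ∀ x, gaussianPDF 0 1 x ≤ ENNReal.ofReal (2 / 5) := by
    intro x
    rw [gaussianPDF, gaussianPDFReal]
    refine ENNReal.ofReal_le_ofReal ?_
    have h1 : Real.exp (-(x - 0) ^ 2 / (2 * ((1 : NNReal) : ℝ))) ≤ 1 := by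
      rw [Real.exp_le_one_iff]
      have := sq_nonneg (x - 0)
      simp only [NNReal.coe_one]
      linarith
    have h2 : (5 / 2 : ℝ) ≤ √(2 * Real.pi * ((1 : NNReal) : ℝ)) := by
      refine Real.le_sqrt_of_sq_le ?_
      simp only [NNReal.coe_one]
      linarith [Real.pi_gt_d2]
    have h3 : (√(2 * Real.pi * ((1 : NNReal) : ℝ)))⁻¹ ≤ 2 / 5 := by
      rw [show (2 / 5 : ℝ) = (5 / 2)⁻¹ by norm_num]
      exact inv_anti₀ (by norm_num) h2
    calc _ ≤ (2 / 5 : ℝ) * 1 := mul_le_mul h3 h1 (Real.exp_pos _).le (by norm_num)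
      _ = 2 / 5 := mul_one _
  have h : gaussianReal 0 1 (Ioo (-(1 / 2)) (1 / 2)) ≤ ENNReal.ofReal (2 / 5) := by
    rw [gaussianReal_apply 0 one_ne_zero]
    refine (lintegral_mono hpdf).trans ?_
    rw [setLIntegral_const, Real.volume_Ioo]
    norm_num
  rw [measureReal_def]
  exact ENNReal.toReal_le_of_le_ofReal (by norm_num) h

/-- At least `3/5` of the mass lies outside `(-1/2, 1/2)`, and symmetry halves it. -/
theorem gaussianReal_real_Ici_ge : 3 / 10 ≤ (gaussianReal 0 1).real (Ici (1 / 2)) := by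
  have hsymm : (gaussianReal 0 1).real (Iic (-(1 / 2))) = (gaussianReal 0 1).real (Ici (1 / 2)) := by
    have h := gaussianReal_map_neg (μ := 0) (v := 1)
    rw [neg_zero] at h
    rw [measureReal_def, measureReal_def]
    nth_rw 2 [← h]
    rw [Measure.map_apply measurable_neg measurableSet_Ici]
    congr 2
    ext x
    simp only [mem_Iic, mem_preimage, mem_Ici]
    constructor <;> intro hx <;> linarith
  have hcover : (univ : Set ℝ) ⊆ Iic (-(1 / 2)) ∪ Ioo (-(1 / 2)) (1 / 2) ∪ Ici (1 / 2) := by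
    intro x _
    rcases le_or_gt x (-(1 / 2)) with h | h
    · exact Or.inl (Or.inl h)
    · rcases lt_or_ge x (1 / 2) with h' | h'
      · exact Or.inl (Or.inr ⟨h, h'⟩)
      · exact Or.inr h'
  have h1 : (1 : ℝ) ≤ (gaussianReal 0 1).real (Iic (-(1 / 2)) ∪ Ioo (-(1 / 2)) (1 / 2) ∪
      Ici (1 / 2)) :=
    (probReal_univ (μ := gaussianReal 0 1)).symm.le.trans (measureReal_mono hcover)
  have h2 := measureReal_union_le (μ := gaussianReal 0 1)
    (Iic (-(1 / 2)) ∪ Ioo (-(1 / 2)) (1 / 2)) (Ici (1 / 2))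
  have h3 := measureReal_union_le (μ := gaussianReal 0 1) (Iic (-(1 / 2))) (Ioo (-(1 / 2)) (1 / 2))
  linarith [gaussianReal_real_Ioo_le]

theorem integral_dual_sq_stdGaussian {d : ℕ} (L : StrongDual ℝ (Vec d)) :
    ∫ z, L z ^ 2 ∂(stdGaussian (Vec d)) = ‖L‖ ^ 2 := by
  rw [← variance_dual_stdGaussian,
    variance_of_integral_eq_zero (by fun_prop) (integral_strongDual_stdGaussian L)]

/-- Markov's inequality for the second moment, which is at most `d`. -/
theorem stdGaussian_norm_gt_le {d : ℕ} (hd : 0 < d) :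
    (stdGaussian (Vec d)).real {z | 4 * (d : ℝ) ≤ ‖z‖ ^ 2} ≤ 1 / 4 := by
  have hint : ∀ i : Fin d, Integrable (fun z : Vec d => z i ^ 2) (stdGaussian (Vec d)) := fun i =>
    (IsGaussian.memLp_dual (stdGaussian (Vec d)) (EuclideanSpace.proj i) 2
      (by norm_num)).integrable_sq
  have hsq : ∀ z : Vec d, ‖z‖ ^ 2 = ∑ i, z i ^ 2 := fun z => by
    rw [EuclideanSpace.norm_sq_eq]
    simp [sq_abs]
  have hI : Integrable (fun z : Vec d => ‖z‖ ^ 2) (stdGaussian (Vec d)) := by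
    simp only [hsq]
    exact integrable_finsetSum _ fun i _ => hint i
  have hval : ∫ z, ‖z‖ ^ 2 ∂(stdGaussian (Vec d)) ≤ d := by
    simp only [hsq]
    rw [integral_finsetSum _ fun i _ => hint i]
    have h1 : ∀ i : Fin d, ∫ z : Vec d, z i ^ 2 ∂(stdGaussian (Vec d)) ≤ 1 := by
      intro i
      have h2 := integral_dual_sq_stdGaussian (d := d) (EuclideanSpace.proj i)
      have h3 : ‖(EuclideanSpace.proj i : StrongDual ℝ (Vec d))‖ ≤ 1 := by
        refine ContinuousLinearMap.opNorm_le_bound _ zero_le_one fun z => ?_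
        rw [one_mul]
        exact PiLp.norm_apply_le z i
      calc ∫ z : Vec d, z i ^ 2 ∂(stdGaussian (Vec d))
          = ‖(EuclideanSpace.proj i : StrongDual ℝ (Vec d))‖ ^ 2 := h2
        _ ≤ 1 := pow_le_one₀ (norm_nonneg _) h3
    calc _ ≤ ∑ _i : Fin d, (1 : ℝ) := Finset.sum_le_sum fun i _ => h1 i
      _ = d := by simp
  have h := mul_meas_ge_le_integral_of_nonneg (μ := stdGaussian (Vec d))
    (f := fun z => ‖z‖ ^ 2) (Eventually.of_forall fun z => sq_nonneg _) hI (4 * d)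
  have hd' : (0 : ℝ) < d := by exact_mod_cast hd
  have h2 := h.trans hval
  rw [mul_comm 4 (d : ℝ), mul_assoc] at h2
  have h3 := le_of_mul_le_mul_left (h2.trans_eq (mul_one _).symm) hd'
  rw [mul_comm (d : ℝ) 4] at h3
  linarith

/-- The half-space has mass at least `3/10` and large norms cost at most `1/4`, leaving `1/20`. On
this event the normalised vector has component at least `1/(4√d)` along `b`. -/
theorem stdGaussian_cap_ge {d : ℕ} (hd : 0 < d) {b : Vec d} (hb : ‖b‖ = 1) :
    ENNReal.ofReal (1 / 20) ≤
      stdGaussian (Vec d) {z | 1 / 2 ≤ inner ℝ b z ∧ ‖z‖ ≤ 2 * √d} := by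
  have hlaw : (stdGaussian (Vec d)).map (innerSL ℝ b) = gaussianReal 0 1 := by
    rw [IsGaussian.map_eq_gaussianReal, integral_strongDual_stdGaussian,
      variance_dual_stdGaussian, innerSL_apply_norm, hb]
    simp
  have h1 : 3 / 10 ≤ (stdGaussian (Vec d)).real {z | 1 / 2 ≤ inner ℝ b z} := by
    have h := gaussianReal_real_Ici_ge
    rw [← hlaw, measureReal_def, Measure.map_apply (by fun_prop) measurableSet_Ici] at h
    exact h
  have hsub : {z : Vec d | 1 / 2 ≤ inner ℝ b z} ⊆
      {z | 1 / 2 ≤ inner ℝ b z ∧ ‖z‖ ≤ 2 * √d} ∪ {z | 4 * (d : ℝ) ≤ ‖z‖ ^ 2} := by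
    intro z hz
    by_cases h : ‖z‖ ≤ 2 * √d
    · exact Or.inl ⟨hz, h⟩
    · right
      push Not at h
      have h2 := pow_le_pow_left₀ (by positivity) h.le 2
      rw [mul_pow, Real.sq_sqrt (by positivity)] at h2
      show 4 * (d : ℝ) ≤ ‖z‖ ^ 2
      linarith
  have h2 := (measureReal_mono (μ := stdGaussian (Vec d)) hsub).trans (measureReal_union_le _ _)
  have h3 := stdGaussian_norm_gt_le (d := d) hd
  rw [ENNReal.ofReal_le_iff_le_toReal (measure_ne_top _ _)]
  rw [← measureReal_def]
  linarith

/-! ### One round of the main loop -/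

/-- The law of the result of one round of the main loop started at `u`. -/
def roundLaw {d : ℕ} (Fh : Vec d → Vec d) (σ : ℝ) (N : ℕ) (u : Vec d) : Measure (Vec d) :=
  (jumpLaw σ u).map fun x => giLoop Fh (sphereExp u x) N

section Round

variable {d : ℕ} {Fh : Vec d → Vec d} {σ : ℝ} {N : ℕ}

theorem measurable_gHat (hF : Measurable Fh) : Measurable (gHat Fh) := by
  classical
  have h : Measurable fun u => if Fh u = 0 then u else ‖Fh u‖⁻¹ • Fh u :=
    Measurable.ite (hF (measurableSet_singleton 0)) measurable_id (by fun_prop)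
  convert h using 2 with u
  by_cases hu : Fh u = 0 <;> simp [gHat, hu]

theorem measurable_giLoop (hF : Measurable Fh) (N : ℕ) : Measurable fun u => giLoop Fh u N :=
  (measurable_gHat hF).iterate N

theorem starProjection_orthogonal_eq (u z : Vec d) :
    (ℝ ∙ u)ᗮ.starProjection z = z - (inner ℝ u z / ‖u‖ ^ 2) • u := by
  rw [Submodule.starProjection_orthogonal_val, Submodule.starProjection_singleton]
  rfl

theorem measurable_toOrthSphere_prod :
    Measurable fun q : Vec d × Vec d => toOrthSphere σ q.1 q.2 := by
  unfold toOrthSphere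
  simp only [starProjection_orthogonal_eq]
  fun_prop

theorem measurable_round_prod (hF : Measurable Fh) :
    Measurable fun q : Vec d × Vec d =>
      giLoop Fh (sphereExp q.1 (toOrthSphere σ q.1 q.2)) N := by
  have h := measurable_toOrthSphere_prod (d := d) (σ := σ)
  refine (measurable_giLoop hF N).comp ?_
  unfold sphereExp
  fun_prop

theorem measurable_round (hF : Measurable Fh) (u : Vec d) :
    Measurable fun x : Vec d => giLoop Fh (sphereExp u x) N := by
  refine (measurable_giLoop hF N).comp ?_
  unfold sphereExp
  fun_prop

theorem roundLaw_apply (hF : Measurable Fh) (u : Vec d) {S : Set (Vec d)} (hS : MeasurableSet S) :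
    roundLaw Fh σ N u S =
      stdGaussian (Vec d) {z | giLoop Fh (sphereExp u (toOrthSphere σ u z)) N ∈ S} := by
  rw [roundLaw, Measure.map_apply (measurable_round hF u) hS, jumpLaw,
    Measure.map_apply (measurable_toOrthSphere σ u) (measurable_round hF u hS)]
  rfl

/-- All starting points share one Gaussian sample, so the mass of a set is that of a section of a
jointly measurable set. -/
theorem measurable_roundLaw (hF : Measurable Fh) : Measurable (roundLaw Fh σ N) := by
  refine Measure.measurable_of_measurable_coe _ fun S hS => ?_
  simp only [roundLaw_apply hF _ hS]
  exact measurable_measure_prodMk_left (ν := stdGaussian (Vec d)) (measurable_round_prod hF hS)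

theorem isProbabilityMeasure_roundLaw (hF : Measurable Fh) (u : Vec d) :
    IsProbabilityMeasure (roundLaw Fh σ N u) := by
  have : IsProbabilityMeasure (jumpLaw σ u) :=
    Measure.isProbabilityMeasure_map (measurable_toOrthSphere σ u).aemeasurable
  exact Measure.isProbabilityMeasure_map (measurable_round hF u).aemeasurable

theorem sphereExp_eq {u x : Vec d} (hσ : 0 < σ) (hx : ‖x‖ = σ) (hux : inner ℝ u x = 0) :
    ‖σ⁻¹ • x‖ = 1 ∧ inner ℝ u (σ⁻¹ • x) = 0 ∧
      sphereExp u x = Real.cos σ • u + Real.sin σ • (σ⁻¹ • x) := by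
  refine ⟨?_, ?_, ?_⟩
  · rw [norm_smul, hx, norm_inv, Real.norm_of_nonneg hσ.le, inv_mul_cancel₀ hσ.ne']
  · rw [inner_smul_right, hux, mul_zero]
  · rw [sphereExp, hx]

theorem roundLaw_eq_zero (hF : Measurable Fh) (hd : 2 ≤ d) (hσ : 0 < σ) {u : Vec d} (hu : ‖u‖ = 1)
    {S : Set (Vec d)} (hS : MeasurableSet S)
    (h : ∀ e : Vec d, ‖e‖ = 1 → inner ℝ u e = 0 →
      giLoop Fh (Real.cos σ • u + Real.sin σ • e) N ∈ S) :
    roundLaw Fh σ N u Sᶜ = 0 := by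
  rw [roundLaw, Measure.map_apply (measurable_round hF u) hS.compl]
  refine measure_mono_null ?_ (ae_iff.1 (jumpLaw_isUniform hd hσ hu).2.1)
  intro x hx hcon
  obtain ⟨h1, h2, h3⟩ := sphereExp_eq hσ hcon.1 hcon.2
  apply hx
  show giLoop Fh (sphereExp u x) N ∈ S
  rw [h3]
  exact h _ h1 h2

/-- Projecting the Gaussian vector to `u^⊥` keeps its component along `b ⊥ u` and does not increase
its norm, so the cap event passes to the jump direction. -/
theorem roundLaw_ge (hF : Measurable Fh) (hd : 0 < d) (hσ : 0 < σ) {u b : Vec d} (hu : ‖u‖ = 1)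
    (hb : ‖b‖ = 1) (hub : inner ℝ u b = 0) {S : Set (Vec d)} (hS : MeasurableSet S)
    (h : ∀ e : Vec d, ‖e‖ = 1 → inner ℝ u e = 0 → 1 / (4 * √d) ≤ inner ℝ b e →
      giLoop Fh (Real.cos σ • u + Real.sin σ • e) N ∈ S) :
    ENNReal.ofReal (1 / 20) ≤ roundLaw Fh σ N u S := by
  rw [roundLaw_apply hF u hS]
  refine (stdGaussian_cap_ge hd hb).trans (measure_mono ?_)
  rintro z ⟨hz1, hz2⟩
  set y := (ℝ ∙ u)ᗮ.starProjection z with hy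
  have hye := starProjection_orthogonal_eq u z
  rw [← hy, hu, one_pow, div_one] at hye
  have huy : inner ℝ u y = 0 := by
    rw [hye, inner_sub_right, inner_smul_right, real_inner_self_eq_norm_sq, hu]
    ring
  have hby : inner ℝ b y = inner ℝ b z := by
    rw [hye, inner_sub_right, inner_smul_right, real_inner_comm u b, hub, mul_zero, sub_zero]
  have hyn : ‖y‖ ≤ 2 * √d := ((ℝ ∙ u)ᗮ.norm_starProjection_apply_le z).trans hz2
  have hy0 : 0 < ‖y‖ := by
    rw [norm_pos_iff]
    intro h0
    rw [h0, inner_zero_right] at hby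
    linarith
  set x := toOrthSphere σ u z with hx
  have hxe : x = σ • (‖y‖⁻¹ • y) := rfl
  have hxn : ‖x‖ = σ := by
    rw [hxe, norm_smul, norm_smul, norm_inv, norm_norm, inv_mul_cancel₀ hy0.ne', mul_one,
      Real.norm_of_nonneg hσ.le]
  have hux : inner ℝ u x = 0 := by
    rw [hxe, inner_smul_right, inner_smul_right, huy, mul_zero, mul_zero]
  obtain ⟨h1, h2, h3⟩ := sphereExp_eq hσ hxn hux
  show giLoop Fh (sphereExp u x) N ∈ S
  rw [h3]
  refine h _ h1 h2 ?_
  rw [hxe, smul_smul, inv_mul_cancel₀ hσ.ne', one_smul, inner_smul_right, hby]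
  have hd' : 0 < √(d : ℝ) := Real.sqrt_pos.2 (by exact_mod_cast hd)
  calc 1 / (4 * √(d : ℝ)) = (2 * √d)⁻¹ * (1 / 2) := by field_simp; norm_num
    _ ≤ ‖y‖⁻¹ * inner ℝ b z := by gcongr

theorem exists_unit_orthogonal (hd : 2 ≤ d) (u : Vec d) : ∃ b : Vec d, ‖b‖ = 1 ∧ inner ℝ u b = 0 := by
  have hne : (ℝ ∙ u)ᗮ ≠ ⊥ := by
    intro h0
    rw [Submodule.orthogonal_eq_bot_iff] at h0
    have := finrank_span_le_card (R := ℝ) ({u} : Set (Vec d))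
    rw [h0, finrank_top, finrank_euclideanSpace_fin, Set.toFinset_singleton,
      Finset.card_singleton] at this
    omega
  obtain ⟨e, he, he0⟩ := Submodule.exists_mem_ne_zero_of_ne_bot hne
  refine ⟨‖e‖⁻¹ • e, norm_smul_inv_norm (𝕜 := ℝ) he0, ?_⟩
  exact Submodule.mem_orthogonal_singleton_iff_inner_right.1 (Submodule.smul_mem _ _ he)

/-- For each `q` there is a direction orthogonal to `u` along which a jump moves `u` far enough
in the direction of `q`. -/
theorem exists_jump_direction (hd : 2 ≤ d) (hσ : 0 < σ) (hσ1 : σ ≤ 1 / 12) {u : Vec d}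
    (hu : ‖u‖ = 1) (q : Vec d) :
    ∃ b : Vec d, ‖b‖ = 1 ∧ inner ℝ u b = 0 ∧ ∀ e : Vec d, ‖e‖ = 1 → inner ℝ u e = 0 →
      1 / (4 * √d) ≤ inner ℝ b e →
      Real.sin σ / (4 * √d) * ‖q‖ ≤ |inner ℝ (Real.cos σ • u + Real.sin σ • e) q| := by
  set r := q - inner ℝ u q • u with hr
  have hur : inner ℝ u r = 0 := by
    rw [hr, inner_sub_right, inner_smul_right, real_inner_self_eq_norm_sq, hu]; ring
  have hq : q = inner ℝ u q • u + r := by rw [hr]; abel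
  -- The sign of `⟨u, q⟩` is built into `b`, so that the contributions of `u` and of the jump to the
  -- pairing with `q` add up. If `q` is parallel to `u`, any `b` will do.
  obtain ⟨b, hb, hub, hbr⟩ : ∃ b : Vec d, ‖b‖ = 1 ∧ inner ℝ u b = 0 ∧
      r = (signOne (inner ℝ u q) * ‖r‖) • b := by
    by_cases h0 : r = 0
    · obtain ⟨b, hb, hub⟩ := exists_unit_orthogonal hd u
      exact ⟨b, hb, hub, by simp [h0]⟩
    · have hς : signOne (inner ℝ u q) * signOne (inner ℝ u q) = 1 := by
        rw [← abs_mul_abs_self, abs_signOne, one_mul]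
      refine ⟨(signOne (inner ℝ u q) * ‖r‖⁻¹) • r, ?_, ?_, ?_⟩
      · rw [norm_smul, norm_mul, Real.norm_eq_abs, abs_signOne, one_mul, norm_inv, norm_norm,
          inv_mul_cancel₀ (norm_ne_zero_iff.2 h0)]
      · rw [inner_smul_right, hur, mul_zero]
      · rw [smul_smul]
        have : signOne (inner ℝ u q) * ‖r‖ * (signOne (inner ℝ u q) * ‖r‖⁻¹) = 1 := by
          rw [mul_mul_mul_comm, hς, one_mul, mul_inv_cancel₀ (norm_ne_zero_iff.2 h0)]
        rw [this, one_smul]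
  refine ⟨b, hb, hub, fun e he hue hbe => ?_⟩
  have hd' : 1 ≤ √(d : ℝ) := Real.one_le_sqrt.2 (by exact_mod_cast (by omega : 1 ≤ d))
  have h1 : inner ℝ (Real.cos σ • u + Real.sin σ • e) q =
      Real.cos σ * inner ℝ u q + Real.sin σ * (signOne (inner ℝ u q) * ‖r‖ * inner ℝ b e) := by
    have h2 : inner ℝ e q = signOne (inner ℝ u q) * ‖r‖ * inner ℝ b e := by
      conv_lhs => rw [hq, inner_add_right, inner_smul_right, real_inner_comm u e, hue, mul_zero,
        zero_add, hbr, inner_smul_right, real_inner_comm b e]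
    rw [inner_add_left, real_inner_smul_left, real_inner_smul_left, h2]
  have hςa : signOne (inner ℝ u q) * inner ℝ (Real.cos σ • u + Real.sin σ • e) q =
      Real.cos σ * |inner ℝ u q| + Real.sin σ * (‖r‖ * inner ℝ b e) := by
    have hς : signOne (inner ℝ u q) * signOne (inner ℝ u q) = 1 := by
      rw [← abs_mul_abs_self, abs_signOne, one_mul]
    rw [h1, ← signOne_mul]
    linear_combination (Real.sin σ * ‖r‖ * inner ℝ b e) * hς
  have hle : signOne (inner ℝ u q) * inner ℝ (Real.cos σ • u + Real.sin σ • e) q ≤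
      |inner ℝ (Real.cos σ • u + Real.sin σ • e) q| := by
    refine (le_abs_self _).trans ?_
    rw [abs_mul, abs_signOne, one_mul]
  refine le_trans ?_ hle
  rw [hςa]
  have hsin0 : 0 ≤ Real.sin σ :=
    Real.sin_nonneg_of_nonneg_of_le_pi hσ.le (by linarith [Real.pi_gt_three])
  have hcos : 1 / 2 ≤ Real.cos σ := by
    have := Real.one_sub_sq_div_two_le_cos (x := σ)
    nlinarith
  have hnq : ‖q‖ ≤ |inner ℝ u q| + ‖r‖ := by
    conv_lhs => rw [hq]
    refine (norm_add_le _ _).trans ?_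
    rw [norm_smul, hu, mul_one, Real.norm_eq_abs]
  have hκ : Real.sin σ / (4 * √d) ≤ Real.cos σ := by
    rw [div_le_iff₀ (by positivity)]
    nlinarith [Real.sin_le_one σ]
  have hκ0 : 0 ≤ Real.sin σ / (4 * √(d : ℝ)) := by positivity
  have h3 : Real.sin σ * (‖r‖ * (1 / (4 * √d))) ≤ Real.sin σ * (‖r‖ * inner ℝ b e) := by
    gcongr
  have h4 : Real.sin σ * (‖r‖ * (1 / (4 * √d))) = Real.sin σ / (4 * √d) * ‖r‖ := by ring
  calc Real.sin σ / (4 * √d) * ‖q‖ ≤ Real.sin σ / (4 * √d) * (|inner ℝ u q| + ‖r‖) := by gcongr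
    _ = Real.sin σ / (4 * √d) * |inner ℝ u q| + Real.sin σ / (4 * √d) * ‖r‖ := by ring
    _ ≤ Real.cos σ * |inner ℝ u q| + Real.sin σ / (4 * √d) * ‖r‖ := by gcongr
    _ ≤ _ := by linarith

end Round

/-! ### A Markov chain descending through nested sets -/

section Chain

variable {E : Type*} [MeasurableSpace E] {κ : E → Measure E} {law : ℕ → Measure E} {u₀ : E}
  {A : ℕ → Set E} {m : ℕ}

/-- The number of the sets `A 1, …, A m` that do not contain `u`. -/
def missCount (A : ℕ → Set E) (m : ℕ) (u : E) : ℝ≥0∞ :=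
  ∑ b ∈ Finset.Icc 1 m, (A b)ᶜ.indicator 1 u

theorem measurable_missCount (hA : ∀ b, MeasurableSet (A b)) : Measurable (missCount A m) :=
  Finset.measurable_fun_sum _ fun b _ => measurable_one.indicator (hA b).compl

theorem lintegral_missCount (hA : ∀ b, MeasurableSet (A b)) (μ : Measure E) :
    ∫⁻ u, missCount A m u ∂μ = ∑ b ∈ Finset.Icc 1 m, μ (A b)ᶜ := by
  unfold missCount
  rw [lintegral_finsetSum _ fun b _ => measurable_one.indicator (hA b).compl]
  exact Finset.sum_congr rfl fun b _ => lintegral_indicator_one (hA b).compl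

/-- If `b` is the least index with `u ∈ A b`, the count is `b - 1`. A step never raises it and, for
`b ≥ 2`, lowers it with probability at least `p`, so its mean is at most `b - 1 - p ≤ (1 - p/m)(b -
1)`. -/
theorem lintegral_missCount_le (hA : ∀ b, MeasurableSet (A b)) (hmono : Monotone A)
    {p : ℝ} (hp0 : 0 ≤ p) (hp1 : p ≤ 1) {u : E} (hu : u ∈ A m) (hu0 : u ∉ A 0)
    {μ : Measure E} [IsProbabilityMeasure μ] (hstay : ∀ b, u ∈ A b → μ (A b)ᶜ = 0)
    (hdrop : ∀ b, u ∈ A (b + 2) → ENNReal.ofReal p ≤ μ (A (b + 1))) :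
    ∫⁻ v, missCount A m v ∂μ ≤ ENNReal.ofReal (1 - p / m) * missCount A m u := by
  classical
  rw [lintegral_missCount hA]
  have hex : ∃ b, u ∈ A b := ⟨m, hu⟩
  set b := Nat.find hex with hb
  have hbA : u ∈ A b := Nat.find_spec hex
  have hbmin : ∀ c, c < b → u ∉ A c := fun c hc => Nat.find_min hex hc
  have hbm : b ≤ m := Nat.find_min' hex hu
  have hstay' : ∀ c, b ≤ c → μ (A c)ᶜ = 0 := fun c hc => hstay c (hmono hc hbA)
  have hcount : missCount A m u = ((b - 1 : ℕ) : ℝ≥0∞) := by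
    unfold missCount
    have h1 : ∀ c ∈ Finset.Icc 1 m, (A c)ᶜ.indicator (1 : E → ℝ≥0∞) u =
        if c ∈ Finset.Icc 1 (b - 1) then 1 else 0 := by
      intro c hc
      have hc1 := (Finset.mem_Icc.1 hc).1
      by_cases h : c < b
      · rw [indicator_of_mem (show u ∈ (A c)ᶜ from hbmin c h), if_pos (by
          rw [Finset.mem_Icc]; omega)]
        rfl
      · rw [indicator_of_notMem (show u ∉ (A c)ᶜ from not_not.2 (hmono (not_lt.1 h) hbA)),
          if_neg (by rw [Finset.mem_Icc]; omega)]
    rw [Finset.sum_congr rfl h1, Finset.sum_ite_mem, Finset.inter_eq_right.2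
      (Finset.Icc_subset_Icc_right (by omega))]
    simp
  rw [hcount]
  rcases Nat.lt_or_ge b 2 with hb2 | hb2
  · have hb1 : b = 1 := by
      have : b ≠ 0 := fun h0 => hu0 (h0 ▸ hbA)
      omega
    rw [Finset.sum_eq_zero fun c hc => hstay' c (by rw [hb1]; exact (Finset.mem_Icc.1 hc).1)]
    exact zero_le
  · obtain ⟨n, hn⟩ : ∃ n, b = n + 2 := ⟨b - 2, by omega⟩
    have hterm : ∀ c ∈ Finset.Icc 1 m, μ (A c)ᶜ ≤
        (if c ∈ Finset.Icc 1 n then (1 : ℝ≥0∞) else 0) +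
          if c = n + 1 then ENNReal.ofReal (1 - p) else 0 := by
      intro c hc
      have hc1 := (Finset.mem_Icc.1 hc).1
      rcases lt_trichotomy c (n + 1) with h | h | h
      · rw [if_pos (Finset.mem_Icc.2 ⟨hc1, by omega⟩)]
        exact prob_le_one.trans le_self_add
      · subst h
        rw [if_pos rfl, prob_compl_eq_one_sub (hA _), ENNReal.ofReal_sub _ hp0, ENNReal.ofReal_one]
        exact (tsub_le_tsub_left (hdrop n (hn ▸ hbA)) 1).trans le_add_self
      · rw [hstay' c (by omega)]
        exact zero_le
    refine (Finset.sum_le_sum hterm).trans ?_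
    rw [Finset.sum_add_distrib, Finset.sum_ite_mem, Finset.inter_eq_right.2
      (Finset.Icc_subset_Icc_right (by omega)), Finset.sum_ite_eq' , if_pos
      (Finset.mem_Icc.2 ⟨by omega, by omega⟩)]
    have hm : (0 : ℝ) < m := by exact_mod_cast (by omega : 0 < m)
    have e1 : ∑ _c ∈ Finset.Icc 1 n, (1 : ℝ≥0∞) = ENNReal.ofReal n := by simp
    have e2 : ((b - 1 : ℕ) : ℝ≥0∞) = ENNReal.ofReal (n + 1) := by
      rw [hn, show n + 2 - 1 = n + 1 by omega, ← ENNReal.ofReal_natCast]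
      push_cast
      rfl
    have hpm : p / m ≤ 1 := by
      rw [div_le_one hm]
      exact hp1.trans (by exact_mod_cast (by omega : 1 ≤ m))
    rw [e1, e2, ← ENNReal.ofReal_add (by positivity) (by linarith),
      ← ENNReal.ofReal_mul (by linarith)]
    refine ENNReal.ofReal_le_ofReal ?_
    have h5 : p / m * (n + 1) ≤ p := by
      rw [div_mul_eq_mul_div, div_le_iff₀ hm]
      have : (n : ℝ) + 1 ≤ m := by exact_mod_cast (by omega : n + 1 ≤ m)
      exact mul_le_mul_of_nonneg_left this hp0
    linarith

theorem law_isProbabilityMeasure (hκ : Measurable κ) (hprob : ∀ u, IsProbabilityMeasure (κ u))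
    (h0 : law 0 = Measure.dirac u₀) (hsucc : ∀ n, law (n + 1) = (law n).bind κ) (n : ℕ) :
    IsProbabilityMeasure (law n) := by
  induction n with
  | zero => rw [h0]; infer_instance
  | succ n ih =>
    refine ⟨?_⟩
    rw [hsucc, Measure.bind_apply MeasurableSet.univ hκ.aemeasurable]
    simp

/-- If every step stays in the current set of the chain, moves to the next smaller one with
probability at least `p`, and moves from `A 1` to `T`, then `T` is reached with high probability. -/
theorem law_ge (hκ : Measurable κ) (hprob : ∀ u, IsProbabilityMeasure (κ u))
    (h0 : law 0 = Measure.dirac u₀) (hsucc : ∀ n, law (n + 1) = (law n).bind κ)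
    (hA : ∀ b, MeasurableSet (A b)) (hmono : Monotone A) (hempty : A 0 = ∅) (hm : 0 < m)
    {p : ℝ} (hp0 : 0 ≤ p) (hp1 : p ≤ 1) (hu₀ : u₀ ∈ A m)
    (hstay : ∀ b, ∀ u ∈ A b, κ u (A b)ᶜ = 0)
    (hdrop : ∀ b, ∀ u ∈ A (b + 2), ENNReal.ofReal p ≤ κ u (A (b + 1)))
    {T : Set E} (hT : MeasurableSet T) (hAT : ∀ u ∈ A 1, κ u Tᶜ = 0) (n : ℕ) :
    ENNReal.ofReal (1 - m * (1 - p / m) ^ n) ≤ law (n + 1) T := by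
  have hlaw := law_isProbabilityMeasure hκ hprob h0 hsucc
  have hm' : (1 : ℝ) ≤ m := by exact_mod_cast hm
  have hin : ∀ n, law n (A m)ᶜ = 0 := by
    intro n
    induction n with
    | zero => rw [h0, Measure.dirac_apply' _ (hA m).compl]; simp [hu₀]
    | succ n ih =>
      have hme : Measurable fun u => κ u (A m)ᶜ :=
        (Measure.measurable_coe (hA m).compl).comp hκ
      rw [hsucc, Measure.bind_apply (hA m).compl hκ.aemeasurable, lintegral_eq_zero_iff hme]
      have : ∀ᵐ u ∂(law n), u ∈ A m := ih
      filter_upwards [this] with u hu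
      exact hstay m u hu
  have hpm : 0 ≤ 1 - p / m := by
    have : p / m ≤ 1 := (div_le_one (by linarith)).2 (by linarith)
    linarith
  have hmiss : ∀ n, ∫⁻ u, missCount A m u ∂(law n) ≤ ENNReal.ofReal (m * (1 - p / m) ^ n) := by
    intro n
    induction n with
    | zero =>
      rw [lintegral_missCount hA, pow_zero, mul_one, ENNReal.ofReal_natCast]
      have := hlaw 0
      calc ∑ b ∈ Finset.Icc 1 m, law 0 (A b)ᶜ ≤ ∑ _b ∈ Finset.Icc 1 m, (1 : ℝ≥0∞) :=
            Finset.sum_le_sum fun b _ => prob_le_one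
        _ = m := by simp
    | succ n ih =>
      rw [hsucc, Measure.lintegral_bind hκ.aemeasurable (measurable_missCount hA).aemeasurable]
      have hae : ∀ᵐ u ∂(law n), u ∈ A m := hin n
      have hle : ∫⁻ u, ∫⁻ v, missCount A m v ∂(κ u) ∂(law n) ≤
          ∫⁻ u, ENNReal.ofReal (1 - p / m) * missCount A m u ∂(law n) := by
        refine lintegral_mono_ae ?_
        filter_upwards [hae] with u hu
        have := hprob u
        exact lintegral_missCount_le hA hmono hp0 hp1 hu (by rw [hempty]; exact notMem_empty u)
          (fun b hb => hstay b u hb) (fun b hb => hdrop b u hb)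
      refine hle.trans ?_
      rw [lintegral_const_mul _ (measurable_missCount hA)]
      refine (mul_le_mul_right ih _).trans ?_
      rw [← ENNReal.ofReal_mul hpm]
      refine ENNReal.ofReal_le_ofReal (le_of_eq ?_)
      rw [pow_succ]; ring
  -- The indicator of the complement of `A 1` is one summand of the count.
  have hA1 : law n (A 1)ᶜ ≤ ENNReal.ofReal (m * (1 - p / m) ^ n) := by
    refine le_trans ?_ (hmiss n)
    rw [lintegral_missCount hA]
    exact Finset.single_le_sum (f := fun b => law n (A b)ᶜ) (fun _ _ => zero_le)
      (Finset.mem_Icc.2 ⟨le_rfl, hm⟩)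
  have hge : ENNReal.ofReal (1 - m * (1 - p / m) ^ n) ≤ law n (A 1) := by
    have := hlaw n
    have h1 : law n (A 1) = 1 - law n (A 1)ᶜ := by
      rw [← prob_compl_eq_one_sub (hA 1).compl, compl_compl]
    rw [h1, ENNReal.ofReal_sub _ (by positivity), ENNReal.ofReal_one]
    exact tsub_le_tsub_left hA1 1
  -- The last of the `n + 1` steps is reserved for the move from `A 1` into `T`.
  refine hge.trans ?_
  rw [hsucc, Measure.bind_apply hT hκ.aemeasurable, ← lintegral_indicator_one (hA 1)]
  refine lintegral_mono fun u => ?_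
  by_cases hu : u ∈ A 1
  · have := hprob u
    have h1 : κ u T = 1 := (prob_compl_eq_zero_iff hT).1 (hAT u hu)
    rw [h1, indicator_of_mem hu]
    rfl
  · rw [indicator_of_notMem hu]
    exact zero_le

end Chain

end HiddenBasis
end

noncomputable section

namespace HiddenBasis

open Filter Topology

section Search

variable {d m : ℕ} {Z : Fin m → Vec d} {ψ : Fin m → ℝ → ℝ} {Fh : Vec d → Vec d}
  {a A γ δ ε σ τ s : ℝ}

/-! ### The descent of the main loop -/

/-- Unit vectors near the span of at most `b` of the `Z i` with `i ∈ I`. -/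
def settled (Z : Fin m → Vec d) (I : Finset (Fin m)) (σ : ℝ) (b : ℕ) : Set (Vec d) :=
  {u | ‖u‖ = 1 ∧ ∃ B : Finset (Fin m), B ⊆ I ∧ B.card ≤ b ∧ resid Z B u ≤ σ / 8}

/-- Unit vectors within distance `r` of the line through one of the `Z i` with `i ∈ I`. -/
def nearBasis (Z : Fin m → Vec d) (I : Finset (Fin m)) (r : ℝ) : Set (Vec d) :=
  {u | ‖u‖ = 1 ∧ ∃ i ∈ I, resid Z {i} u ≤ r}

theorem measurableSet_resid_le (B : Finset (Fin m)) (r : ℝ) :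
    MeasurableSet {u : Vec d | resid Z B u ≤ r} :=
  (isClosed_le (continuous_resid B) continuous_const).measurableSet

theorem measurableSet_norm_eq_one : MeasurableSet {u : Vec d | ‖u‖ = 1} :=
  (isClosed_eq continuous_norm continuous_const).measurableSet

theorem measurableSet_settled (I : Finset (Fin m)) (b : ℕ) :
    MeasurableSet (settled Z I σ b) := by
  have e : settled Z I σ b = {u | ‖u‖ = 1} ∩ ⋃ B : Finset (Fin m), ⋃ _ : B ⊆ I ∧ B.card ≤ b,
      {u | resid Z B u ≤ σ / 8} := by
    ext u
    simp [settled, and_assoc]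
  rw [e]
  exact measurableSet_norm_eq_one.inter
    (MeasurableSet.iUnion fun B => MeasurableSet.iUnion fun _ => measurableSet_resid_le B _)

theorem measurableSet_nearBasis (I : Finset (Fin m)) (r : ℝ) :
    MeasurableSet (nearBasis Z I r) := by
  have e : nearBasis Z I r = {u | ‖u‖ = 1} ∩ ⋃ i : Fin m, ⋃ _ : i ∈ I,
      {u | resid Z {i} u ≤ r} := by
    ext u
    simp [nearBasis]
  rw [e]
  exact measurableSet_norm_eq_one.inter
    (MeasurableSet.iUnion fun i => MeasurableSet.iUnion fun _ => measurableSet_resid_le _ _)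

theorem settled_mono (I : Finset (Fin m)) : Monotone (settled Z I σ) := by
  rintro b c hbc u ⟨hu, B, hB, hcard, hR⟩
  exact ⟨hu, B, hB, hcard.trans hbc, hR⟩

theorem resid_empty (u : Vec d) : resid Z ∅ u = ‖u‖ := by simp [resid]

theorem settled_zero (hs : Scales d m a A γ δ ε σ τ s) (I : Finset (Fin m)) :
    settled Z I σ 0 = ∅ := by
  ext u
  simp only [mem_empty_iff_false, iff_false]
  rintro ⟨hu, B, -, hcard, hR⟩
  rw [Finset.card_eq_zero.1 (Nat.le_zero.1 hcard), resid_empty, hu] at hR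
  linarith [hs.σ_le, hs.τ_lt_one]

/-- One contraction step already undoes the jump: `(9/8)/15 + 1/900 ≤ 1/8`. -/
theorem resid_giLoop_jump_le (hs : Scales d m a A γ δ ε σ τ s) (hZ : Orthonormal ℝ Z)
    (hψ : ∀ i, IsProfile (ψ i) a A γ δ) (hF : IsNoisyField Z ψ Fh ε) {B : Finset (Fin m)}
    {u e : Vec d} (hu : ‖u‖ = 1) (hR : resid Z B u ≤ σ / 8) (he : ‖e‖ = 1)
    (hue : inner ℝ u e = 0) {N : ℕ} (hN : 1 ≤ N) :
    ‖giLoop Fh (Real.cos σ • u + Real.sin σ • e) N‖ = 1 ∧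
      resid Z B (giLoop Fh (Real.cos σ • u + Real.sin σ • e) N) ≤ σ / 8 := by
  obtain ⟨h1, h2⟩ := Tame.jump hs hZ hu hR he hue
  obtain ⟨h3, h4⟩ := h1.iterate hs hZ hψ hF N
  refine ⟨h3.norm_eq, h4.trans ?_⟩
  have h5 : ((1 : ℝ) / 15) ^ N ≤ (1 / 15) ^ 1 :=
    pow_le_pow_of_le_one (by norm_num) (by norm_num) hN
  rw [pow_one] at h5
  have h6 := mul_le_mul h2 h5 (by positivity) (by linarith [hs.σ_pos])
  linarith [hs.σ_pos]

theorem roundLaw_settled (hs : Scales d m a A γ δ ε σ τ s) (hZ : Orthonormal ℝ Z)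
    (hψ : ∀ i, IsProfile (ψ i) a A γ δ) (hF : IsNoisyField Z ψ Fh ε) (hFm : Measurable Fh)
    (hd : 2 ≤ d) {I : Finset (Fin m)} {N : ℕ} (hN : 1 ≤ N) {b : ℕ} {u : Vec d}
    (hu : u ∈ settled Z I σ b) : roundLaw Fh σ N u (settled Z I σ b)ᶜ = 0 := by
  obtain ⟨hu1, B, hB, hcard, hR⟩ := hu
  refine roundLaw_eq_zero hFm hd hs.σ_pos hu1 (measurableSet_settled I b) fun e he hue => ?_
  obtain ⟨h1, h2⟩ := resid_giLoop_jump_le hs hZ hψ hF hu1 hR he hue hN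
  exact ⟨h1, B, hB, hcard, h2⟩

/-- With at least two active directions, any two of them serve as the pair to be separated by the
jump. Such a pair exists only for `m ≥ 2`, so the counts in `hJ` are needed only then. -/
theorem roundLaw_drop (hs : Scales d m a A γ δ ε σ τ s) (hZ : Orthonormal ℝ Z)
    (hψ : ∀ i, IsProfile (ψ i) a A γ δ) (hF : IsNoisyField Z ψ Fh ε) (hFm : Measurable Fh)
    (hd : 2 ≤ d) {I : Finset (Fin m)} {N : ℕ} (hN : 1 ≤ N)
    (hJ : 2 ≤ m → ∃ J L : ℕ, ((1 : ℝ) / 15) ^ L ≤ σ / 10 ∧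
      -Real.log s - Real.log (τ ^ 2) <
        2 * (δ * (a / A) * s ^ (δ - γ) * (s * σ / (40 * √d))) * J ∧ J + L ≤ N)
    {b : ℕ} {u : Vec d} (hu : u ∈ settled Z I σ (b + 2)) :
    ENNReal.ofReal (1 / 20) ≤ roundLaw Fh σ N u (settled Z I σ (b + 1)) := by
  have hprob := isProbabilityMeasure_roundLaw (σ := σ) (N := N) hFm u
  obtain ⟨hu1, B, hB, hcard, hR⟩ := hu
  by_cases hlt : B.card ≤ b + 1
  · have h1 := roundLaw_settled hs hZ hψ hF hFm hd hN (I := I) (b := b + 1) (u := u)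
      ⟨hu1, B, hB, hlt, hR⟩
    rw [(prob_compl_eq_zero_iff (measurableSet_settled I (b + 1))).1 h1]
    exact ENNReal.ofReal_le_one.2 (by norm_num)
  · have hd0 : 0 < d := by omega
    obtain ⟨i, hi, j, hj, hij⟩ := Finset.one_lt_card.1 (by omega : 1 < B.card)
    have hm2 : 2 ≤ m := by
      have := B.card_le_univ
      rw [Fintype.card_fin] at this
      omega
    obtain ⟨J, L, hL, hJ', hJL⟩ := hJ hm2
    obtain ⟨x, l, hx, hsum⟩ := hs.exists_balanced hψ ⟨i, hi⟩
    obtain ⟨c, hc, huc, hdir⟩ := exists_jump_direction hd hs.σ_pos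
      (by linarith [hs.σ_le, hs.τ_lt_one]) hu1 (testDir Z x u i j)
    refine roundLaw_ge hFm hd0 hs.σ_pos hu1 hc huc (measurableSet_settled I (b + 1))
      fun e he hue hce => ?_
    have hsep := separated_of_jump hs hZ hd0 (fun k hk => ⟨(hx k hk).1, (hx k hk).2.1⟩) hu1 he hue
      hi hj hij (hdir e he hue hce)
    obtain ⟨ht, hRt⟩ := Tame.jump hs hZ hu1 hR he hue
    obtain ⟨k, hk, hRk⟩ := exists_erase_resid_le hs hZ hψ hF hd0 hx hsum ht hRt hsep hL hJ' hJL
    refine ⟨(ht.iterate hs hZ hψ hF N).1.norm_eq, B.erase k, (Finset.erase_subset k B).trans hB,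
      ?_, hRk⟩
    rw [Finset.card_erase_of_mem hk]
    omega

theorem roundLaw_nearBasis (hs : Scales d m a A γ δ ε σ τ s) (hZ : Orthonormal ℝ Z)
    (hψ : ∀ i, IsProfile (ψ i) a A γ δ) (hF : IsNoisyField Z ψ Fh ε) (hFm : Measurable Fh)
    (hd : 2 ≤ d) {I : Finset (Fin m)} {N : ℕ}
    (hN : (1 / 2 : ℝ) ^ ((1 + 2 * γ) ^ (N : ℝ)) ≤ 8 * (A / a) * ((4 * ε / a) ^ 2) ^ γ)
    {u : Vec d} (hu : u ∈ settled Z I σ 1) :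
    roundLaw Fh σ N u (nearBasis Z I (4 * ε / a))ᶜ = 0 := by
  obtain ⟨hu1, B, hB, hcard, hR⟩ := hu
  have hBne : B ≠ ∅ := by
    rintro rfl
    rw [resid_empty, hu1] at hR
    linarith [hs.σ_le, hs.τ_lt_one]
  obtain ⟨i, rfl⟩ := Finset.card_eq_one.1 (le_antisymm hcard
    (Finset.card_pos.2 (Finset.nonempty_iff_ne_empty.2 hBne)))
  refine roundLaw_eq_zero hFm hd hs.σ_pos hu1 (measurableSet_nearBasis I _) fun e he hue => ?_
  obtain ⟨ht, hRt⟩ := Tame.jump hs hZ hu1 hR he hue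
  exact ⟨(ht.iterate hs hZ hψ hF N).1.norm_eq, i, hB (Finset.mem_singleton_self i),
    resid_singleton_iterate_le hs hZ hψ hF ht hRt hN⟩

theorem mainLoopLaw_ge (hs : Scales d m a A γ δ ε σ τ s) (hZ : Orthonormal ℝ Z)
    (hψ : ∀ i, IsProfile (ψ i) a A γ δ) (hF : IsNoisyField Z ψ Fh ε) (hFm : Measurable Fh)
    (hd : 2 ≤ d) (hm : 0 < m) {I : Finset (Fin m)} {N : ℕ} (hN : 1 ≤ N)
    (hN' : (1 / 2 : ℝ) ^ ((1 + 2 * γ) ^ (N : ℝ)) ≤ 8 * (A / a) * ((4 * ε / a) ^ 2) ^ γ)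
    (hJ : 2 ≤ m → ∃ J L : ℕ, ((1 : ℝ) / 15) ^ L ≤ σ / 10 ∧
      -Real.log s - Real.log (τ ^ 2) <
        2 * (δ * (a / A) * s ^ (δ - γ) * (s * σ / (40 * √d))) * J ∧ J + L ≤ N)
    {u₀ : Vec d} (hu₀ : ‖u₀‖ = 1) (hR₀ : resid Z I u₀ ≤ σ / 8) (n : ℕ) :
    ENNReal.ofReal (1 - m * (1 - 1 / 20 / m) ^ n) ≤
      mainLoopLaw Fh σ N u₀ (n + 1) (nearBasis Z I (4 * ε / a)) := by
  refine law_ge (κ := roundLaw Fh σ N) (law := mainLoopLaw Fh σ N u₀) (u₀ := u₀)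
    (A := settled Z I σ) (measurable_roundLaw hFm) (isProbabilityMeasure_roundLaw hFm) rfl
    (fun _ => rfl) (measurableSet_settled I) (settled_mono I) (settled_zero hs I) hm
    (by norm_num) (by norm_num) ⟨hu₀, I, subset_rfl, ?_, hR₀⟩
    (fun b u hu => roundLaw_settled hs hZ hψ hF hFm hd hN hu)
    (fun b u hu => roundLaw_drop hs hZ hψ hF hFm hd hN hJ hu)
    (measurableSet_nearBasis I _)
    (fun u hu => roundLaw_nearBasis hs hZ hψ hF hFm hd hN' hu) n
  have := I.card_le_univ
  rwa [Fintype.card_fin] at this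

/-! ### The starting point -/

theorem resid_giLoop_le (hs : Scales d m a A γ δ ε σ τ s) (hZ : Orthonormal ℝ Z)
    (hψ : ∀ i, IsProfile (ψ i) a A γ δ) (hF : IsNoisyField Z ψ Fh ε) {B : Finset (Fin m)}
    {u : Vec d} (hu : ‖u‖ = 1) (hR : resid Z B u ≤ σ / 8) (n : ℕ) :
    ‖giLoop Fh u n‖ = 1 ∧ resid Z B (giLoop Fh u n) ≤ σ / 8 := by
  induction n with
  | zero => exact ⟨hu, hR⟩
  | succ n ih =>
    obtain ⟨h1, h2⟩ := ih
    have ht : Tame Z σ τ B (giLoop Fh u n) := by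
      refine ⟨h1, ?_, fun i hi => ?_⟩
      · linarith [resid_anti hZ (Finset.subset_univ B) (giLoop Fh u n), hs.σ_pos]
      · linarith [abs_inner_le_resid hZ hi (giLoop Fh u n), hs.σ_le, hs.τ_pos]
    have h3 := ht.step hs hZ hψ hF
    have e : giLoop Fh u (n + 1) = gHat Fh (giLoop Fh u n) := Function.iterate_succ_apply' _ _ _
    rw [e]
    exact ⟨h3.1.norm_eq, by linarith [h3.2, hs.σ_pos]⟩

theorem exists_orthonormalBasis_extend {n k : ℕ} (hd : n + k = d) {x : Fin n → Vec d}
    (hx : Orthonormal ℝ x) :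
    ∃ b : OrthonormalBasis (Fin n ⊕ Fin k) ℝ (Vec d), ∀ l, b (Sum.inl l) = x l := by
  have h : Orthonormal ℝ ((range (Sum.inl : Fin n → Fin n ⊕ Fin k)).domRestrict
      (Sum.elim x fun _ => 0)) := by
    refine ⟨?_, ?_⟩
    · rintro ⟨_, l, rfl⟩
      exact hx.1 l
    · rintro ⟨_, l, rfl⟩ ⟨_, l', rfl⟩ hne
      exact hx.2 fun e => hne (by rw [e])
  obtain ⟨b, hb⟩ := Orthonormal.exists_orthonormalBasis_extension_of_card_eq (𝕜 := ℝ)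
    (by rw [finrank_euclideanSpace_fin, Fintype.card_sum, Fintype.card_fin, Fintype.card_fin, hd]) h
  exact ⟨b, fun l => hb _ ⟨l, rfl⟩⟩

/-- An orthonormal family of `d - k` vectors almost orthogonal to `k` of the `Z i` has a member
with a large component along any other `Z j`. -/
theorem exists_inner_sq_ge (hZ : Orthonormal ℝ Z) {K : Finset (Fin m)} {j : Fin m} (hj : j ∉ K)
    {k : ℕ} (hkK : K.card = k) (hK : k < d) {x : Fin (d - k) → Vec d} (hx : Orthonormal ℝ x)
    {r : ℝ} (hr : ∀ l, ∀ i ∈ K, |inner ℝ (x l) (Z i)| ≤ r) :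
    ∃ l, (1 - k * (d * r ^ 2)) / d ≤ inner ℝ (x l) (Z j) ^ 2 := by
  have hd : (0 : ℝ) < d := by exact_mod_cast (by omega : 0 < d)
  -- The `k` additional basis vectors absorb at most `k` units of the mass of the `Z i`, `i ∈ insert
  -- j K`. The directions in `K`, almost orthogonal to all `x l`, use up nearly all of it, so most
  -- of `Z j` is seen by the `x l`.
  obtain ⟨b, hbx⟩ := exists_orthonormalBasis_extend (k := k) (by omega) hx
  have hpars : ∀ i, ∑ l, inner ℝ (x l) (Z i) ^ 2 +
      ∑ t, inner ℝ (b (Sum.inr t)) (Z i) ^ 2 = 1 := by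
    intro i
    have h1 := b.sum_sq_norm_inner_right (Z i)
    rw [Fintype.sum_sum_type, hZ.1 i] at h1
    simp only [hbx, Real.norm_eq_abs, sq_abs, one_pow] at h1
    exact h1
  have hbessel : ∑ i ∈ insert j K, ∑ t, inner ℝ (b (Sum.inr t)) (Z i) ^ 2 ≤ k := by
    rw [Finset.sum_comm]
    calc ∑ t : Fin k, ∑ i ∈ insert j K, inner ℝ (b (Sum.inr t)) (Z i) ^ 2
        ≤ ∑ _t : Fin k, (1 : ℝ) := by
          refine Finset.sum_le_sum fun t _ => ?_
          have h1 := hZ.sum_inner_products_le (b (Sum.inr t)) (s := insert j K)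
          rw [b.norm_eq_one, one_pow] at h1
          refine le_trans (le_of_eq (Finset.sum_congr rfl fun i _ => ?_)) h1
          rw [Real.norm_eq_abs, sq_abs, real_inner_comm]
      _ = k := by simp
  rw [Finset.sum_insert hj] at hbessel
  have hfound : ∀ i ∈ K, 1 - d * r ^ 2 ≤ ∑ t, inner ℝ (b (Sum.inr t)) (Z i) ^ 2 := by
    intro i hi
    have h1 : ∑ l, inner ℝ (x l) (Z i) ^ 2 ≤ d * r ^ 2 := by
      calc ∑ l, inner ℝ (x l) (Z i) ^ 2 ≤ ∑ _l : Fin (d - k), r ^ 2 :=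
            Finset.sum_le_sum fun l _ => by
              rw [← sq_abs]; exact pow_le_pow_left₀ (abs_nonneg _) (hr l i hi) 2
        _ = ((d - k : ℕ) : ℝ) * r ^ 2 := by simp
        _ ≤ d * r ^ 2 := by
          have : ((d - k : ℕ) : ℝ) ≤ d := by exact_mod_cast Nat.sub_le d k
          gcongr
    linarith [hpars i]
  have hsumK := Finset.sum_le_sum hfound
  rw [Finset.sum_const, nsmul_eq_mul] at hsumK
  have hj1 : 1 - k * (d * r ^ 2) ≤ ∑ l, inner ℝ (x l) (Z j) ^ 2 := by
    have := hpars j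
    rw [hkK] at hsumK
    linarith
  by_contra hcon
  push Not at hcon
  have hpos : 0 < d - k := by omega
  have hne : (Finset.univ : Finset (Fin (d - k))).Nonempty := ⟨⟨0, hpos⟩, Finset.mem_univ _⟩
  have h2 := Finset.sum_lt_sum_of_nonempty hne fun l _ => hcon l
  rw [Finset.sum_const, nsmul_eq_mul, Finset.card_univ, Fintype.card_fin] at h2
  have hnn : 0 < (1 - k * (d * r ^ 2)) / d :=
    lt_of_le_of_lt (sq_nonneg _) (hcon ⟨0, hpos⟩)
  have h3 : ((d - k : ℕ) : ℝ) * ((1 - k * (d * r ^ 2)) / d) ≤ d * ((1 - k * (d * r ^ 2)) / d) := by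
    have : ((d - k : ℕ) : ℝ) ≤ d := by exact_mod_cast Nat.sub_le d k
    gcongr
  rw [mul_div_cancel₀ _ hd.ne'] at h3
  linarith

/-- The first gradient step from the best of the vectors `x l` lands near the span of the
directions that were not found before. -/
theorem resid_start_le (hs : Scales d m a A γ δ ε σ τ s) (hZ : Orthonormal ℝ Z)
    (hψ : ∀ i, IsProfile (ψ i) a A γ δ) (hF : IsNoisyField Z ψ Fh ε)
    (hstart : 50 * √m * ε ≤ a * ((d : ℝ) ^ (1 / 2 + δ))⁻¹ * σ)
    {K : Finset (Fin m)} {j : Fin m} (hj : j ∉ K)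
    {k : ℕ} (hkK : K.card = k) (hK : k < d) {x : Fin (d - k) → Vec d} (hx : Orthonormal ℝ x)
    (hr : ∀ l, ∀ i ∈ K, |inner ℝ (x l) (Z i)| ≤ 4 * √2 * (ε / a))
    {l₀ : Fin (d - k)} (hl₀ : ∀ l, ‖Fh (x l)‖ ≤ ‖Fh (x l₀)‖) :
    ‖gHat Fh (x l₀)‖ = 1 ∧ resid Z Kᶜ (gHat Fh (x l₀)) ≤ σ / 8 := by
  have ha := hs.a_pos
  have hε := hs.ε_pos
  have hσ := hs.σ_pos
  have hd : (1 : ℝ) ≤ d := by exact_mod_cast (by omega : 1 ≤ d)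
  have hm : (1 : ℝ) ≤ m := hs.one_le_of_fin j
  have hσ1 : σ ≤ 1 / 12 := by linarith [hs.σ_le, hs.τ_lt_one]
  set D := ((d : ℝ) ^ (1 / 2 + δ))⁻¹ with hD
  have hD0 : 0 < D := inv_pos.2 (Real.rpow_pos_of_pos (by linarith) _)
  have hdD : d * D ^ 2 ≤ 1 := by
    have h1 : (d : ℝ) ≤ ((d : ℝ) ^ (1 / 2 + δ)) ^ 2 := by
      rw [← Real.rpow_natCast, ← Real.rpow_mul (by linarith)]
      nth_rw 1 [← Real.rpow_one (d : ℝ)]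
      refine Real.rpow_le_rpow_of_exponent_le hd ?_
      push_cast
      linarith [hs.δ_pos]
    rw [hD, inv_pow, ← div_eq_mul_inv, div_le_one (by positivity)]
    exact h1
  set r := 4 * √2 * (ε / a) with hrdef
  have hr0 : 0 ≤ r := by positivity
  have hsqm : 1 ≤ √(m : ℝ) := Real.one_le_sqrt.2 hm
  have hεD : 50 * (√m * (ε / a)) ≤ D * σ := by
    have h1 : 50 * (√m * (ε / a)) = 50 * √m * ε / a := by ring
    rw [h1, div_le_iff₀ ha]
    linarith
  have hmr : √m * r ≤ D * σ / 8 := by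
    have h1 : √2 ≤ 3 / 2 := by rw [Real.sqrt_le_left (by norm_num)]; norm_num
    have h2 : 0 ≤ √m * (ε / a) := by positivity
    have h3 : √m * r = 4 * √2 * (√m * (ε / a)) := by rw [hrdef]; ring
    rw [h3]
    nlinarith
  have hcardm : (k : ℝ) ≤ m := by
    have := K.card_le_univ
    rw [Fintype.card_fin, hkK] at this
    exact_mod_cast this
  have hmr2 : k * r ^ 2 ≤ D ^ 2 * σ ^ 2 / 64 := by
    have h1 := pow_le_pow_left₀ (by positivity) hmr 2
    rw [mul_pow, Real.sq_sqrt (by linarith)] at h1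
    have h2 : k * r ^ 2 ≤ m * r ^ 2 := by gcongr
    linarith
  obtain ⟨l, hl⟩ := exists_inner_sq_ge hZ hj hkK hK hx hr
  have hθ : (1 + 2 * δ) * (k * (d * r ^ 2)) ≤ 1 / 50 := by
    have h1 : k * (d * r ^ 2) ≤ σ ^ 2 / 64 := by
      calc k * (d * r ^ 2) = d * (k * r ^ 2) := by ring
        _ ≤ d * (D ^ 2 * σ ^ 2 / 64) := by gcongr
        _ = (d * D ^ 2) * (σ ^ 2 / 64) := by ring
        _ ≤ 1 * (σ ^ 2 / 64) := by gcongr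
        _ = σ ^ 2 / 64 := one_mul _
    have := mul_le_mul_of_nonneg_left h1 (by linarith [hs.δ_pos] : 0 ≤ 1 + 2 * δ)
    linarith [hs.σ_sq_le]
  set θ := k * (d * r ^ 2) with hθdef
  have hθ0 : 0 ≤ θ := by positivity
  have hθ1 : θ ≤ 1 := by nlinarith [mul_nonneg hs.δ_pos.le hθ0]
  obtain ⟨c', hc', hFc'⟩ := hF (x l) (hx.1 l)
  have hL' : 2 * a * D * (49 / 50) ≤ ‖∑ i, c' i • Z i‖ := by
    have h1 := norm_field_ge hZ hψ ha hs.δ_pos (Finset.singleton_nonempty j) (hx.1 l) hc'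
    rw [← sum_inner_sq_eq hZ {j} (hx.1 l), Finset.sum_singleton, Finset.card_singleton,
      Nat.cast_one, Real.one_rpow, mul_one] at h1
    refine le_trans ?_ h1
    have h2 : D * (1 - θ) ^ (1 / 2 + δ) ≤ (inner ℝ (x l) (Z j) ^ 2) ^ (1 / 2 + δ) := by
      calc D * (1 - θ) ^ (1 / 2 + δ) = ((1 - θ) / d) ^ (1 / 2 + δ) := by
            rw [Real.div_rpow (by linarith) (by linarith), hD]; ring
        _ ≤ _ := by
            refine Real.rpow_le_rpow (div_nonneg (by linarith) (by linarith)) hl ?_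
            linarith [hs.δ_pos]
    have h3 := one_sub_le_rpow hθ0 hθ1 hs.δ_pos
    have h4 : D * (49 / 50) ≤ D * (1 - θ) ^ (1 / 2 + δ) :=
      mul_le_mul_of_nonneg_left (by linarith) hD0.le
    have h5 := mul_le_mul_of_nonneg_left (h4.trans h2) (by positivity : 0 ≤ 2 * a)
    linarith
  obtain ⟨c, hc, hFc⟩ := hF (x l₀) (hx.1 l₀)
  have hεs : ε ≤ a * D * σ / 50 := by
    have h1 : ε / a ≤ √m * (ε / a) := le_mul_of_one_le_left (by positivity) hsqm
    have h2 : ε / a ≤ D * σ / 50 := by linarith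
    rw [div_le_iff₀ ha] at h2
    linarith
  have haD : 0 < a * D := by positivity
  have hεs' : ε ≤ a * D / 600 := by nlinarith
  -- Maximality of `l₀` transfers the lower bound from `l`, at the price of two noise terms.
  have hL : a * D * (19 / 10) ≤ ‖∑ i, c i • Z i‖ := by
    have h1 := norm_sub_norm_le (∑ i, c' i • Z i) (Fh (x l))
    rw [norm_sub_rev] at h1
    have h2 := norm_sub_norm_le (Fh (x l₀)) (∑ i, c i • Z i)
    have h3 := hl₀ l
    linarith
  have hεL : ε < a * D * (19 / 10) := by linarith
  refine ⟨(gHat_of_approx hFc hL hεL).2.2, (resid_gHat_le hZ _ hFc hL hεL).trans ?_⟩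
  have hrτ : r ≤ τ := by
    have h1 : r ≤ √m * r := le_mul_of_one_le_left hr0 hsqm
    have h2 : D ≤ 1 := by
      have : 1 ≤ (d : ℝ) ^ (1 / 2 + δ) := Real.one_le_rpow hd (by linarith [hs.δ_pos])
      exact inv_le_one_of_one_le₀ this
    have h3 : D * σ ≤ σ := mul_le_of_le_one_left hσ.le h2
    linarith [hs.σ_le, hs.τ_pos]
  have hci : ∀ i ∈ K, |c i| ≤ a / 8 * r := by
    intro i hi
    have h1 := abs_field_le hZ hψ hs.γ_pos hs.A_pos (hx.1 l₀) hc ((hr l₀ i hi).trans hrτ)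
    rw [hs.τ_pow] at h1
    have hm1 : (m : ℝ) ^ (-δ) ≤ 1 :=
      Real.rpow_le_one_of_one_le_of_nonpos hm (by linarith [hs.δ_pos])
    calc |c i| ≤ 2 * (a * (m : ℝ) ^ (-δ) / 16) * |inner ℝ (x l₀) (Z i)| := h1
      _ ≤ 2 * (a * 1 / 16) * r := by gcongr; exact hr l₀ i hi
      _ = a / 8 * r := by ring
  -- The exact field lies in the span of the `Z i`, so its residual consists of the coordinates in
  -- `K`.
  have hG : resid Z Kᶜ (∑ i, c i • Z i) ≤ a * (D * σ) / 64 := by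
    refine (sq_le_sq₀ (resid_nonneg _ _) (by positivity)).1 ?_
    rw [resid_sq hZ, norm_sum_smul_sq hZ]
    simp only [inner_sum_smul hZ]
    rw [← Finset.sum_add_sum_compl K, add_sub_cancel_right]
    calc ∑ i ∈ K, c i ^ 2 ≤ ∑ _i ∈ K, (a / 8 * r) ^ 2 := Finset.sum_le_sum fun i hi => by
          rw [← sq_abs]; exact pow_le_pow_left₀ (abs_nonneg _) (hci i hi) 2
      _ = a ^ 2 / 64 * (k * r ^ 2) := by rw [Finset.sum_const, nsmul_eq_mul, hkK]; ring
      _ ≤ a ^ 2 / 64 * (D ^ 2 * σ ^ 2 / 64) := by gcongr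
      _ = (a * (D * σ) / 64) ^ 2 := by ring
  rw [div_le_iff₀ (by linarith)]
  nlinarith

end Search

end HiddenBasis
end

noncomputable section

namespace HiddenBasis

open Filter Topology

/-! ### The scales of the theorem -/

section Parameters

variable {α β γ δ ε σ : ℝ} {d m : ℕ}

/-- The lower bound for the squared coordinates of balanced points. -/
def sFloor (α β γ δ : ℝ) (m : ℕ) : ℝ := (β * γ / (α * δ * (m : ℝ) ^ δ)) ^ (1 / γ)

/-- The elementary conditions on the parameters. -/
structure Admissible (α β γ δ : ℝ) (d m : ℕ) : Prop where
  α_pos : 0 < α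
  β_pos : 0 < β
  γ_pos : 0 < γ
  δ_pos : 0 < δ
  γ_le : γ ≤ δ
  ratio_le : β * γ ≤ α * δ
  two_le : 2 ≤ d
  one_le : 1 ≤ m

namespace Admissible

theorem m_cast (h : Admissible α β γ δ d m) : (1 : ℝ) ≤ m := by exact_mod_cast h.one_le

theorem d_cast (h : Admissible α β γ δ d m) : (2 : ℝ) ≤ d := by exact_mod_cast h.two_le

theorem base_pos (h : Admissible α β γ δ d m) : 0 < β * γ / (α * δ * (m : ℝ) ^ δ) := by
  have := h.α_pos; have := h.β_pos; have := h.γ_pos; have := h.δ_pos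
  have := Real.rpow_pos_of_pos (zero_lt_one.trans_le h.m_cast) δ
  positivity

theorem sFloor_pos (h : Admissible α β γ δ d m) : 0 < sFloor α β γ δ m :=
  Real.rpow_pos_of_pos h.base_pos _

theorem sFloor_rpow (h : Admissible α β γ δ d m) :
    sFloor α β γ δ m ^ γ = β * γ / (α * δ * (m : ℝ) ^ δ) := by
  rw [sFloor, ← Real.rpow_mul h.base_pos.le, one_div, inv_mul_cancel₀ h.γ_pos.ne', Real.rpow_one]

theorem tau_base (h : Admissible α β γ δ d m) : β * γ / (16 * α * δ) * (m : ℝ) ^ (-δ) =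
    β * γ / (α * δ * (m : ℝ) ^ δ) / 16 := by
  have := h.α_pos; have := h.δ_pos
  have := Real.rpow_pos_of_pos (zero_lt_one.trans_le h.m_cast) δ
  rw [Real.rpow_neg (zero_le_one.trans h.m_cast)]
  field_simp

theorem tau_pos (h : Admissible α β γ δ d m) : 0 < tau α β γ δ m := by
  rw [tau, h.tau_base]
  exact Real.rpow_pos_of_pos (div_pos h.base_pos (by norm_num)) _

theorem tau_sq (h : Admissible α β γ δ d m) :
    tau α β γ δ m ^ 2 = sFloor α β γ δ m * (16 : ℝ)⁻¹ ^ (1 / γ) := by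
  have hb := h.base_pos
  rw [tau, h.tau_base, ← Real.rpow_natCast, ← Real.rpow_mul (by positivity), sFloor,
    ← Real.mul_rpow hb.le (by norm_num), div_eq_mul_inv]
  congr 1
  have := h.γ_pos
  push_cast
  field_simp

theorem tau_sq_rpow (h : Admissible α β γ δ d m) :
    (tau α β γ δ m ^ 2) ^ γ = β * γ / (α * δ * (m : ℝ) ^ δ) / 16 := by
  rw [h.tau_sq, Real.mul_rpow h.sFloor_pos.le (by positivity), h.sFloor_rpow,
    ← Real.rpow_mul (by norm_num), one_div, inv_mul_cancel₀ h.γ_pos.ne', Real.rpow_one]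
  ring

theorem sFloor_le_inv (h : Admissible α β γ δ d m) : sFloor α β γ δ m ≤ (m : ℝ)⁻¹ := by
  have hm := h.m_cast
  have hm0 : (0 : ℝ) < m := by linarith
  have hpow := Real.rpow_pos_of_pos hm0 δ
  have h1 : β * γ / (α * δ * (m : ℝ) ^ δ) ≤ (m : ℝ)⁻¹ ^ γ := by
    have hαδ : 0 < α * δ := mul_pos h.α_pos h.δ_pos
    rw [Real.inv_rpow hm0.le]
    calc β * γ / (α * δ * (m : ℝ) ^ δ) ≤ α * δ / (α * δ * (m : ℝ) ^ δ) := by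
          have := h.ratio_le; gcongr
      _ = ((m : ℝ) ^ δ)⁻¹ := by rw [div_mul_eq_div_div, div_self hαδ.ne', one_div]
      _ ≤ ((m : ℝ) ^ γ)⁻¹ :=
          inv_anti₀ (Real.rpow_pos_of_pos hm0 γ) (Real.rpow_le_rpow_of_exponent_le hm h.γ_le)
  have h2 := Real.rpow_le_rpow h.base_pos.le h1 (one_div_pos.2 h.γ_pos).le
  rwa [← Real.rpow_mul (by positivity), mul_one_div_cancel h.γ_pos.ne', Real.rpow_one] at h2

theorem sFloor_le_one (h : Admissible α β γ δ d m) : sFloor α β γ δ m ≤ 1 :=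
  h.sFloor_le_inv.trans (inv_le_one_of_one_le₀ h.m_cast)

/-- Since `ln 16 ≥ 2`, `16^(1/γ) ≥ 1 + 2/γ`. Hence `τ² ≤ δ/2`, so that the factor `τ²` in `etaZero`
makes up for the factor `δ` in the growth rate `δ (a/A) s^(δ-γ)`. -/
theorem inv_sixteen_rpow_le (h : Admissible α β γ δ d m) :
    (16 : ℝ)⁻¹ ^ (1 / γ) ≤ δ / (δ + 2) := by
  have hγ := h.γ_pos
  have hlog : 2 ≤ Real.log 16 := by
    rw [show (16 : ℝ) = 2 ^ 4 by norm_num, Real.log_pow]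
    have := Real.log_two_gt_d9
    push_cast
    linarith
  have h1 : 1 + 2 / γ ≤ (16 : ℝ) ^ (1 / γ) := by
    rw [Real.rpow_def_of_pos (by norm_num)]
    have h2 := Real.add_one_le_exp (Real.log 16 * (1 / γ))
    have h3 : 2 / γ ≤ Real.log 16 * (1 / γ) := by
      rw [mul_one_div]; gcongr
    linarith
  rw [Real.inv_rpow (by norm_num)]
  refine (inv_anti₀ (by positivity) h1).trans ?_
  have h4 : (1 + 2 / γ)⁻¹ = γ / (γ + 2) := by field_simp
  rw [h4, div_le_div_iff₀ (by linarith) (by linarith [h.δ_pos])]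
  nlinarith [h.γ_le]

theorem tau_sq_le (h : Admissible α β γ δ d m) :
    tau α β γ δ m ^ 2 ≤ sFloor α β γ δ m * (δ / (δ + 2)) := by
  rw [h.tau_sq]
  exact mul_le_mul_of_nonneg_left h.inv_sixteen_rpow_le h.sFloor_pos.le

theorem tau_sq_le_delta (h : Admissible α β γ δ d m) : tau α β γ δ m ^ 2 ≤ δ / 2 := by
  have hδ := h.δ_pos
  have h1 : δ / (δ + 2) ≤ δ / 2 := by gcongr; linarith
  have h2 : 0 ≤ δ / (δ + 2) := by positivity
  have := h.tau_sq_le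
  nlinarith [h.sFloor_le_one, h.sFloor_pos]

theorem tau_sq_lt_one (h : Admissible α β γ δ d m) : tau α β γ δ m ^ 2 < 1 := by
  have hδ := h.δ_pos
  have h1 : δ / (δ + 2) < 1 := by rw [div_lt_one (by linarith)]; linarith
  have h2 : 0 ≤ δ / (δ + 2) := by positivity
  have := h.tau_sq_le
  nlinarith [h.sFloor_le_one, h.sFloor_pos]

theorem tau_lt_one (h : Admissible α β γ δ d m) : tau α β γ δ m < 1 := by
  by_contra hlt
  push Not at hlt
  have := one_le_pow₀ (n := 2) hlt
  linarith [h.tau_sq_lt_one]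

theorem sigma_sq_le (h : Admissible α β γ δ d m) (hσ0 : 0 < σ)
    (hσ : σ ≤ 1 / (6 * √(2 * d * (1 + 2 * δ))) * tau α β γ δ m ^ 2) :
    72 * d * (1 + 2 * δ) * σ ^ 2 ≤ (tau α β γ δ m ^ 2) ^ 2 := by
  have hδ := h.δ_pos
  have hd := h.d_cast
  have hW : 0 < 2 * (d : ℝ) * (1 + 2 * δ) := by positivity
  rw [one_div_mul_eq_div, le_div_iff₀ (by have := Real.sqrt_pos.2 hW; positivity)] at hσ
  have h1 := pow_le_pow_left₀ (by positivity) hσ 2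
  rw [mul_pow, mul_pow, Real.sq_sqrt hW.le] at h1
  linarith

/-- The rate `(βγ/(αδ)) s^(δ-γ)`. -/
theorem rate_eq (h : Admissible α β γ δ d m) :
    β / δ / (α / γ) * sFloor α β γ δ m ^ (δ - γ) =
      (β * γ / (α * δ)) ^ (δ / γ) * (m : ℝ) ^ (-(δ / γ * (δ - γ))) := by
  have hα := h.α_pos; have hβ := h.β_pos; have hγ := h.γ_pos; have hδ := h.δ_pos
  have hm0 : (0 : ℝ) < m := zero_lt_one.trans_le h.m_cast
  have hκ : 0 < β * γ / (α * δ) := by positivity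
  have e1 : β * γ / (α * δ * (m : ℝ) ^ δ) = β * γ / (α * δ) * (m : ℝ) ^ (-δ) := by
    rw [Real.rpow_neg hm0.le, ← div_div, div_eq_mul_inv (β * γ / (α * δ))]
  have e2 : β / δ / (α / γ) = β * γ / (α * δ) := by field_simp
  rw [e2, sFloor, e1, ← Real.rpow_mul (by positivity), Real.mul_rpow hκ.le (by positivity),
    ← Real.rpow_mul hm0.le, ← mul_assoc]
  nth_rw 1 [← Real.rpow_one (β * γ / (α * δ))]
  rw [← Real.rpow_add hκ]
  congr 2
  · field_simp; ring
  · field_simp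

theorem rate_pos (h : Admissible α β γ δ d m) :
    0 < β / δ / (α / γ) * sFloor α β γ δ m ^ (δ - γ) := by
  have := h.α_pos; have := h.β_pos; have := h.γ_pos; have := h.δ_pos; have := h.sFloor_pos
  positivity

theorem rate_le_one (h : Admissible α β γ δ d m) :
    β / δ / (α / γ) * sFloor α β γ δ m ^ (δ - γ) ≤ 1 := by
  have hα := h.α_pos; have hβ := h.β_pos; have hγ := h.γ_pos; have hδ := h.δ_pos
  have h1 : β / δ / (α / γ) ≤ 1 := by
    rw [show β / δ / (α / γ) = β * γ / (α * δ) by field_simp, div_le_one (by positivity)]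
    exact h.ratio_le
  have h2 : sFloor α β γ δ m ^ (δ - γ) ≤ 1 :=
    Real.rpow_le_one h.sFloor_pos.le h.sFloor_le_one (sub_nonneg.2 h.γ_le)
  exact mul_le_one₀ h1 (Real.rpow_nonneg h.sFloor_pos.le _) h2

/-! ### Noise level and jump length in terms of the scales -/

theorem etaZero_eq : etaZero α β γ δ m d σ =
    σ / √d * sFloor α β γ δ m * tau α β γ δ m ^ 2 := rfl

/-- The discarded factors `(βγ/(αδ))^(1/(2γ))` and `m^(-δ/(2γ))` are at most `1`; the rest regroups
around the rate of `rate_eq`. -/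
theorem epsDiverge_le (h : Admissible α β γ δ d m) {η : ℝ} (hη : 0 ≤ η) :
    epsDiverge α β γ δ m η ≤ 9 / 256 * (β / δ) *
      (β / δ / (α / γ) * sFloor α β γ δ m ^ (δ - γ)) * (m : ℝ) ^ (-δ) *
      (tau α β γ δ m ^ 2 * (tau α β γ δ m ^ 2) ^ δ) * η := by
  have hα := h.α_pos; have hβ := h.β_pos; have hγ := h.γ_pos; have hδ := h.δ_pos
  have hm0 : (0 : ℝ) < m := zero_lt_one.trans_le h.m_cast
  have hκ : 0 < β * γ / (α * δ) := by positivity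
  have hκ1 : β * γ / (α * δ) ≤ 1 := by
    rw [div_le_one (by positivity)]; exact h.ratio_le
  have hτ := h.tau_pos
  have e1 : (β * γ / (α * δ)) ^ ((2 * δ + 1) / (2 * γ)) =
      (β * γ / (α * δ)) ^ (δ / γ) * (β * γ / (α * δ)) ^ (1 / (2 * γ)) := by
    rw [← Real.rpow_add hκ]; congr 1; field_simp
  have e2 : (m : ℝ) ^ (-(δ / γ) * (1 / 2 + δ - γ) - δ) =
      (m : ℝ) ^ (-(δ / γ * (δ - γ))) * (m : ℝ) ^ (-(δ / (2 * γ))) * (m : ℝ) ^ (-δ) := by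
    rw [← Real.rpow_add hm0, ← Real.rpow_add hm0]; congr 1; field_simp; ring
  have e3 : tau α β γ δ m ^ (2 + 2 * δ) =
      tau α β γ δ m ^ 2 * (tau α β γ δ m ^ 2) ^ δ := by
    rw [Real.rpow_add hτ, Real.rpow_two, Real.rpow_mul hτ.le, Real.rpow_two]
  have h1 : (β * γ / (α * δ)) ^ (1 / (2 * γ)) ≤ 1 := Real.rpow_le_one hκ.le hκ1 (by positivity)
  have h2 : (m : ℝ) ^ (-(δ / (2 * γ))) ≤ 1 :=
    Real.rpow_le_one_of_one_le_of_nonpos h.m_cast (neg_nonpos.2 (by positivity))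
  have h3 : (β * γ / (α * δ)) ^ (1 / (2 * γ)) * (m : ℝ) ^ (-(δ / (2 * γ))) ≤ 1 :=
    mul_le_one₀ h1 (by positivity) h2
  rw [epsDiverge, e1, e2, e3, h.rate_eq]
  set V := (β * γ / (α * δ)) ^ (δ / γ)
  set W := (m : ℝ) ^ (-(δ / γ * (δ - γ)))
  set q := (β * γ / (α * δ)) ^ (1 / (2 * γ)) * (m : ℝ) ^ (-(δ / (2 * γ))) with hq
  set R := 9 / 256 * (β / δ) * (V * W) * (m : ℝ) ^ (-δ) *
      (tau α β γ δ m ^ 2 * (tau α β γ δ m ^ 2) ^ δ) * η with hR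
  have hR0 : 0 ≤ R := by positivity
  calc _ = R * q := by rw [hR, hq]; ring
    _ ≤ R * 1 := mul_le_mul_of_nonneg_left h3 hR0
    _ = R := mul_one R

theorem eps_le (h : Admissible α β γ δ d m) (hσ0 : 0 < σ)
    (hε : ε ≤ 1 / 100 * epsDiverge α β γ δ m (etaZero α β γ δ m d σ) * (d : ℝ) ^ (-δ)) :
    ε ≤ 1 / 2000 * ((β / δ) * (β / δ / (α / γ) * sFloor α β γ δ m ^ (δ - γ)) * (m : ℝ) ^ (-δ) *
      (tau α β γ δ m ^ 2 * (tau α β γ δ m ^ 2) ^ δ) *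
      (σ / √d * sFloor α β γ δ m * tau α β γ δ m ^ 2) * (d : ℝ) ^ (-δ)) := by
  have hs := h.sFloor_pos
  have hτ := h.tau_pos
  have hβ := h.β_pos; have hδ := h.δ_pos
  have hV := h.rate_pos
  have hη : 0 ≤ etaZero α β γ δ m d σ := by rw [etaZero_eq]; positivity
  have h1 := h.epsDiverge_le hη
  have hd : 0 ≤ (d : ℝ) ^ (-δ) := Real.rpow_nonneg (Nat.cast_nonneg d) _
  have h2 := mul_le_mul_of_nonneg_right (mul_le_mul_of_nonneg_left h1
    (by norm_num : (0 : ℝ) ≤ 1 / 100)) hd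
  refine (hε.trans h2).trans ?_
  rw [etaZero_eq]
  set V := β / δ / (α / γ) * sFloor α β γ δ m ^ (δ - γ)
  set R := (β / δ) * V * (m : ℝ) ^ (-δ) *
      (tau α β γ δ m ^ 2 * (tau α β γ δ m ^ 2) ^ δ) *
      (σ / √d * sFloor α β γ δ m * tau α β γ δ m ^ 2) * (d : ℝ) ^ (-δ) with hR
  have hR0 : 0 ≤ R := by positivity
  calc _ = 9 / 25600 * R := by rw [hR]; ring
    _ ≤ _ := by linarith

theorem sigma_bounds (h : Admissible α β γ δ d m) (hσ0 : 0 < σ)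
    (hσ : σ ≤ 1 / (6 * √(2 * d * (1 + 2 * δ))) * tau α β γ δ m ^ 2) :
    σ ≤ tau α β γ δ m / 12 ∧ (1 + 2 * δ) * σ ^ 2 ≤ 1 / 144 ∧
      σ * √d ≤ sFloor α β γ δ m / 32 := by
  have hδ := h.δ_pos
  have hd := h.d_cast
  have hd0 : (0 : ℝ) < d := by linarith
  have hs0 := h.sFloor_pos
  have hτ0 := h.tau_pos
  have hτsq := h.tau_sq_lt_one
  have hτs := h.tau_sq_le
  have hσsq := h.sigma_sq_le hσ0 hσ
  clear hσ
  generalize tau α β γ δ m = τ at *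
  generalize sFloor α β γ δ m = s at *
  have hτ4 : (τ ^ 2) ^ 2 ≤ τ ^ 2 := by
    rw [sq (τ ^ 2)]; exact mul_le_of_le_one_left (sq_nonneg τ) hτsq.le
  have hσ12 : (12 * σ) ^ 2 ≤ τ ^ 2 := by
    have h1 : 0 ≤ δ * σ ^ 2 := by positivity
    nlinarith [mul_nonneg (by linarith : (0 : ℝ) ≤ d - 2) (sq_nonneg σ),
      mul_nonneg (by linarith : (0 : ℝ) ≤ d - 2) h1]
  refine ⟨?_, ?_, ?_⟩
  · have := (sq_le_sq₀ (by positivity) hτ0.le).1 hσ12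
    linarith
  · have h1 : 0 ≤ (1 + 2 * δ) * σ ^ 2 := by positivity
    have h2 : (1 + 2 * δ) * σ ^ 2 * 2 ≤ (1 + 2 * δ) * σ ^ 2 * d :=
      mul_le_mul_of_nonneg_left hd h1
    linarith
  · refine (sq_le_sq₀ (by positivity) (by positivity)).1 ?_
    rw [mul_pow, Real.sq_sqrt hd0.le, div_pow]
    have h1 : (τ ^ 2) ^ 2 ≤ s ^ 2 * (δ / (δ + 2)) ^ 2 := by
      rw [← mul_pow]; exact pow_le_pow_left₀ (sq_nonneg τ) hτs 2
    -- The estimate `τ² ≤ s` alone would not suffice for small `δ`; the factor `δ/(δ+2)` is needed.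
    have h2 : (δ / (δ + 2)) ^ 2 * (128 / 9) ≤ 1 + 2 * δ := by
      rw [div_pow, div_mul_eq_mul_div, div_le_iff₀ (by positivity)]
      nlinarith [mul_nonneg hδ.le (sq_nonneg (δ - 21 / 16)), sq_nonneg δ]
    have h3 : 72 * (1 + 2 * δ) * (σ ^ 2 * d) ≤ s ^ 2 * ((1 + 2 * δ) * (9 / 128)) := by
      calc 72 * (1 + 2 * δ) * (σ ^ 2 * d) = 72 * d * (1 + 2 * δ) * σ ^ 2 := by ring
        _ ≤ s ^ 2 * (δ / (δ + 2)) ^ 2 := hσsq.trans h1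
        _ ≤ s ^ 2 * ((1 + 2 * δ) * (9 / 128)) := by gcongr; linarith
    have h4 : (1 + 2 * δ) * (72 * (σ ^ 2 * d)) ≤ (1 + 2 * δ) * (s ^ 2 * (9 / 128)) := by linarith
    have h5 := le_of_mul_le_mul_left h4 (by linarith)
    linarith

-- Apart from `a`, the bound on `ε` from `eps_le` is a product of factors at most `1`. Each relation
-- keeps the factors it needs and replaces the others by `1`.
set_option maxHeartbeats 1000000 in
theorem scales (h : Admissible α β γ δ d m) (hσ0 : 0 < σ)
    (hσ : σ ≤ 1 / (6 * √(2 * d * (1 + 2 * δ))) * tau α β γ δ m ^ 2) (hε0 : 0 < ε)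
    (hε : ε ≤ 1 / 100 * epsDiverge α β γ δ m (etaZero α β γ δ m d σ) * (d : ℝ) ^ (-δ)) :
    Scales d m (β / δ) (α / γ) γ δ ε σ (tau α β γ δ m) (sFloor α β γ δ m) ∧
      50 * √m * ε ≤ β / δ * ((d : ℝ) ^ (1 / 2 + δ))⁻¹ * σ := by
  have hα := h.α_pos; have hβ := h.β_pos; have hγ := h.γ_pos; have hδ := h.δ_pos
  have hd := h.d_cast
  have hd0 : (0 : ℝ) < d := by linarith
  have hm := h.m_cast
  have hm0 : (0 : ℝ) < m := by linarith
  have hεb := h.eps_le hσ0 hε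
  clear hε
  have hV0 := h.rate_pos
  have hV1 := h.rate_le_one
  have hs0 := h.sFloor_pos
  have hs1 := h.sFloor_le_one
  have hτ0 := h.tau_pos
  have hτ1 := h.tau_lt_one
  have hτsq := h.tau_sq_lt_one
  have hτs := h.tau_sq_le
  have hτδ := h.tau_sq_le_delta
  have hτrpow := h.tau_sq_rpow
  have hsrpow := h.sFloor_rpow
  have hsinv := h.sFloor_le_inv
  have hS := h.sigma_bounds hσ0 hσ
  set τ := tau α β γ δ m
  set s := sFloor α β γ δ m
  set V := β / δ / (α / γ) * s ^ (δ - γ) with hV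
  set a := β / δ with ha
  have ha0 : 0 < a := by positivity
  have hp0 : 0 < (m : ℝ) ^ (-δ) := Real.rpow_pos_of_pos hm0 _
  have hp1 : (m : ℝ) ^ (-δ) ≤ 1 := Real.rpow_le_one_of_one_le_of_nonpos hm (by linarith)
  have hdp0 : 0 < (d : ℝ) ^ (-δ) := Real.rpow_pos_of_pos hd0 _
  have hdp1 : (d : ℝ) ^ (-δ) ≤ 1 :=
    Real.rpow_le_one_of_one_le_of_nonpos (by linarith) (by linarith)
  have ht0 : 0 < (τ ^ 2) ^ δ := by positivity
  have ht1 : (τ ^ 2) ^ δ ≤ 1 := Real.rpow_le_one (sq_nonneg τ) hτsq.le hδ.le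
  have hsd : 1 ≤ √(d : ℝ) := Real.one_le_sqrt.2 (by linarith)
  have hσd : σ / √(d : ℝ) ≤ σ := div_le_self hσ0.le hsd
  have hσd0 : 0 < σ / √(d : ℝ) := by positivity
  have hττ : τ ^ 2 ≤ τ := by rw [sq]; exact mul_le_of_le_one_left hτ0.le hτ1.le
  have hτt : τ ^ 2 * (τ ^ 2) ^ δ ≤ τ * (τ ^ 2) ^ δ := mul_le_mul_of_nonneg_right hττ ht0.le
  have hτδ2 : τ ^ 2 ≤ δ / 2 := by
    linarith
  have hαγ : α / γ * (β * γ / (α * δ * (m : ℝ) ^ δ)) = a * (m : ℝ) ^ (-δ) := by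
    rw [Real.rpow_neg hm0.le, ha]; field_simp
  have hσ1 : σ ≤ 1 := by
    have := hS.1
    linarith
  have hσd1 : σ / √(d : ℝ) ≤ 1 := hσd.trans hσ1
  refine ⟨⟨ha0, by positivity, hγ, hδ, hε0, hσ0, hτ0, hτ1, hs0, ?_, ?_, ?_, ?_, ?_, ?_, ?_, ?_⟩, ?_⟩
  · rw [hτrpow, ← mul_div_assoc, hαγ]
  · rw [hsrpow, hαγ]
  · exact hS.1
  · exact hS.2.1
  · exact hS.2.2
  · calc ε ≤ _ := hεb
      _ ≤ 1 / 2000 * (a * 1 * (m : ℝ) ^ (-δ) * (1 * 1) * (σ * 1 * 1) * 1) := by gcongr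
      _ ≤ _ := by
        have : 0 < a * (m : ℝ) ^ (-δ) * σ := by positivity
        linarith
  · calc ε ≤ _ := hεb
      _ ≤ 1 / 2000 * (a * 1 * 1 * (τ * (τ ^ 2) ^ δ) * (1 * 1 * 1) * 1) := by
        gcongr
      _ ≤ _ := by
        have : 0 < a * (τ * (τ ^ 2) ^ δ) := by positivity
        linarith
  -- Only this relation uses the rate `V`; one factor `τ²` is traded for `δ/2`.
  · have hδV : δ * (a / (α / γ)) * s ^ (δ - γ) = δ * V := by rw [hV]; ring
    rw [hδV]
    have h1 : ε ≤ 1 / 2000 * (a * V * 1 * (τ * (τ ^ 2) ^ δ) * (σ / √d * s * (δ / 2)) * 1) := by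
      refine hεb.trans ?_
      gcongr
    have h2 : s * σ / (40 * √(d : ℝ)) = σ / √d * s / 40 := by field_simp
    rw [h2]
    have h3 : 0 < a * V * (τ * (τ ^ 2) ^ δ) * (σ / √d * s) * δ := by positivity
    linarith
  · have hsm : √(m : ℝ) * τ ^ 2 ≤ 1 := by
      have h1 : τ ^ 2 ≤ (m : ℝ)⁻¹ := by
        have h2 : δ / (δ + 2) ≤ 1 := by rw [div_le_one (by linarith)]; linarith
        have h3 : s * (δ / (δ + 2)) ≤ s := mul_le_of_le_one_right hs0.le h2
        linarith
      have h4 : √(m : ℝ) ≤ m := by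
        rw [Real.sqrt_le_left (by linarith)]; nlinarith
      calc √(m : ℝ) * τ ^ 2 ≤ m * (m : ℝ)⁻¹ := by gcongr
        _ = 1 := mul_inv_cancel₀ hm0.ne'
    have e : ((d : ℝ) ^ (1 / 2 + δ))⁻¹ = (√d)⁻¹ * (d : ℝ) ^ (-δ) := by
      rw [Real.rpow_add hd0, mul_inv, ← Real.sqrt_eq_rpow, Real.rpow_neg hd0.le]
    rw [e]
    calc 50 * √m * ε ≤ 50 * √m * (1 / 2000 * (a * 1 * 1 * (τ ^ 2 * 1) * (σ / √d * 1 * 1) *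
          (d : ℝ) ^ (-δ))) := by
          refine mul_le_mul_of_nonneg_left (hεb.trans ?_) (by positivity)
          gcongr
      _ = 1 / 40 * (√m * τ ^ 2) * (a * (σ / √d) * (d : ℝ) ^ (-δ)) := by ring
      _ ≤ 1 / 40 * 1 * (a * (σ / √d) * (d : ℝ) ^ (-δ)) := by gcongr
      _ ≤ 1 * (a * (σ / √d) * (d : ℝ) ^ (-δ)) := by gcongr; norm_num
      _ = a * ((√d)⁻¹ * (d : ℝ) ^ (-δ)) * σ := by ring

end Admissible

/-! ### The iteration counts -/

/-- The argument of the outer logarithm in `nSmall` is `-log₂` of the value of `8(A/a) r^(2γ)` at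
the target residual `r = 4ε/a`, so `nSmall` counts the steps of `resid_singleton_iterate_le`. -/
theorem small_exponent_eq (hα : 0 < α) (hβ : 0 < β) (hγ : 0 < γ) (hδ : 0 < δ) (hε : 0 < ε) :
    Real.logb 2 (β * γ / (8 * α * δ)) + 2 * γ * Real.logb 2 (β / (4 * δ * ε)) =
      -Real.logb 2 (8 * (α / γ / (β / δ)) * ((4 * ε / (β / δ)) ^ 2) ^ γ) := by
  have h1 : β * γ / (8 * α * δ) = (8 * (α / γ / (β / δ)))⁻¹ := by field_simp
  have h2 : β / (4 * δ * ε) = (4 * ε / (β / δ))⁻¹ := by field_simp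
  have hK : 0 < 8 * (α / γ / (β / δ)) := by positivity
  have hT : 0 < 4 * ε / (β / δ) := by positivity
  have h3 : Real.logb 2 (8 * (α / γ / (β / δ)) * ((4 * ε / (β / δ)) ^ 2) ^ γ) =
      Real.logb 2 (8 * (α / γ / (β / δ))) + γ * (2 * Real.logb 2 (4 * ε / (β / δ))) := by
    rw [Real.logb_mul hK.ne' (by positivity), Real.logb_rpow_eq_mul_logb_of_pos (by positivity),
      Real.logb_pow]
    norm_num
  rw [h1, h2, h3, Real.logb_inv, Real.logb_inv]
  ring

theorem half_rpow_le_of_nSmall_le (hα : 0 < α) (hβ : 0 < β) (hγ : 0 < γ) (hδ : 0 < δ) (hε : 0 < ε)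
    {N : ℕ} (hN : nSmall α β γ δ ε ≤ (N : ℤ)) :
    (1 / 2 : ℝ) ^ ((1 + 2 * γ) ^ (N : ℝ)) ≤
      8 * (α / γ / (β / δ)) * ((4 * ε / (β / δ)) ^ 2) ^ γ := by
  rw [nSmall, Int.ceil_le, small_exponent_eq hα hβ hγ hδ hε] at hN
  set Q := 8 * (α / γ / (β / δ)) * ((4 * ε / (β / δ)) ^ 2) ^ γ with hQ
  have hQ0 : 0 < Q := by positivity
  have hle : -Real.logb 2 Q ≤ (1 + 2 * γ) ^ (N : ℝ) := by
    -- A logarithm of a nonpositive number says nothing about `N`, but in that case the left side is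
    -- nonpositive and the bound is trivial.
    by_cases h0 : 0 < -Real.logb 2 Q
    · rw [Real.logb_le_iff_le_rpow (by linarith) h0] at hN
      exact_mod_cast hN
    · push Not at h0
      exact h0.trans (Real.rpow_nonneg (by linarith) _)
  calc (1 / 2 : ℝ) ^ ((1 + 2 * γ) ^ (N : ℝ)) = 2 ^ (-((1 + 2 * γ) ^ (N : ℝ))) := by
        rw [one_div, Real.inv_rpow (by norm_num), Real.rpow_neg (by norm_num)]
    _ ≤ 2 ^ Real.logb 2 Q := Real.rpow_le_rpow_of_exponent_le (by norm_num) (by linarith)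
    _ = Q := Real.rpow_logb (by norm_num) (by norm_num) hQ0

/-- The bound on `N₂` contains several multiples of `nSmall`; only its sign allows the superfluous
ones to be dropped. -/
theorem nSmall_nonneg {τ s : ℝ} (hα : 0 < α) (hβ : 0 < β) (hγ : 0 < γ) (hδ : 0 < δ)
    (hs : Scales d m (β / δ) (α / γ) γ δ ε σ τ s) (i : Fin m) : 0 ≤ nSmall α β γ δ ε := by
  have hε := hs.ε_pos
  rw [nSmall, small_exponent_eq hα hβ hγ hδ hε]
  refine Int.ceil_nonneg (Real.logb_nonneg (by linarith) ?_)
  have ha := hs.a_pos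
  have hT : 4 * ε / (β / δ) ≤ 5 / 4 * σ := by
    rw [div_le_iff₀ ha]
    have hm1 : (m : ℝ) ^ (-δ) ≤ 1 :=
      Real.rpow_le_one_of_one_le_of_nonpos (hs.one_le_of_fin i) (by linarith)
    have h1 : β / δ * (m : ℝ) ^ (-δ) * σ ≤ β / δ * 1 * σ := by
      have := hs.σ_pos; gcongr
    have h2 : 0 < β / δ * σ := mul_pos ha hs.σ_pos
    linarith [hs.ε_le]
  have h1 := hs.ratio_mul_rpow_le i (by positivity : 0 ≤ 4 * ε / (β / δ)) hT
  set Q := 8 * (α / γ / (β / δ)) * ((4 * ε / (β / δ)) ^ 2) ^ γ with hQ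
  have hQ0 : 0 < Q := by positivity
  have hQ1 : Q ≤ 2⁻¹ := by rw [hQ]; linarith
  have h2 := Real.logb_le_logb_of_le (b := 2) (by norm_num) hQ0 hQ1
  rw [Real.logb_inv, Real.logb_self_eq_one (by norm_num)] at h2
  linarith

/-- A crude count of order `1/σ` is enough, because the spreading time is at least that long. -/
theorem exists_geometric_le {σ : ℝ} (hσ : 0 < σ) :
    ∃ L : ℕ, ((1 : ℝ) / 15) ^ L ≤ σ / 10 ∧ (L : ℝ) ≤ 1 / σ + 1 := by
  refine ⟨⌈1 / σ⌉₊, ?_, (Nat.ceil_lt_add_one (by positivity)).le⟩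
  set L := ⌈1 / σ⌉₊
  have h1 : 1 / σ ≤ L := Nat.le_ceil _
  have h2 := one_add_mul_le_pow (a := (14 : ℝ)) (by norm_num) L
  rw [div_pow, one_pow, div_le_iff₀ (by positivity)]
  have h3 : 1 + (L : ℝ) * 14 ≤ 15 ^ L := by
    have : (1 + 14 : ℝ) = 15 := by norm_num
    rwa [this] at h2
  have h4 : 1 ≤ L * σ := (div_le_iff₀ hσ).1 h1
  nlinarith

namespace Admissible

/-- The real number that is rounded up in `nSpread`. -/
theorem spread_eq (h : Admissible α β γ δ d m) {η : ℝ} (hη : 0 < η) :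
    3 / (2 * η) * (α * δ / (β * γ)) ^ (δ / γ) * (m : ℝ) ^ (δ / γ * (δ - γ)) *
      (1 / γ * Real.log (4 * α * δ / (β * γ)) + δ / γ * Real.log m) =
    3 / 4 * (-Real.log (sFloor α β γ δ m) - Real.log (tau α β γ δ m ^ 2)) /
      (η * (β / δ / (α / γ) * sFloor α β γ δ m ^ (δ - γ))) := by
  have hα := h.α_pos; have hβ := h.β_pos; have hγ := h.γ_pos; have hδ := h.δ_pos
  have hm0 : (0 : ℝ) < m := zero_lt_one.trans_le h.m_cast
  have hpow := Real.rpow_pos_of_pos hm0 δ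
  have e1 : (α * δ / (β * γ)) ^ (δ / γ) = ((β * γ / (α * δ)) ^ (δ / γ))⁻¹ := by
    rw [← Real.inv_rpow (by positivity), inv_div]
  have e2 : (m : ℝ) ^ (δ / γ * (δ - γ)) = ((m : ℝ) ^ (-(δ / γ * (δ - γ))))⁻¹ := by
    rw [Real.rpow_neg hm0.le, inv_inv]
  have e3 : Real.log (sFloor α β γ δ m) =
      1 / γ * (-Real.log (α * δ / (β * γ)) - δ * Real.log m) := by
    rw [sFloor, Real.log_rpow h.base_pos,
      show β * γ / (α * δ * (m : ℝ) ^ δ) = (α * δ / (β * γ) * (m : ℝ) ^ δ)⁻¹ by field_simp,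
      Real.log_inv, Real.log_mul (by positivity) hpow.ne', Real.log_rpow hm0]
    ring
  have e4 : Real.log (tau α β γ δ m ^ 2) =
      Real.log (sFloor α β γ δ m) - 1 / γ * (2 * Real.log 4) := by
    rw [h.tau_sq, Real.log_mul h.sFloor_pos.ne' (by positivity), Real.log_rpow (by norm_num),
      Real.log_inv, show (16 : ℝ) = 4 ^ 2 by norm_num, Real.log_pow]
    push_cast
    ring
  have e5 : Real.log (4 * α * δ / (β * γ)) = Real.log 4 + Real.log (α * δ / (β * γ)) := by
    rw [← Real.log_mul (by norm_num) (by positivity)]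
    congr 1
    ring
  rw [h.rate_eq, e1, e2, e4, e3, e5]
  have h1 : 0 < (β * γ / (α * δ)) ^ (δ / γ) := by positivity
  have h2 : 0 < (m : ℝ) ^ (-(δ / γ * (δ - γ))) := by positivity
  field_simp
  ring

/-- For `m ≥ 2`, `τ² ≤ s ≤ 1/m ≤ 1/2`, and `2 ln 2 ≥ 4/3`. The constant makes the spreading time at
least `1/σ`. -/
theorem log_sum_ge (h : Admissible α β γ δ d m) (hm : 2 ≤ m) :
    4 / 3 ≤ -Real.log (sFloor α β γ δ m) - Real.log (tau α β γ δ m ^ 2) := by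
  have hm2 : (2 : ℝ) ≤ m := by exact_mod_cast hm
  have h1 : Real.log (sFloor α β γ δ m) ≤ -Real.log m := by
    rw [← Real.log_inv]
    exact Real.log_le_log h.sFloor_pos h.sFloor_le_inv
  have h2 : Real.log (tau α β γ δ m ^ 2) ≤ Real.log (sFloor α β γ δ m) := by
    refine Real.log_le_log (pow_pos h.tau_pos 2) ?_
    have hδ := h.δ_pos
    have h3 : δ / (δ + 2) ≤ 1 := by rw [div_le_one (by linarith)]; linarith
    exact h.tau_sq_le.trans (mul_le_of_le_one_right h.sFloor_pos.le h3)
  have h4 := Real.log_le_log two_pos hm2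
  linarith [Real.log_two_gt_d9]

theorem log_sum_pos (h : Admissible α β γ δ d m) :
    0 < -Real.log (sFloor α β γ δ m) - Real.log (tau α β γ δ m ^ 2) := by
  have h1 := Real.log_nonpos h.sFloor_pos.le h.sFloor_le_one
  have h2 := Real.log_neg (pow_pos h.tau_pos 2) h.tau_sq_lt_one
  linarith

theorem exists_counts (h : Admissible α β γ δ d m) (hσ0 : 0 < σ) (hσ1 : σ ≤ 1 / 12) (hm : 2 ≤ m)
    {N : ℕ}
    (hN : 16 * (3 / 4 * (-Real.log (sFloor α β γ δ m) - Real.log (tau α β γ δ m ^ 2)) /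
      (etaZero α β γ δ m d σ * (β / δ / (α / γ) * sFloor α β γ δ m ^ (δ - γ)))) ≤ N) :
    ∃ J L : ℕ, ((1 : ℝ) / 15) ^ L ≤ σ / 10 ∧
      -Real.log (sFloor α β γ δ m) - Real.log (tau α β γ δ m ^ 2) <
        2 * (δ * (β / δ / (α / γ)) * sFloor α β γ δ m ^ (δ - γ) *
          (sFloor α β γ δ m * σ / (40 * √d))) * J ∧ J + L ≤ N := by
  obtain ⟨L, hL, hL'⟩ := exists_geometric_le hσ0
  have hδ := h.δ_pos
  have hd := h.d_cast
  have hs0 := h.sFloor_pos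
  have hs1 := h.sFloor_le_one
  have hτ0 := h.tau_pos
  have hτ1 := h.tau_sq_lt_one
  have hτδ := h.tau_sq_le_delta
  have hV0 := h.rate_pos
  have hV1 := h.rate_le_one
  have hY := h.log_sum_ge hm
  rw [etaZero_eq] at hN
  set s := sFloor α β γ δ m
  set τ := tau α β γ δ m
  set Y := -Real.log s - Real.log (τ ^ 2)
  set V := β / δ / (α / γ) * s ^ (δ - γ) with hV
  have hδV : δ * (β / δ / (α / γ)) * s ^ (δ - γ) = δ * V := by rw [hV]; ring
  rw [hδV]
  have hsd : 1 ≤ √(d : ℝ) := Real.one_le_sqrt.2 (by linarith)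
  set η := σ / √(d : ℝ) * s * τ ^ 2 with hη
  have hη0 : 0 < η := by positivity
  have hησ : η ≤ σ := by
    calc η ≤ σ * 1 * 1 := by
          rw [hη]
          gcongr
          exact div_le_self hσ0.le hsd
      _ = σ := by ring
  set q := 2 * (δ * V * (s * σ / (40 * √d))) with hq
  have hq0 : 0 < q := by positivity
  set X := 3 / 4 * Y / (η * V) with hX
  have hX1 : 1 / σ ≤ X := by
    rw [hX, div_le_div_iff₀ hσ0 (by positivity)]
    have h1 : η * V ≤ σ * 1 := mul_le_mul hησ hV1 hV0.le hσ0.le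
    nlinarith
  -- This is `τ² ≤ δ/2` again, comparing `etaZero` with the guaranteed gain per step.
  have hqη : η * V ≤ 10 * q := by
    have e : q = δ * V * (σ / √d * s) / 20 := by rw [hq]; field_simp; norm_num
    rw [e, hη]
    have h1 : 0 < V * (σ / √d * s) := by positivity
    nlinarith
  have hR : Y / q ≤ 40 / 3 * X := by
    have h1 : Y / q ≤ Y / (η * V / 10) :=
      div_le_div_of_nonneg_left (by linarith) (by positivity) (by linarith)
    have h2 : Y / (η * V / 10) = 40 / 3 * X := by rw [hX]; field_simp; norm_num
    linarith
  -- Spreading costs at most `40/3 X`, contraction at most `X`, and the two roundings at most `X/6`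
  -- because `X ≥ 1/σ ≥ 12`; the total is below `16 X`.
  refine ⟨⌊Y / q⌋₊ + 1, L, hL, ?_, ?_⟩
  · have h1 := Nat.lt_floor_add_one (Y / q)
    rw [div_lt_iff₀ hq0] at h1
    push_cast
    linarith
  · have h1 := Nat.floor_le (by positivity : 0 ≤ Y / q)
    have h2 : (12 : ℝ) ≤ 1 / σ := by rw [le_div_iff₀ hσ0]; linarith
    have h3 : ((⌊Y / q⌋₊ + 1 + L : ℕ) : ℝ) ≤ N := by
      push_cast
      linarith
    exact_mod_cast h3

end Admissible

theorem pow_le_of_log_le {p : ℝ} (hm : 1 ≤ m) (hp : 0 < p) {n : ℕ}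
    (hn : 20 * m * Real.log (m / p) ≤ n) : m * (1 - 1 / 20 / m) ^ n ≤ p := by
  have hm0 : (0 : ℝ) < m := by exact_mod_cast hm
  have hm1 : (1 : ℝ) ≤ m := by exact_mod_cast hm
  have h1 : 1 - 1 / 20 / (m : ℝ) ≤ Real.exp (-(1 / 20 / m)) := by
    have := Real.add_one_le_exp (-(1 / 20 / (m : ℝ)))
    linarith
  have h0 : 0 ≤ 1 - 1 / 20 / (m : ℝ) := by
    have : 1 / 20 / (m : ℝ) ≤ 1 := by rw [div_le_one hm0]; linarith
    linarith
  have h2 := pow_le_pow_left₀ h0 h1 n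
  rw [← Real.exp_nat_mul] at h2
  have h3 : (n : ℝ) * -(1 / 20 / m) ≤ -Real.log (m / p) := by
    have e : (n : ℝ) * -(1 / 20 / m) = -(n / (20 * m)) := by field_simp
    rw [e, neg_le_neg_iff, le_div_iff₀ (by positivity)]
    linarith
  have h4 := h2.trans (Real.exp_le_exp.2 h3)
  rw [Real.exp_neg, Real.exp_log (by positivity), inv_div] at h4
  calc m * (1 - 1 / 20 / (m : ℝ)) ^ n ≤ m * (p / m) := by gcongr
    _ = p := mul_div_cancel₀ _ hm0.ne'

end Parameters

end HiddenBasis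
end

noncomputable section

namespace HiddenBasis

/-! ### The main theorem -/

section Main

variable {d m k : ℕ} {Z : Fin m → Vec d} {α β γ δ ε σ : ℝ}

/-- The index set already found. -/
def foundSet (π : Equiv.Perm (Fin m)) (k : ℕ) : Finset (Fin m) :=
  Finset.univ.filter fun i => (π.symm i : ℕ) < k

theorem mem_foundSet {π : Equiv.Perm (Fin m)} {i : Fin m} :
    i ∈ foundSet π k ↔ (π.symm i : ℕ) < k := by
  simp [foundSet]

theorem card_foundSet (π : Equiv.Perm (Fin m)) (hk : k ≤ m) : (foundSet π k).card = k := by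
  have h : foundSet π k =
      Finset.univ.map ((Fin.castLEEmb hk).trans π.toEmbedding) := by
    ext i
    rw [mem_foundSet, Finset.mem_map]
    constructor
    · exact fun hi => ⟨⟨π.symm i, hi⟩, Finset.mem_univ _, by simp⟩
    · rintro ⟨j, -, rfl⟩
      simp
  rw [h, Finset.card_map, Finset.card_univ, Fintype.card_fin]

theorem abs_inner_le_of_norm_smul_sub_le {x μ z : Vec d} {s r : ℝ} (hx : ‖x‖ = 1)
    (hxμ : inner ℝ x μ = 0) (h : ‖s • μ - z‖ ≤ r) : |inner ℝ x z| ≤ r := by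
  have h1 : inner ℝ x z = -inner ℝ x (s • μ - z) := by
    rw [inner_sub_right, inner_smul_right, hxμ]; ring
  rw [h1, abs_neg]
  have h2 := abs_real_inner_le_norm x (s • μ - z)
  rw [hx, one_mul] at h2
  exact h2.trans h

theorem nearBasis_subset (hZ : Orthonormal ℝ Z) (π : Equiv.Perm (Fin m)) :
    nearBasis Z (foundSet π k)ᶜ (4 * ε / (β / δ)) ⊆
      {v | ∃ t : ℝ, (t = 1 ∨ t = -1) ∧ ∃ j : Fin m, k ≤ (j : ℕ) ∧
        ‖t • v - Z (π j)‖ ≤ 4 * √2 * δ * ε / β} := by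
  rintro v ⟨hv, i, hi, hr⟩
  rw [Finset.mem_compl, mem_foundSet, not_lt] at hi
  obtain ⟨t, ht, htv⟩ := exists_sign_norm_sub_le (i := i) hZ hv
  refine ⟨t, ht, π.symm i, hi, ?_⟩
  rw [Equiv.apply_symm_apply]
  calc ‖t • v - Z i‖ ≤ √2 * (4 * ε / (β / δ)) :=
        htv.trans (mul_le_mul_of_nonneg_left hr (Real.sqrt_nonneg 2))
    _ = 4 * √2 * δ * ε / β := by rw [div_div_eq_mul_div]; ring

theorem admissible_of_isProfile {ψ : Fin m → ℝ → ℝ} (hα : 0 < α) (hβ : 0 < β)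
    (hγ : 0 < γ) (hδ : 0 < δ) (hd : 2 ≤ d) (i : Fin m)
    (hψ : IsProfile (ψ i) (β / δ) (α / γ) γ δ) : Admissible α β γ δ d m where
  α_pos := hα
  β_pos := hβ
  γ_pos := hγ
  δ_pos := hδ
  γ_le := hψ.exponent_le hδ hγ (by positivity)
  ratio_le := by
    have := hψ.le_of_mem hδ hγ
    rwa [div_le_div_iff₀ hδ hγ] at this
  two_le := hd
  one_le := i.pos

theorem card_le_of_orthonormal (hZ : Orthonormal ℝ Z) : m ≤ d := by
  simpa using hZ.linearIndependent.fintype_card_le_finrank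

/-- A loop long enough for the spreading and the convergence phase. -/
theorem Admissible.loop_length (h : Admissible α β γ δ d m) (hσ0 : 0 < σ)
    (hsmall : 0 ≤ nSmall α β γ δ ε) {N : ℕ}
    (hN : 2 * (nSmall α β γ δ ε : ℝ) +
      16 * (nSpread α β γ δ ε m (etaZero α β γ δ m d σ) : ℝ) ≤ (N : ℝ)) :
    1 ≤ N ∧ nSmall α β γ δ ε ≤ (N : ℤ) ∧
      16 * (3 / 4 * (-Real.log (sFloor α β γ δ m) - Real.log (tau α β γ δ m ^ 2)) /
        (etaZero α β γ δ m d σ * (β / δ / (α / γ) * sFloor α β γ δ m ^ (δ - γ)))) ≤ N := by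
  have hs := h.sFloor_pos
  have hτ := h.tau_pos
  have hd := h.d_cast
  have hη : 0 < etaZero α β γ δ m d σ := by
    rw [etaZero_eq]
    have : 0 < √(d : ℝ) := Real.sqrt_pos.2 (by linarith)
    positivity
  have hX : 0 < 3 / 4 * (-Real.log (sFloor α β γ δ m) - Real.log (tau α β γ δ m ^ 2)) /
      (etaZero α β γ δ m d σ * (β / δ / (α / γ) * sFloor α β γ δ m ^ (δ - γ))) :=
    div_pos (mul_pos (by norm_num) h.log_sum_pos) (mul_pos hη h.rate_pos)
  rw [nSpread, h.spread_eq hη] at hN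
  set X := 3 / 4 * (-Real.log (sFloor α β γ δ m) - Real.log (tau α β γ δ m ^ 2)) /
      (etaZero α β γ δ m d σ * (β / δ / (α / γ) * sFloor α β γ δ m ^ (δ - γ)))
  have h1 := Int.le_ceil X
  have h2 : (0 : ℝ) ≤ nSmall α β γ δ ε := by exact_mod_cast hsmall
  push_cast at hN
  refine ⟨?_, ?_, by linarith⟩
  · have : (0 : ℝ) < N := by linarith
    exact_mod_cast this
  · have : (nSmall α β γ δ ε : ℝ) ≤ N := by linarith
    exact_mod_cast this

/-- Twenty of the `21` multiples of `m⌈ln(m/p)⌉` bring the failure probability down to `p`; the last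
one is at least `1` and pays for the final round. -/
theorem exists_eq_succ_of_rounds_le {p : ℝ} {I : ℕ} (hm : 1 ≤ m) (hp : 0 < p) (hp1 : p < 1)
    (hI : 21 * m * (⌈Real.log (m / p)⌉ : ℝ) ≤ (I : ℝ)) :
    ∃ n, I = n + 1 ∧ m * (1 - 1 / 20 / m : ℝ) ^ n ≤ p := by
  have hm1 : (1 : ℝ) ≤ m := by exact_mod_cast hm
  have hlog : 0 < Real.log (m / p) := Real.log_pos (by rw [lt_div_iff₀ hp]; linarith)
  have hc : (1 : ℝ) ≤ ⌈Real.log (m / p)⌉ := by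
    exact_mod_cast Int.one_le_ceil_iff.2 hlog
  have hle := Int.le_ceil (Real.log (m / p))
  have h1 : (1 : ℝ) ≤ m * ⌈Real.log (m / p)⌉ := one_le_mul_of_one_le_of_one_le hm1 hc
  have h2 : (m : ℝ) * Real.log (m / p) ≤ m * ⌈Real.log (m / p)⌉ := by gcongr
  obtain - | n := I
  · push_cast at hI
    linarith
  · refine ⟨n, rfl, pow_le_of_log_le hm hp ?_⟩
    push_cast at hI
    linarith

end Main

end HiddenBasis

end

theorem mainTheorem6 :
    ∃ C₀ C₁ C₂ : ℝ, 0 < C₀ ∧ 0 < C₁ ∧ 0 < C₂ ∧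
      ∀ (d m k : ℕ), 2 ≤ d → ∀ (hk : k < m)
        (g : Fin m → ℝ → ℝ) (Z : Fin m → Vec d) (α β γ δ ε σ p : ℝ)
        (Fh : Vec d → Vec d) (N₁ N₂ I : ℕ)
        (π : Equiv.Perm (Fin m)) (s : Fin k → ℝ) (μ : Fin k → Vec d),
        IsBEF g Z →
        IsRobust g α β γ δ →
        Measurable Fh →
        IsGradApprox g Z Fh ε →
        0 < σ →
        σ ≤ 1 / (6 * √(2 * d * (1 + 2 * δ))) * tau α β γ δ m ^ 2 →
        0 < ε →
        ε ≤ C₀ * epsDiverge α β γ δ m (etaZero α β γ δ m d σ) * (d : ℝ) ^ (-δ) →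
        0 < p → p < 1 →
        2 * nSmall α β γ δ ε ≤ (N₁ : ℤ) →
        2 * (nSmall α β γ δ ε : ℝ)
          + C₁ * (nSpread α β γ δ ε m (etaZero α β γ δ m d σ) : ℝ) ≤ (N₂ : ℝ) →
        C₂ * m * (⌈Real.log (m / p)⌉ : ℝ) ≤ (I : ℝ) →
        (∀ i, s i = 1 ∨ s i = -1) →
        (∀ i : Fin k, ‖s i • μ i - Z (π (Fin.castLE hk.le i))‖ ≤ 4 * √2 * δ * ε / β) →
        ∀ P : MeasureTheory.Measure (Vec d), IsFindBasisElementLaw Fh σ N₁ N₂ I μ P →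
          ENNReal.ofReal (1 - p) ≤
            P {v | ∃ t : ℝ, (t = 1 ∨ t = -1) ∧ ∃ j : Fin m, k ≤ (j : ℕ) ∧
              ‖t • v - Z (π j)‖ ≤ 4 * √2 * δ * ε / β} := by
  refine ⟨1 / 100, 16, 21, by norm_num, by norm_num, by norm_num, ?_⟩
  intro d m k hd hk g Z α β γ δ ε σ p Fh N₁ N₂ I π s μ hBEF hrob hFm hF hσ0 hσ hε0 hε hp0 hp1
    _ hN₂ hI _ hμ P hP
  obtain ⟨x, hx, hxμ, l₀, hl₀, rfl⟩ := hP
  have hZ := hBEF.orthonormal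
  obtain ⟨ψ, hψ, hψF⟩ := exists_isNoisyField hBEF hrob hF
  have hadm : Admissible α β γ δ d m := admissible_of_isProfile hrob.α_pos hrob.β_pos
    hrob.γ_pos hrob.δ_pos hd ⟨k, hk⟩ (hψ _)
  obtain ⟨hs, hstart⟩ := hadm.scales hσ0 hσ hε0 hε
  have hsmall := nSmall_nonneg hrob.α_pos hrob.β_pos hrob.γ_pos hrob.δ_pos hs ⟨k, hk⟩
  obtain ⟨hN1, hNs, hNX⟩ := hadm.loop_length hσ0 hsmall hN₂
  obtain ⟨n, rfl, hn⟩ := exists_eq_succ_of_rounds_le hadm.one_le hp0 hp1 hI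
  -- The `x l` are exactly orthogonal to the `μ i`, so only the error of `μ i` contributes.
  have hr : ∀ l, ∀ i ∈ foundSet π k, |inner ℝ (x l) (Z i)| ≤ 4 * √2 * (ε / (β / δ)) := by
    intro l i hi
    rw [mem_foundSet] at hi
    have h1 := hμ ⟨π.symm i, hi⟩
    have h2 : π (Fin.castLE hk.le ⟨π.symm i, hi⟩) = i := by simp
    rw [h2] at h1
    have h3 : inner ℝ (x l) (μ ⟨π.symm i, hi⟩) = 0 := by
      rw [real_inner_comm]
      exact hxμ l _ (Submodule.subset_span (mem_range_self _))
    refine (abs_inner_le_of_norm_smul_sub_le (hx.1 l) h3 h1).trans_eq ?_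
    rw [div_div_eq_mul_div]
    ring
  have hj : π ⟨k, hk⟩ ∉ foundSet π k := by simp [mem_foundSet]
  obtain ⟨hu, hR⟩ := resid_start_le hs hZ hψ hψF hstart hj (card_foundSet π hk.le)
    (hk.trans_le (card_le_of_orthonormal hZ)) hx hr hl₀
  obtain ⟨hu', hR'⟩ := resid_giLoop_le hs hZ hψ hψF hu hR N₁
  have hσ1 : σ ≤ 1 / 12 := by linarith [hs.σ_le, hs.τ_lt_one]
  calc ENNReal.ofReal (1 - p) ≤ ENNReal.ofReal (1 - m * (1 - 1 / 20 / m) ^ n) :=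
        ENNReal.ofReal_le_ofReal (by linarith)
    _ ≤ _ := mainLoopLaw_ge hs hZ hψ hψF hFm hd hadm.one_le hN1
        (half_rpow_le_of_nSmall_le hrob.α_pos hrob.β_pos hrob.γ_pos hrob.δ_pos hε0 hNs)
        (fun hm => hadm.exists_counts hσ0 hσ1 hm hNX) hu' hR' n
    _ ≤ _ := measure_mono (nearBasis_subset hZ π)
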